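/- Consider $n$ items with an unknown underlying strict total order. An algorithm learns about the order only through noisy pairwise comparisons of distinct items: each comparison returns the correct answer with probability $2/3$, independently of all other comparisons (including repetitions of the same comparison). An $r$-round algorithm may use internal randomness; in each of its $r$ rounds it performs a collection of comparisons simultaneously, and the collection may depend on the answers received in the previous rounds; after the last round it outputs a set of items. It solves top-$k$ if, for every underlying order, it outputs the set of the $k$ highest-ranked items with probability at least $2/3$ (over its internal randomness and the noise). Its sample complexity is the worst-case total number of comparisons, over all internal random choices and all answers. Then there is an absolute constant $C$ such that, for all integers $0 \le k \le n$: 1. there is a $1$-round algorithm that solves top-$k$ with sample complexity at most $C n^2$; 2. there is a $2$-round algorithm that solves top-$k$ with sample complexity at most $C n^{4/3}$. -/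

import Mathlib

open scoped ENNReal

/-- An (ordered) pair of distinct items; a comparison is always made between two distinct items. -/
abbrev ItemPair (n : ℕ) : Type := {p : Fin n × Fin n // p.1 ≠ p.2}

/-- The correct answer to the question "does `p.1` rank above `p.2`?" when the underlying order of
the items is `σ`: `σ i` is the position of item `i`, position `0` being the highest rank. -/
def trueAnswer {n : ℕ} (σ : Equiv.Perm (Fin n)) (p : ItemPair n) : Bool :=
  decide (σ p.1.1 < σ p.1.2)

/-- The set of the `k` items with the highest ranks. -/
def topK {n : ℕ} (σ : Equiv.Perm (Fin n)) (k : ℕ) : Finset (Fin n) :=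
  Finset.univ.filter fun i => (σ i : ℕ) < k

/-- The probability that one noisy comparison whose correct answer is `t` returns `b`:
it is correct with probability `2/3`. -/
noncomputable def noisyAnswerProb (t b : Bool) : ℝ≥0∞ := if b = t then 2 / 3 else 1 / 3

theorem sum_noisyAnswerProb (t : Bool) : ∑ b, noisyAnswerProb t b = 1 := by
  have h : (2 / 3 : ℝ≥0∞) + 1 / 3 = 1 := by
    rw [ENNReal.div_add_div_same, show (2 : ℝ≥0∞) + 1 = 3 by norm_num]
    exact ENNReal.div_self (by norm_num) (by norm_num)
  cases t
  · simpa [noisyAnswerProb, add_comm] using h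
  · simpa [noisyAnswerProb] using h

/-- The joint law of the answers to `m` simultaneous comparisons `q 0, …, q (m - 1)`
(the same pair may be listed several times): the answers are independent, and each one is correct
with probability `2/3`. -/
noncomputable def answerLaw {n m : ℕ} (σ : Equiv.Perm (Fin n)) (q : Fin m → ItemPair n) :
    PMF (Fin m → Bool) :=
  PMF.ofFintype (fun a => ∏ i, noisyAnswerProb (trueAnswer σ (q i)) (a i)) (by
    rw [← Fintype.prod_sum]
    simp only [sum_noisyAnswerProb, Finset.prod_const_one])

/-- A deterministic comparison algorithm on `n` items with `r` rounds that outputs a set of items.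
In each round it performs `m` comparisons simultaneously; what it does afterwards may depend on
their answers. After the last round it outputs a set. -/
inductive DetAlgorithm (n : ℕ) : ℕ → Type
  | output (S : Finset (Fin n)) : DetAlgorithm n 0
  | round {r : ℕ} (m : ℕ) (q : Fin m → ItemPair n)
      (next : (Fin m → Bool) → DetAlgorithm n r) : DetAlgorithm n (r + 1)

namespace DetAlgorithm

/-- The law of the output of the algorithm when the underlying order is `σ`; the noise is
independent across all comparisons, in the same round and in different rounds. -/
noncomputable def outputLaw {n : ℕ} (σ : Equiv.Perm (Fin n)) :
    {r : ℕ} → DetAlgorithm n r → PMF (Finset (Fin n))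
  | _, output S => PMF.pure S
  | _, round _ q next => (answerLaw σ q).bind fun a => outputLaw σ (next a)

/-- The worst-case total number of comparisons, over all possible answers. -/
def maxComparisons {n : ℕ} : {r : ℕ} → DetAlgorithm n r → ℕ
  | _, output _ => 0
  | _, round m _ next => m + Finset.univ.sup fun a => maxComparisons (next a)

end DetAlgorithm

/-- A randomized algorithm with `r` rounds: a probability distribution on deterministic algorithms
with `r` rounds (all internal random choices, including those used in later rounds, are
drawn in advance, independently of the noise). -/
abbrev RandAlgorithm (n r : ℕ) : Type := PMF (DetAlgorithm n r)

namespace RandAlgorithm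

/-- The law of the output when the underlying order is `σ`, over the internal randomness and
the noise of the comparisons. -/
noncomputable def outputLaw {n r : ℕ} (A : RandAlgorithm n r) (σ : Equiv.Perm (Fin n)) :
    PMF (Finset (Fin n)) :=
  A.bind fun D => D.outputLaw σ

/-- The algorithm never makes more than `s` comparisons in total, whatever its internal random
choices and the answers are. -/
def ComparisonsLE {n r : ℕ} (A : RandAlgorithm n r) (s : ℝ) : Prop :=
  ∀ D ∈ A.support, (D.maxComparisons : ℝ) ≤ s

/-- For every underlying order, the output is the set of top-`k` items with probability at
least `2/3`. -/
def SolvesTopK {n r : ℕ} (A : RandAlgorithm n r) (k : ℕ) : Prop :=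
  ∀ σ : Equiv.Perm (Fin n), 2 / 3 ≤ A.outputLaw σ (topK σ k)

end RandAlgorithm

/-! Majority votes over a constant odd number of repetitions turn every comparison into the truth
xored with an independent error of tiny constant probability `η`. Items carry signed ranks `f`
running over `-a, …, b - 1`, the top set being the negative ranks.

Decoding (`neg_iff_of_consistent`) is deterministic. After the first round each item has a level.
Level `0` is the core, of size `O(N)`; all pairs in the core are compared. An item of level `t` with
`1 ≤ t < L` is compared with a random core sample of rate `2 ^ (-t)`. Items of level `L` are
assigned to a side without further comparisons. The decoder outputs the top set of any ranking that
passes a list of counting tests (`Consistent`), chiefly that near the boundary, at every scale `D ≤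
N`, each item has at most a small fraction of `D` erroneous comparisons. Two rankings that pass have
the same negative items. The proof is a descending induction on `D` showing that no unresolved item
at distance `D` from the boundary in one of them is on the wrong side in the other. A comparison on
which the two rankings disagree is an error for one of them, so a misplaced item would force more
errors than the tests allow.

It remains to see that the true ranking passes. In the second round (`second_round`) a Chernoff
bound is applied for each item and scale, followed by a union bound. Core items fail with
probability exponentially small in `D`, which beats the `O(D)` items involved. An item of level `t`
fails with probability only about `exp (-D / 2 ^ t)`, so such items must be rare near the boundary;
this is the field `risk` of `GoodLevels`.

Levels come from random pivots, compared with all items in the first round (`prob_not_goodPivots`,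
`prob_rankEst`, `prob_not_goodLevels`). Comparisons with all `n` items locate each pivot up to `N`,
well above `√n`. An item gets level `j` if it wins (or loses) clearly against the pivots within `j`
units of `256 * N` above (or below) the boundary, `j` maximal. A misleading verdict at scale `j`
needs order `j` errors and has probability at most `exp (-400 j)`. So the level is about the
distance in units, items near the boundary rarely leave the core, and the geometric sampling rates
keep the second round at `O(N ^ 2)` comparisons.

With `m` of order `n / N` pivots the cost is of order `n ^ 2 / N + N ^ 2`, balanced at `N` of order
`n ^ (2/3)`. Taking every item as core gives the one-round algorithm. -/

/-! ### Finite probability spaces, product weights and Chernoff bounds -/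

namespace FinProb

open scoped Classical in
/-- The probability of an event under a weight function on a finite type. -/
noncomputable def prob {Ω : Type*} [Fintype Ω] (w : Ω → ℝ) (S : Ω → Prop) : ℝ :=
  ∑ ω, w ω * (if S ω then 1 else 0)

/-- The expectation of a function under a weight function on a finite type. -/
def expect {Ω : Type*} [Fintype Ω] (w g : Ω → ℝ) : ℝ := ∑ ω, w ω * g ω

/-- A probability weight: nonnegative, of total mass one. -/
structure IsWeight {Ω : Type*} [Fintype Ω] (w : Ω → ℝ) : Prop where
  nonneg : ∀ ω, 0 ≤ w ω
  sum_one : ∑ ω, w ω = 1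

/-- The product of two weights. -/
def prodW {α β : Type*} (u : α → ℝ) (v : β → ℝ) : α × β → ℝ := fun p => u p.1 * v p.2

/-- The weight of independent identically distributed coordinates. -/
def piW (ι : Type*) [Fintype ι] {α : Type*} (w : α → ℝ) : (ι → α) → ℝ := fun ω => ∏ i, w (ω i)

/-- The uniform weight. -/
noncomputable def unifW (α : Type*) [Fintype α] : α → ℝ := fun _ => (Fintype.card α : ℝ)⁻¹

/-- The weight of a coin that shows `true` with probability `η`. -/
def coinW (η : ℝ) : Bool → ℝ := fun b => if b then η else 1 - η

section basic

variable {Ω : Type*} [Fintype Ω] {w : Ω → ℝ}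

theorem prob_def (w : Ω → ℝ) (S : Ω → Prop) [DecidablePred S] :
    prob w S = ∑ ω, w ω * (if S ω then 1 else 0) := by
  unfold prob
  congr! 3

theorem prob_eq_expect (w : Ω → ℝ) (S : Ω → Prop) [DecidablePred S] :
    prob w S = expect w (fun ω => if S ω then 1 else 0) := prob_def w S

theorem expect_mono (hw : IsWeight w) {g h : Ω → ℝ} (hgh : ∀ ω, g ω ≤ h ω) :
    expect w g ≤ expect w h :=
  Finset.sum_le_sum fun ω _ => mul_le_mul_of_nonneg_left (hgh ω) (hw.nonneg ω)

theorem expect_nonneg (hw : IsWeight w) {g : Ω → ℝ} (hg : ∀ ω, 0 ≤ g ω) : 0 ≤ expect w g :=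
  Finset.sum_nonneg fun ω _ => mul_nonneg (hw.nonneg ω) (hg ω)

theorem expect_add (g h : Ω → ℝ) :
    expect w (fun ω => g ω + h ω) = expect w g + expect w h := by
  simp [expect, mul_add, Finset.sum_add_distrib]

theorem expect_const_mul (c : ℝ) (g : Ω → ℝ) :
    expect w (fun ω => c * g ω) = c * expect w g := by
  simp only [expect, Finset.mul_sum]
  exact Finset.sum_congr rfl fun _ _ => by ring

theorem expect_const (hw : IsWeight w) (c : ℝ) : expect w (fun _ => c) = c := by
  simp [expect, ← Finset.sum_mul, hw.sum_one]

theorem expect_sum {ι : Type*} (s : Finset ι) (g : ι → Ω → ℝ) :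
    expect w (fun ω => ∑ i ∈ s, g i ω) = ∑ i ∈ s, expect w (g i) := by
  simp only [expect, Finset.mul_sum]
  exact Finset.sum_comm

theorem prob_mono (hw : IsWeight w) {S T : Ω → Prop} (h : ∀ ω, S ω → T ω) :
    prob w S ≤ prob w T := by
  classical
  rw [prob_eq_expect, prob_eq_expect]
  refine expect_mono hw fun ω => ?_
  by_cases hS : S ω
  · simp [hS, h ω hS]
  · simp only [hS, if_false]; split_ifs <;> norm_num

theorem prob_nonneg (hw : IsWeight w) (S : Ω → Prop) : 0 ≤ prob w S := by
  classical
  rw [prob_eq_expect]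
  exact expect_nonneg hw fun ω => by split_ifs <;> norm_num

theorem prob_le_one (hw : IsWeight w) (S : Ω → Prop) : prob w S ≤ 1 := by
  classical
  rw [prob_eq_expect]
  exact (expect_mono hw fun ω => by split_ifs <;> norm_num).trans_eq (expect_const hw 1)

theorem prob_false (w : Ω → ℝ) : prob w (fun _ => False) = 0 := by simp [prob]

theorem prob_or_le (hw : IsWeight w) (S T : Ω → Prop) :
    prob w (fun ω => S ω ∨ T ω) ≤ prob w S + prob w T := by
  classical
  rw [prob_eq_expect, prob_eq_expect, prob_eq_expect, ← expect_add]
  refine expect_mono hw fun ω => ?_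
  by_cases h1 : S ω <;> by_cases h2 : T ω <;> simp [h1, h2]

theorem prob_exists_le {ι : Type*} (hw : IsWeight w) (s : Finset ι) (S : ι → Ω → Prop) :
    prob w (fun ω => ∃ i ∈ s, S i ω) ≤ ∑ i ∈ s, prob w (S i) := by
  classical
  simp only [prob_eq_expect]
  rw [← expect_sum]
  refine expect_mono hw fun ω => ?_
  split_ifs with h
  · obtain ⟨i, hi, hS⟩ := h
    calc (1 : ℝ) = if S i ω then 1 else 0 := by simp [hS]
      _ ≤ _ := Finset.single_le_sum (f := fun i => if S i ω then (1 : ℝ) else 0)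
          (fun j _ => by split_ifs <;> norm_num) hi
  · exact Finset.sum_nonneg fun j _ => by split_ifs <;> norm_num

theorem prob_not (hw : IsWeight w) (S : Ω → Prop) : prob w (fun ω => ¬ S ω) = 1 - prob w S := by
  classical
  rw [eq_sub_iff_add_eq, prob_eq_expect, prob_eq_expect, ← expect_add]
  refine Eq.trans ?_ (expect_const hw 1)
  congr 1
  funext ω
  by_cases h : S ω <;> simp [h]

/-- Markov's inequality. -/
theorem prob_le_expect_div (hw : IsWeight w) {g : Ω → ℝ} (hg : ∀ ω, 0 ≤ g ω) {r : ℝ}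
    (hr : 0 < r) : prob w (fun ω => r ≤ g ω) ≤ expect w g / r := by
  classical
  rw [le_div_iff₀ hr, mul_comm, prob_eq_expect, ← expect_const_mul]
  refine expect_mono hw fun ω => ?_
  split_ifs with h
  · simpa using h
  · simpa using hg ω

end basic

section prod

variable {α β : Type*} [Fintype α] [Fintype β] {u : α → ℝ} {v : β → ℝ}

theorem expect_prodW (g : α × β → ℝ) :
    expect (prodW u v) g = expect u (fun a => expect v (fun b => g (a, b))) := by
  simp only [expect, prodW, Fintype.sum_prod_type, Finset.mul_sum, mul_assoc]

theorem IsWeight.prodW (hu : IsWeight u) (hv : IsWeight v) : IsWeight (prodW u v) where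
  nonneg p := mul_nonneg (hu.nonneg _) (hv.nonneg _)
  sum_one := by
    simp only [FinProb.prodW, Fintype.sum_prod_type, ← Finset.mul_sum, hv.sum_one, mul_one,
      hu.sum_one]

theorem prob_prodW (S : α × β → Prop) :
    prob (prodW u v) S = expect u (fun a => prob v (fun b => S (a, b))) := by
  classical
  rw [prob_eq_expect, expect_prodW]
  simp only [prob_eq_expect]

theorem prob_prodW_and (S : α → Prop) (T : β → Prop) :
    prob (prodW u v) (fun p => S p.1 ∧ T p.2) = prob u S * prob v T := by
  classical
  rw [prob_prodW, prob_eq_expect u, mul_comm, ← expect_const_mul]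
  congr 1
  funext a
  by_cases h : S a <;> simp [h, prob_false]

/-- Conditioning on the first coordinate: a bad value of it is charged to `¬ G`, a good one leaves
at most `ε`. The stages of the algorithm are chained by this. -/
theorem prob_prodW_le (hu : IsWeight u) (hv : IsWeight v) (S : α × β → Prop) (G : α → Prop)
    {ε : ℝ} (hε : 0 ≤ ε) (h : ∀ a, G a → prob v (fun b => S (a, b)) ≤ ε) :
    prob (prodW u v) S ≤ prob u (fun a => ¬ G a) + ε := by
  classical
  rw [prob_prodW, prob_eq_expect u, ← expect_const hu ε, ← expect_add]
  refine expect_mono hu fun a => ?_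
  by_cases hG : G a
  · simpa [hG] using h a hG
  · simpa [hG] using (prob_le_one hv _).trans (by linarith)

theorem prob_prodW_fst (hv : IsWeight v) (S : α → Prop) :
    prob (prodW u v) (fun p => S p.1) = prob u S := by
  have := prob_prodW_and (u := u) (v := v) S (fun _ => True)
  simp only [and_true] at this
  rw [this]
  simp [prob, hv.sum_one]

end prod

section pi

variable {ι α : Type*} [Fintype ι] [Fintype α] {w : α → ℝ}

theorem expect_piW_prod [DecidableEq ι] (g : ι → α → ℝ) :
    expect (piW ι w) (fun ω => ∏ i, g i (ω i)) = ∏ i, expect w (g i) := by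
  simp only [expect, piW, ← Finset.prod_mul_distrib]
  exact (Fintype.prod_sum fun i a => w a * g i a).symm

theorem IsWeight.piW [DecidableEq ι] (hw : IsWeight w) : IsWeight (FinProb.piW ι w) where
  nonneg ω := Finset.prod_nonneg fun i _ => hw.nonneg _
  sum_one := by
    have := expect_piW_prod (ι := ι) (w := w) (fun _ _ => 1)
    simpa [expect, hw.sum_one] using this

theorem prob_piW_apply [DecidableEq ι] (hw : IsWeight w) (i : ι) (S : α → Prop) :
    prob (piW ι w) (fun ω => S (ω i)) = prob w S := by
  classical
  have := expect_piW_prod (w := w) (fun j a => if j = i then (if S a then (1 : ℝ) else 0) else 1)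
  rw [prob_eq_expect, prob_eq_expect]
  have h1 : ∀ ω : ι → α, (∏ j, if j = i then (if S (ω j) then (1 : ℝ) else 0) else 1)
      = if S (ω i) then 1 else 0 := by
    intro ω
    rw [Finset.prod_ite_eq' Finset.univ i (fun j => if S (ω j) then (1 : ℝ) else 0)]
    simp
  simp only [h1] at this
  rw [this, Finset.prod_eq_single i]
  · simp
  · intro j _ hj
    simp [hj, expect_const hw]
  · simp

theorem isWeight_unifW (α : Type*) [Fintype α] [Nonempty α] : IsWeight (unifW α) where
  nonneg _ := by unfold unifW; positivity
  sum_one := by simp [unifW]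

theorem prob_unifW (S : α → Prop) [DecidablePred S] :
    prob (unifW α) S = (Finset.univ.filter S).card / Fintype.card α := by
  rw [prob_def]
  simp only [unifW]
  rw [← Finset.mul_sum, div_eq_inv_mul]
  simp

theorem isWeight_coinW {η : ℝ} (h0 : 0 ≤ η) (h1 : η ≤ 1) : IsWeight (coinW η) where
  nonneg b := by cases b <;> simp [coinW] <;> linarith
  sum_one := by simp [coinW]

theorem prob_coinW (η : ℝ) : prob (coinW η) (fun b => b = true) = η := by
  simp [prob, coinW]

/-- The exponential moment method. -/
theorem prob_le_exp_moment [DecidableEq ι] (hw : IsWeight w) (g : ι → α → ℝ) (r : ℝ) (b : ι → ℝ)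
    (hb : ∀ i, expect w (fun a => Real.exp (g i a)) ≤ Real.exp (b i)) :
    prob (piW ι w) (fun ω => r ≤ ∑ i, g i (ω i)) ≤ Real.exp (-r + ∑ i, b i) := by
  have h1 : prob (piW ι w) (fun ω => r ≤ ∑ i, g i (ω i)) ≤
      prob (piW ι w) (fun ω => Real.exp r ≤ ∏ i, Real.exp (g i (ω i))) := by
    refine prob_mono hw.piW fun ω h => ?_
    rw [← Real.exp_sum]
    exact Real.exp_le_exp.2 h
  refine h1.trans ((prob_le_expect_div hw.piW
    (fun ω => Finset.prod_nonneg fun i _ => (Real.exp_pos _).le) (Real.exp_pos r)).trans ?_)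
  rw [expect_piW_prod (fun i a => Real.exp (g i a)), Real.exp_add, Real.exp_neg, Real.exp_sum,
    div_eq_inv_mul]
  refine mul_le_mul_of_nonneg_left ?_ (inv_nonneg.2 (Real.exp_pos r).le)
  exact Finset.prod_le_prod (fun i _ => expect_nonneg hw fun a => (Real.exp_pos _).le)
    fun i _ => hb i

open scoped Classical in
-- Chernoff with `1 + (exp l - 1) q ≤ exp (exp l * q)`. The parameter `l` stays free because rare
-- events need a very large one to give a steep tail.
theorem upper_tail [DecidableEq ι] (hw : IsWeight w) (A : Finset ι) (S : ι → α → Prop) {q l r : ℝ}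
    (hl : 0 ≤ l) (hS : ∀ i ∈ A, prob w (S i) ≤ q) :
    prob (piW ι w) (fun ω => r ≤ ((A.filter fun i => S i (ω i)).card : ℝ)) ≤
      Real.exp (-(l * r) + Real.exp l * q * A.card) := by
  have key := prob_le_exp_moment (ι := ι) hw
    (fun i a => if i ∈ A ∧ S i a then l else 0) (l * r)
    (fun i => if i ∈ A then Real.exp l * q else 0) (by
      intro i
      by_cases hi : i ∈ A
      · simp only [hi, true_and, if_true]
        have h1 : ∀ a, Real.exp (if S i a then l else 0)
            = 1 + (Real.exp l - 1) * (if S i a then 1 else 0) := by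
          intro a; split_ifs <;> simp
        simp only [h1]
        rw [expect_add, expect_const hw, expect_const_mul, ← prob_eq_expect]
        have h2 : 0 ≤ Real.exp l - 1 := by linarith [Real.add_one_le_exp l]
        have h3 := prob_nonneg hw (S i)
        have h4 := hS i hi
        have h5 := Real.add_one_le_exp (Real.exp l * q)
        nlinarith
      · simp [hi, expect_const hw])
  have h2 : (∑ i, if i ∈ A then Real.exp l * q else 0) = Real.exp l * q * A.card := by
    simp [Finset.sum_ite_mem, mul_comm]
  rw [h2] at key
  refine le_trans (prob_mono hw.piW fun ω h => ?_) key
  have h3 : (∑ i, if i ∈ A ∧ S i (ω i) then l else 0)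
      = l * ((A.filter fun i => S i (ω i)).card : ℝ) := by
    rw [← Finset.sum_filter, Finset.sum_const, nsmul_eq_mul, mul_comm]
    congr 3
    ext i; simp
  rw [h3]
  exact mul_le_mul_of_nonneg_left h hl

open scoped Classical in
-- The exponential moment at parameter `-1`, with `1 - exp (-1) ≥ 3 / 5`.
theorem lower_tail [DecidableEq ι] (hw : IsWeight w) (A : Finset ι) (S : ι → α → Prop) {q r : ℝ}
    (hS : ∀ i ∈ A, q ≤ prob w (S i)) :
    prob (piW ι w) (fun ω => ((A.filter fun i => S i (ω i)).card : ℝ) ≤ r) ≤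
      Real.exp (r - 3 / 5 * q * A.card) := by
  have he : Real.exp (-1) ≤ 2 / 5 := by
    have h := Real.exp_one_gt_d9
    rw [Real.exp_neg]
    rw [inv_le_comm₀ (Real.exp_pos 1) (by norm_num)]
    linarith
  have key := prob_le_exp_moment (ι := ι) hw
    (fun i a => if i ∈ A ∧ S i a then -1 else 0) (-r)
    (fun i => if i ∈ A then -(3 / 5 * q) else 0) (by
      intro i
      by_cases hi : i ∈ A
      · simp only [hi, true_and, if_true]
        have h1 : ∀ a, Real.exp (if S i a then -1 else 0)
            = 1 + (Real.exp (-1) - 1) * (if S i a then 1 else 0) := by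
          intro a; split_ifs <;> simp
        simp only [h1]
        rw [expect_add, expect_const hw, expect_const_mul, ← prob_eq_expect]
        have h3 := prob_nonneg hw (S i)
        have h4 := hS i hi
        have h5 := Real.add_one_le_exp (-(3 / 5 * q))
        nlinarith
      · simp [hi, expect_const hw])
  have h2 : (∑ i, if i ∈ A then -(3 / 5 * q) else 0) = -(3 / 5 * q * A.card) := by
    simp [Finset.sum_ite_mem, mul_comm]
  rw [h2] at key
  refine le_trans (prob_mono hw.piW fun ω h => ?_) (key.trans_eq ?_)
  · have h3 : (∑ i, if i ∈ A ∧ S i (ω i) then (-1 : ℝ) else 0)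
        = -((A.filter fun i => S i (ω i)).card : ℝ) := by
      rw [← Finset.sum_filter, Finset.sum_const, nsmul_eq_mul, mul_neg_one]
      congr 3
      ext i; simp
    rw [h3]
    linarith
  · congr 1; ring

/-- A two-sided deviation bound for sums of independent centred variables. -/
theorem deviation_bound [DecidableEq ι] (hw : IsWeight w) (h : ι → α → ℝ)
    (h1 : ∀ i a, |h i a| ≤ 1) (h0 : ∀ i, expect w (h i) = 0) {l r : ℝ} (hl : 0 < l) (hl1 : l ≤ 1) :
    prob (piW ι w) (fun ω => r ≤ |∑ i, h i (ω i)|) ≤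
      2 * Real.exp (-(l * r) + l ^ 2 * Fintype.card ι) := by
  have one_side : ∀ s : ℝ, |s| = l →
      prob (piW ι w) (fun ω => l * r ≤ s * ∑ i, h i (ω i)) ≤
        Real.exp (-(l * r) + l ^ 2 * Fintype.card ι) := by
    intro s hs
    have key := prob_le_exp_moment (ι := ι) hw (fun i a => s * h i a) (l * r)
      (fun _ => l ^ 2) (by
        intro i
        -- This is `exp x ≤ 1 + x + x ^ 2` for `|x| ≤ 1`; the linear term then vanishes in
        -- expectation.
        have hb : ∀ a, Real.exp (s * h i a) ≤ (1 + l ^ 2) + s * h i a := by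
          intro a
          have hx : |s * h i a| ≤ 1 := by
            rw [abs_mul, hs]
            have := h1 i a
            nlinarith [abs_nonneg (h i a)]
          have h2 := Real.abs_exp_sub_one_sub_id_le hx
          have h3 := (abs_le.1 h2).2
          have h4 : (s * h i a) ^ 2 ≤ l ^ 2 := by
            rw [mul_pow, ← sq_abs s, hs, ← sq_abs (h i a)]
            have := h1 i a
            have h5 : |h i a| ^ 2 ≤ 1 := by nlinarith [abs_nonneg (h i a)]
            nlinarith [sq_nonneg l]
          linarith
        refine (expect_mono hw hb).trans ?_
        rw [expect_add, expect_const hw, expect_const_mul, h0, mul_zero, add_zero]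
        linarith [Real.add_one_le_exp (l ^ 2)])
    simp only [← Finset.mul_sum, Finset.sum_const, Finset.card_univ, nsmul_eq_mul] at key
    rwa [mul_comm (l ^ 2)]
  have hsub : prob (piW ι w) (fun ω => r ≤ |∑ i, h i (ω i)|) ≤
      prob (piW ι w) (fun ω => l * r ≤ l * ∑ i, h i (ω i) ∨ l * r ≤ (-l) * ∑ i, h i (ω i)) := by
    refine prob_mono hw.piW fun ω hω => ?_
    rcases le_abs.1 hω with h | h
    · exact Or.inl (mul_le_mul_of_nonneg_left h hl.le)
    · exact Or.inr (by rw [neg_mul, ← mul_neg]; exact mul_le_mul_of_nonneg_left h hl.le)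
  refine hsub.trans ((prob_or_le hw.piW _ _).trans ?_)
  have e1 := one_side l (abs_of_pos hl)
  have e2 := one_side (-l) (by rw [abs_neg, abs_of_pos hl])
  linarith

end pi

end FinProb

/-! ### Deterministic decoding: consistent rankings have the same top set -/

namespace Decoding

variable {V : Type*}

/-- The distance of an item from the boundary between negative and nonnegative ranks. -/
def sdist (f : V → ℤ) (x : V) : ℤ := max (-f x) (f x + 1)

/-- The ranking read from the other end. -/
def flip (f : V → ℤ) : V → ℤ := fun x => -1 - f x

theorem flip_flip (f : V → ℤ) : flip (flip f) = f := by
  funext x; simp only [flip]; ring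

theorem sdist_flip (f : V → ℤ) : sdist (flip f) = sdist f := by
  funext x; simp only [sdist, flip]; rw [max_comm]; congr 1 <;> ring

/-- A bijective ranking of the items by the integers `-a, …, b - 1`. -/
structure IsRanking (a b : ℤ) (f : V → ℤ) : Prop where
  inj : Function.Injective f
  lower : ∀ x, -a ≤ f x
  upper : ∀ x, f x < b
  surj : ∀ z, -a ≤ z → z < b → ∃ x, f x = z

theorem IsRanking.flip {a b : ℤ} {f : V → ℤ} (h : IsRanking a b f) :
    IsRanking b a (flip f) where
  inj x y hxy := h.inj (by simp only [Decoding.flip] at hxy; omega)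
  lower x := by have := h.upper x; simp only [Decoding.flip]; omega
  upper x := by have := h.lower x; simp only [Decoding.flip]; omega
  surj z h1 h2 := by
    obtain ⟨x, hx⟩ := h.surj (-1 - z) (by omega) (by omega)
    exact ⟨x, by simp only [Decoding.flip]; omega⟩

theorem IsRanking.card_interval [Fintype V] {a b : ℤ} {f : V → ℤ} (h : IsRanking a b f) {l u : ℤ}
    (hl : -a ≤ l) (hlu : l ≤ u) (hu : u ≤ b) :
    ((Finset.univ.filter fun x => l ≤ f x ∧ f x < u).card : ℤ) = u - l := by
  have h1 : ((Finset.univ.filter fun x => l ≤ f x ∧ f x < u).image f) = Finset.Ico l u := by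
    ext z
    simp only [Finset.mem_image, Finset.mem_filter, Finset.mem_univ, true_and, Finset.mem_Ico]
    constructor
    · rintro ⟨x, hx, rfl⟩; exact hx
    · intro hz
      obtain ⟨x, hx⟩ := h.surj z (by omega) (by omega)
      exact ⟨x, by rw [hx]; exact hz, hx⟩
  have h2 := Finset.card_image_of_injective
    (Finset.univ.filter fun x => l ≤ f x ∧ f x < u) h.inj
  rw [h1, Int.card_Ico] at h2
  rw [← h2]
  omega

/-- No unresolved item at distance `D` above the boundary in `f` is displaced too far in `g`. -/
def Clean (L : ℕ) (lev : V → ℕ) (f g : V → ℤ) (D : ℤ) : Prop :=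
  (∀ x, lev x = 0 → f x ≤ -D → 2 * g x < -D) ∧
    (∀ x, 1 ≤ lev x → lev x < L → f x ≤ -D → g x < 0)

/-- `Clean` for both directions and both ends. -/
def AllClean (L : ℕ) (lev : V → ℕ) (f g : V → ℤ) (D : ℤ) : Prop :=
  (Clean L lev f g D ∧ Clean L lev g f D) ∧
    (Clean L lev (flip f) (flip g) D ∧ Clean L lev (flip g) (flip f) D)

theorem AllClean.swap {L : ℕ} {lev : V → ℕ} {f g : V → ℤ} {D : ℤ} (h : AllClean L lev f g D) :
    AllClean L lev g f D :=
  ⟨⟨h.1.2, h.1.1⟩, ⟨h.2.2, h.2.1⟩⟩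

theorem AllClean.flip {L : ℕ} {lev : V → ℕ} {f g : V → ℤ} {D : ℤ} (h : AllClean L lev f g D) :
    AllClean L lev (flip f) (flip g) D := by
  refine ⟨h.2, ?_⟩
  rw [flip_flip, flip_flip]; exact h.1

variable [Fintype V]

open scoped Classical in
/-- The ranking `f` is consistent with the data: an item `x` carries a level `lev x` and a
provisional side; items of level `0` form the core, and items of level at least `L` are resolved.
Every unresolved item `x` is compared with the core items `y` with `Q (lev x) y`, and `R x y` says
that `x` was reported to rank above `y`. -/
structure Consistent (N : ℤ) (L : ℕ) (lev : V → ℕ) (side : V → Prop) (Q : ℕ → V → Prop)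
    (R : V → V → Prop) (a b : ℤ) (f : V → ℤ) : Prop where
  few_outer : ∀ D, 1 ≤ D → D ≤ N →
    32 * ((Finset.univ.filter fun v => lev v ≠ 0 ∧ sdist f v ≤ D).card : ℤ) ≤ D
  few_wrong : 32 * ((Finset.univ.filter fun v => lev v ≠ 0 ∧ ¬ (side v ↔ f v < 0)).card : ℤ) ≤ N
  resolved : ∀ v, L ≤ lev v → (side v ↔ f v < 0)
  errors : ∀ x, lev x < L → ∀ D, 1 ≤ D → D ≤ N → min (sdist f x) N ≤ D →
    32 * 2 ^ lev x * ((Finset.univ.filter fun y => lev y = 0 ∧ y ≠ x ∧ Q (lev x) y ∧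
      min (sdist f y) N ≤ D ∧ (R x y ↔ ¬ f x < f y)).card : ℤ) ≤ D
  samples_top : ∀ x, 1 ≤ lev x → lev x < L → ∀ D, 32 ≤ D → D ≤ N → min (sdist f x) N ≤ D →
    D ≤ a → D < 8 * 2 ^ lev x * ((Finset.univ.filter fun y => lev y = 0 ∧ Q (lev x) y ∧
      -D ≤ 2 * f y ∧ f y < 0).card : ℤ)
  samples_bot : ∀ x, 1 ≤ lev x → lev x < L → ∀ D, 32 ≤ D → D ≤ N → min (sdist f x) N ≤ D →
    D ≤ b → D < 8 * 2 ^ lev x * ((Finset.univ.filter fun y => lev y = 0 ∧ Q (lev x) y ∧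
      0 ≤ f y ∧ 2 * f y ≤ D - 2).card : ℤ)

variable {N : ℤ} {L : ℕ} {lev : V → ℕ} {side : V → Prop} {Q : ℕ → V → Prop}
  {R : V → V → Prop} {a b : ℤ} {f g : V → ℤ}

theorem Consistent.flip (hf : IsRanking a b f) (h : Consistent N L lev side Q R a b f) :
    Consistent N L lev (fun v => ¬ side v) Q (fun x y => ¬ R x y) b a (flip f) where
  few_outer D h1 h2 := by rw [sdist_flip]; exact h.few_outer D h1 h2
  few_wrong := by
    convert h.few_wrong using 6
    rename_i v _
    have h4 : Decoding.flip f v < 0 ↔ ¬ f v < 0 := by simp only [Decoding.flip]; omega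
    rw [h4]
    tauto
  resolved v hv := by
    have := h.resolved v hv
    rw [this]; simp only [Decoding.flip]; omega
  errors x hx D h1 h2 h3 := by
    rw [sdist_flip] at h3 ⊢
    convert h.errors x hx D h1 h2 h3 using 6
    rename_i y _
    by_cases hy : y = x
    · simp [hy]
    · have : f y ≠ f x := fun e => hy (hf.inj e)
      have h4 : (Decoding.flip f x < Decoding.flip f y) ↔ ¬ f x < f y := by
        simp only [Decoding.flip]; omega
      rw [h4]
      by_cases hR : R x y <;> by_cases hlt : f x < f y <;> simp [hR, hlt]
  samples_top x h0 hx D h1 h2 h3 h4 := by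
    rw [sdist_flip] at h3
    convert h.samples_bot x h0 hx D h1 h2 h3 h4 using 7
    simp only [Decoding.flip]
    omega
  samples_bot x h0 hx D h1 h2 h3 h4 := by
    rw [sdist_flip] at h3
    convert h.samples_top x h0 hx D h1 h2 h3 h4 using 7
    simp only [Decoding.flip]
    omega

open scoped Classical in
-- Suppose a core item `x` has `f x ≤ -D` but `-D ≤ 2 * g x`. At least `D / 2` items lie in `g`
-- between `-D` and the middle of that range, all above `x`. Those that are core and below `x` in
-- `f` are errors of `x` for `f` or for `g`, hence few; so nearly all lie above `-D` in `f`, and `g`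
-- pushes them down across `-D`. Counting shows that `g` moves equally many items up across `-D`. A
-- single item `u` pushed down is inverted with every core item moved up, and this makes too many
-- errors at `u`. The induction hypothesis serves to place all these items within the scale at which
-- errors are counted.
theorem clean_core (hL : 1 ≤ L) (hQ : ∀ y, Q 0 y)
    (hf : IsRanking a b f) (hg : IsRanking a b g)
    (cf : Consistent N L lev side Q R a b f) (cg : Consistent N L lev side Q R a b g)
    {D : ℤ} (hD : 1 ≤ D) (hDN : D ≤ N)
    (ih : ∀ D', D < D' → D' ≤ N → AllClean L lev f g D')
    (x : V) (hx : lev x = 0) (hfx : f x ≤ -D) : 2 * g x < -D := by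
  by_contra hgx
  push Not at hgx
  have hDa : D ≤ a := by have := hf.lower x; omega
  have i1 : ∀ y, lev y = 0 → ∀ D', D < D' → D' ≤ N → f y ≤ -D' → 2 * g y < -D' :=
    fun y hy D' h1 h2 h3 => (ih D' h1 h2).1.1.1 y hy h3
  have i2 : ∀ y, lev y = 0 → ∀ D', D < D' → D' ≤ N → g y ≤ -D' → 2 * f y < -D' :=
    fun y hy D' h1 h2 h3 => (ih D' h1 h2).1.2.1 y hy h3
  have i3 : ∀ y, lev y = 0 → ∀ D', D < D' → D' ≤ N → D' - 1 ≤ f y → D' - 1 ≤ 2 * g y := by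
    intro y hy D' h1 h2 h3
    have := (ih D' h1 h2).2.1.1 y hy (by simp only [flip]; omega)
    simp only [flip] at this; omega
  have i4 : ∀ y, lev y = 0 → ∀ D', D < D' → D' ≤ N → D' - 1 ≤ g y → D' - 1 ≤ 2 * f y := by
    intro y hy D' h1 h2 h3
    have := (ih D' h1 h2).2.2.1 y hy (by simp only [flip]; omega)
    simp only [flip] at this; omega
  have r3 : ∀ y, 1 ≤ lev y → lev y < L → ∀ D', D < D' → D' ≤ N → D' - 1 ≤ f y → 0 ≤ g y := by
    intro y hy hy' D' h1 h2 h3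
    have := (ih D' h1 h2).2.1.2 y hy hy' (by simp only [flip]; omega)
    simp only [flip] at this; omega
  -- errors of core items
  have ef : ∀ u, lev u = 0 → ∀ E, 1 ≤ E → E ≤ N → min (sdist f u) N ≤ E →
      32 * ((Finset.univ.filter fun y => lev y = 0 ∧ y ≠ u ∧
        min (sdist f y) N ≤ E ∧ (R u y ↔ ¬ f u < f y)).card : ℤ) ≤ E := by
    intro u hu E h1 h2 h3
    have := cf.errors u (by omega) E h1 h2 h3
    simpa [hu, hQ] using this
  have eg : ∀ u, lev u = 0 → ∀ E, 1 ≤ E → E ≤ N → min (sdist g u) N ≤ E →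
      32 * ((Finset.univ.filter fun y => lev y = 0 ∧ y ≠ u ∧
        min (sdist g y) N ≤ E ∧ (R u y ↔ ¬ g u < g y)).card : ℤ) ≤ E := by
    intro u hu E h1 h2 h3
    have := cg.errors u (by omega) E h1 h2 h3
    simpa [hu, hQ] using this
  -- the item `x` itself is within the scale `D` in both rankings
  have hxf : min (sdist f x) N ≤ D := by
    by_contra hc
    have h2 := i1 x hx (min (-f x) N)
    simp only [sdist] at hc
    omega
  have hxg : min (sdist g x) N ≤ D := by
    by_contra hc
    have h2 := i4 x hx (min (g x + 1) N)
    simp only [sdist] at hc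
    omega
  -- A band of `D - D / 2` items. All but `3 * (D / 32)` of them land in `Z`: that is the allowance
  -- for outer items and for the errors of `x` in either ranking.
  set A := Finset.univ.filter fun u => -D ≤ g u ∧ g u < -(D / 2) with hA
  have hAcard : (A.card : ℤ) = -(D / 2) - -D := hg.card_interval (by omega) (by omega)
    (by have := hf.upper x; have := hg.upper x; omega)
  set Z := Finset.univ.filter fun u => lev u = 0 ∧ f u < -D ∧ -D ≤ g u ∧ 2 * g u < -D with hZ
  have hcov : A ⊆ ((Finset.univ.filter fun v => lev v ≠ 0 ∧ sdist g v ≤ D) ∪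
      (Finset.univ.filter fun y => lev y = 0 ∧ y ≠ x ∧
        min (sdist f y) N ≤ D ∧ (R x y ↔ ¬ f x < f y))) ∪
      ((Finset.univ.filter fun y => lev y = 0 ∧ y ≠ x ∧
        min (sdist g y) N ≤ D ∧ (R x y ↔ ¬ g x < g y)) ∪ Z) := by
    intro u hu
    simp only [hA, hZ, Finset.mem_filter, Finset.mem_univ, true_and, Finset.mem_union] at hu ⊢
    by_cases hu0 : lev u = 0
    · have hne : u ≠ x := by rintro rfl; omega
      have hgu : ¬ g x < g u := by omega
      have hgD : min (sdist g u) N ≤ D := by simp only [sdist]; omega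
      by_cases hfu : f x < f u
      · have hfD : min (sdist f u) N ≤ D := by
          by_contra hc
          have h3 := i3 u hu0 (min (f u + 1) N)
          simp only [sdist] at hc
          rw [not_le, lt_min_iff, lt_max_iff] at hc
          rcases hc with ⟨h4 | h4, h5⟩
          · have hh := i1 x hx (min (-f x) N)
            simp only [sdist] at hxf
            omega
          · omega
        by_cases hR : R x u
        · exact Or.inr (Or.inl ⟨hu0, hne, hgD, by simp [hR, hgu]⟩)
        · exact Or.inl (Or.inr ⟨hu0, hne, hfD, by simp [hR, hfu]⟩)
      · have : f u ≠ f x := fun e => hne (hf.inj e)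
        exact Or.inr (Or.inr ⟨hu0, by omega, by omega, by omega⟩)
    · exact Or.inl (Or.inl ⟨hu0, by simp only [sdist]; omega⟩)
  have hc1 := Finset.card_le_card hcov
  have hc2 := Finset.card_union_le ((Finset.univ.filter fun v => lev v ≠ 0 ∧ sdist g v ≤ D) ∪
      (Finset.univ.filter fun y => lev y = 0 ∧ y ≠ x ∧
        min (sdist f y) N ≤ D ∧ (R x y ↔ ¬ f x < f y))) ((Finset.univ.filter fun y => lev y = 0 ∧
        y ≠ x ∧ min (sdist g y) N ≤ D ∧ (R x y ↔ ¬ g x < g y)) ∪ Z)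
  have hc3 := Finset.card_union_le (Finset.univ.filter fun v => lev v ≠ 0 ∧ sdist g v ≤ D)
      (Finset.univ.filter fun y => lev y = 0 ∧ y ≠ x ∧
        min (sdist f y) N ≤ D ∧ (R x y ↔ ¬ f x < f y))
  have hc4 := Finset.card_union_le (Finset.univ.filter fun y => lev y = 0 ∧
        y ≠ x ∧ min (sdist g y) N ≤ D ∧ (R x y ↔ ¬ g x < g y)) Z
  have hb1 := cg.few_outer D hD hDN
  have hb2 := ef x hx D hD hDN hxf
  have hb3 := eg x hx D hD hDN hxg
  have hZcard : D ≤ 2 * (Z.card : ℤ) + 6 * (D / 32) := by omega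
  -- the items that `g` moves across the threshold in the other direction
  set P := Finset.univ.filter fun u => -a ≤ g u ∧ g u < -D with hP
  set Q' := Finset.univ.filter fun u => -a ≤ f u ∧ f u < -D with hQ'
  have hb0 : -D ≤ b := by have := hf.upper x; have := hg.upper x; omega
  -- Both rankings are bijections onto the same interval, so the numbers of items crossing `-D` in
  -- the two directions agree.
  have hPQ : P.card = Q'.card := by
    have h1 := hg.card_interval (l := -a) (u := -D) le_rfl (by omega) hb0
    have h2 := hf.card_interval (l := -a) (u := -D) le_rfl (by omega) hb0
    rw [← hP] at h1; rw [← hQ'] at h2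
    omega
  have hsd := Finset.card_sdiff_comm hPQ
  have hZsub : Z ⊆ Q' \ P := by
    intro u hu
    have := hf.lower u
    simp only [hZ, hP, hQ', Finset.mem_filter, Finset.mem_univ, true_and, Finset.mem_sdiff]
      at hu ⊢
    omega
  have hZle := Finset.card_le_card hZsub
  have hZpos : 0 < Z.card := by omega
  obtain ⟨u, huZ⟩ := Finset.card_pos.1 hZpos
  simp only [hZ, Finset.mem_filter, Finset.mem_univ, true_and] at huZ
  obtain ⟨hu0, hu1, hu2, hu3⟩ := huZ
  -- Twice the scale suffices for items that cross `-D`: one further away in one ranking would, by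
  -- induction at its own scale, lie beyond `D` in the other.
  set E := min (2 * D) N with hE
  have huf : min (sdist f u) N ≤ E := by
    by_contra hc
    have h2 := i1 u hu0 (min (-f u) N)
    simp only [sdist] at hc
    omega
  have hug : min (sdist g u) N ≤ E := by simp only [sdist]; omega
  set W := Finset.univ.filter fun v => 1 ≤ lev v ∧ g v < -D ∧ D ≤ f v with hW
  -- Outer items that jump across the whole window. Below scale `N` the induction hypothesis and the
  -- resolved sides exclude them. At `D = N` nothing is known yet, and only `few_wrong` bounds them:
  -- such an item is on the wrong side for `f` or for `g`.
  have hWcard : 32 * (W.card : ℤ) ≤ 2 * D := by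
    rcases hDN.lt_or_eq with hlt | heq
    · have : W = ∅ := by
        rw [Finset.eq_empty_iff_forall_notMem]
        intro v hv
        simp only [hW, Finset.mem_filter, Finset.mem_univ, true_and] at hv
        by_cases hvL : lev v < L
        · have := r3 v hv.1 hvL (D + 1) (by omega) (by omega) (by omega)
          omega
        · have s1 := cf.resolved v (by omega)
          have s2 := cg.resolved v (by omega)
          rw [s1] at s2
          omega
      rw [this]; simp; omega
    · have hsub : W ⊆ (Finset.univ.filter fun v => lev v ≠ 0 ∧ ¬ (side v ↔ f v < 0)) ∪
          (Finset.univ.filter fun v => lev v ≠ 0 ∧ ¬ (side v ↔ g v < 0)) := by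
        intro v hv
        simp only [hW, Finset.mem_filter, Finset.mem_univ, true_and, Finset.mem_union] at hv ⊢
        have h1 : ¬ f v < 0 := by omega
        have h2 : g v < 0 := by omega
        have h3 : lev v ≠ 0 := by omega
        by_cases hs : side v <;> simp [hs, h1, h2, h3]
      have h1 := Finset.card_le_card hsub
      have h2 := Finset.card_union_le
        (Finset.univ.filter fun v => lev v ≠ 0 ∧ ¬ (side v ↔ f v < 0))
        (Finset.univ.filter fun v => lev v ≠ 0 ∧ ¬ (side v ↔ g v < 0))
      have h3 := cf.few_wrong
      have h4 := cg.few_wrong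
      omega
  have hcov2 : P \ Q' ⊆ ((Finset.univ.filter fun v => lev v ≠ 0 ∧ sdist f v ≤ D) ∪ W) ∪
      ((Finset.univ.filter fun y => lev y = 0 ∧ y ≠ u ∧
        min (sdist f y) N ≤ E ∧ (R u y ↔ ¬ f u < f y)) ∪
      (Finset.univ.filter fun y => lev y = 0 ∧ y ≠ u ∧
        min (sdist g y) N ≤ E ∧ (R u y ↔ ¬ g u < g y))) := by
    intro v hv
    have hvl := hf.lower v
    simp only [hP, hQ', hW, Finset.mem_filter, Finset.mem_univ, true_and, Finset.mem_union,
      Finset.mem_sdiff] at hv ⊢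
    by_cases hv0 : lev v = 0
    · have hne : v ≠ u := by rintro rfl; omega
      have hvg : min (sdist g v) N ≤ E := by
        by_contra hc
        have h2 := i2 v hv0 (min (-g v) N)
        simp only [sdist] at hc
        omega
      have hvf : min (sdist f v) N ≤ E := by
        by_contra hc
        have h3 := i3 v hv0 (min (f v + 1) N)
        simp only [sdist] at hc
        omega
      have c1 : f u < f v := by omega
      have c2 : ¬ g u < g v := by omega
      by_cases hR : R u v
      · exact Or.inr (Or.inr ⟨hv0, hne, hvg, by simp [hR, c2]⟩)
      · exact Or.inr (Or.inl ⟨hv0, hne, hvf, by simp [hR, c1]⟩)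
    · refine Or.inl ?_
      by_cases hvD : f v < D
      · exact Or.inl ⟨hv0, by simp only [sdist]; omega⟩
      · exact Or.inr ⟨by omega, by omega, by omega⟩
  have hd1 := Finset.card_le_card hcov2
  have hd2 := Finset.card_union_le ((Finset.univ.filter fun v => lev v ≠ 0 ∧ sdist f v ≤ D) ∪ W)
      ((Finset.univ.filter fun y => lev y = 0 ∧ y ≠ u ∧
        min (sdist f y) N ≤ E ∧ (R u y ↔ ¬ f u < f y)) ∪
      (Finset.univ.filter fun y => lev y = 0 ∧ y ≠ u ∧
        min (sdist g y) N ≤ E ∧ (R u y ↔ ¬ g u < g y)))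
  have hd3 := Finset.card_union_le (Finset.univ.filter fun v => lev v ≠ 0 ∧ sdist f v ≤ D) W
  have hd4 := Finset.card_union_le (Finset.univ.filter fun y => lev y = 0 ∧ y ≠ u ∧
        min (sdist f y) N ≤ E ∧ (R u y ↔ ¬ f u < f y))
      (Finset.univ.filter fun y => lev y = 0 ∧ y ≠ u ∧
        min (sdist g y) N ≤ E ∧ (R u y ↔ ¬ g u < g y))
  have he1 := cf.few_outer D hD hDN
  have he2 := ef u hu0 E (by omega) (by omega) huf
  have he3 := eg u hu0 E (by omega) (by omega) hug
  omega

open scoped Classical in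
-- If `f x ≤ -D` and `0 ≤ g x`, every sampled core item `y` with `-D ≤ 2 * g y < 0` is above `x` in
-- `g`, and below `x` in `f` by `hcore`. Each is an error of `x` in one of the rankings. Two error
-- allowances of `D / (32 * 2 ^ lev x)` cannot cover more than `D / (8 * 2 ^ lev x)` samples.
theorem clean_ring (hN : 32 ≤ N) (hf : IsRanking a b f)
    (cf : Consistent N L lev side Q R a b f) (cg : Consistent N L lev side Q R a b g)
    {D : ℤ} (hD : 1 ≤ D) (hDN : D ≤ N)
    (ih : ∀ D', D < D' → D' ≤ N → AllClean L lev f g D')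
    (hcore : ∀ x, lev x = 0 → f x ≤ -D → 2 * g x < -D)
    (x : V) (hx : 1 ≤ lev x) (hxL : lev x < L) (hfx : f x ≤ -D) : g x < 0 := by
  by_contra hgx
  push Not at hgx
  have hDa : D ≤ a := by have := hf.lower x; omega
  have i3 : ∀ y, lev y = 0 → ∀ D', D < D' → D' ≤ N → D' - 1 ≤ f y → D' - 1 ≤ 2 * g y := by
    intro y hy D' h1 h2 h3
    have := (ih D' h1 h2).2.1.1 y hy (by simp only [flip]; omega)
    simp only [flip] at this; omega
  have r1 : ∀ D', D < D' → D' ≤ N → f x ≤ -D' → g x < 0 := fun D' h1 h2 h3 =>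
    (ih D' h1 h2).1.1.2 x hx hxL h3
  have r4 : ∀ D', D < D' → D' ≤ N → D' - 1 ≤ g x → 0 ≤ f x := by
    intro D' h1 h2 h3
    have := (ih D' h1 h2).2.2.2 x hx hxL (by simp only [flip]; omega)
    simp only [flip] at this; omega
  have hxf : min (sdist f x) N ≤ D := by
    by_contra hc
    have h2 := r1 (min (-f x) N)
    simp only [sdist] at hc
    omega
  have hxg : min (sdist g x) N ≤ D := by
    by_contra hc
    have h2 := r4 (min (g x + 1) N)
    simp only [sdist] at hc
    omega
  -- For `D < 32` the bound in `few_outer` is less than one item, so no item of positive level is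
  -- that close; `32 ≤ N` ensures that the truncation at `N` does not interfere.
  have hD32 : 32 ≤ D := by
    by_contra hc
    have h1 := cf.few_outer D hD hDN
    have h2 : 0 < (Finset.univ.filter fun v => lev v ≠ 0 ∧ sdist f v ≤ D).card := by
      refine Finset.card_pos.2 ⟨x, ?_⟩
      simp only [Finset.mem_filter, Finset.mem_univ, true_and]
      refine ⟨by omega, ?_⟩
      rw [min_le_iff] at hxf
      omega
    omega
  have hs := cg.samples_top x hx hxL D hD32 hDN hxg hDa
  have he1 := cf.errors x hxL D hD hDN hxf
  have he2 := cg.errors x hxL D hD hDN hxg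
  have hcov : (Finset.univ.filter fun y => lev y = 0 ∧ Q (lev x) y ∧ -D ≤ 2 * g y ∧ g y < 0) ⊆
      (Finset.univ.filter fun y => lev y = 0 ∧ y ≠ x ∧ Q (lev x) y ∧
        min (sdist f y) N ≤ D ∧ (R x y ↔ ¬ f x < f y)) ∪
      (Finset.univ.filter fun y => lev y = 0 ∧ y ≠ x ∧ Q (lev x) y ∧
        min (sdist g y) N ≤ D ∧ (R x y ↔ ¬ g x < g y)) := by
    intro u hu
    simp only [Finset.mem_filter, Finset.mem_univ, true_and, Finset.mem_union] at hu ⊢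
    obtain ⟨hu0, huQ, hu1, hu2⟩ := hu
    have hne : u ≠ x := by rintro rfl; omega
    have hfne : f u ≠ f x := fun e => hne (hf.inj e)
    have c1 : f x < f u := by
      by_contra hc
      have := hcore u hu0 (by omega)
      omega
    have c2 : ¬ g x < g u := by omega
    have hgD : min (sdist g u) N ≤ D := by simp only [sdist]; omega
    have hfD : min (sdist f u) N ≤ D := by
      by_contra hc
      have h3 := i3 u hu0 (min (f u + 1) N)
      have h4 := r1 (min (-f x) N)
      simp only [sdist] at hc
      omega
    by_cases hR : R x u
    · exact Or.inr ⟨hu0, hne, huQ, hgD, by simp [hR, c2]⟩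
    · exact Or.inl ⟨hu0, hne, huQ, hfD, by simp [hR, c1]⟩
  have hc1 := (Finset.card_le_card hcov).trans (Finset.card_union_le _ _)
  have hpow : (0 : ℤ) < 2 ^ lev x := by positivity
  rw [← Nat.cast_le (α := ℤ), Nat.cast_add] at hc1
  nlinarith [mul_le_mul_of_nonneg_left hc1 hpow.le]

/-- Descending induction on `D`, started vacuously above `N`. Exchanging the rankings and reversing
the order reduce all four requirements to the two one-sided lemmas. -/
theorem allClean (hL : 1 ≤ L) (hQ : ∀ y, Q 0 y) (hN : 32 ≤ N)
    (hf : IsRanking a b f) (hg : IsRanking a b g)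
    (cf : Consistent N L lev side Q R a b f) (cg : Consistent N L lev side Q R a b g) :
    ∀ D, 1 ≤ D → D ≤ N → AllClean L lev f g D := by
  have main : ∀ m : ℕ, ∀ D, 1 ≤ D → D ≤ N → N - D < m → AllClean L lev f g D := by
    intro m
    induction m with
    | zero => intro D _ h1 h2; exfalso; simp at h2; omega
    | succ m ihm =>
      intro D hD hDN hm
      have ih : ∀ D', D < D' → D' ≤ N → AllClean L lev f g D' := fun D' h1 h2 =>
        ihm D' (by omega) h2 (by push_cast at hm; omega)
      have ih' : ∀ D', D < D' → D' ≤ N → AllClean L lev g f D' := fun D' h1 h2 => (ih D' h1 h2).swap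
      have k1 := clean_core hL hQ hf hg cf cg hD hDN ih
      have k2 := clean_core hL hQ hg hf cg cf hD hDN ih'
      have k3 := clean_core hL hQ hf.flip hg.flip (cf.flip hf) (cg.flip hg) hD hDN
        fun D' h1 h2 => (ih D' h1 h2).flip
      have k4 := clean_core hL hQ hg.flip hf.flip (cg.flip hg) (cf.flip hf) hD hDN
        fun D' h1 h2 => (ih' D' h1 h2).flip
      exact ⟨⟨⟨k1, clean_ring hN hf cf cg hD hDN ih k1⟩,
        ⟨k2, clean_ring hN hg cg cf hD hDN ih' k2⟩⟩,
        ⟨⟨k3, clean_ring hN hf.flip (cf.flip hf) (cg.flip hg) hD hDN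
          (fun D' h1 h2 => (ih D' h1 h2).flip) k3⟩,
        ⟨k4, clean_ring hN hg.flip (cg.flip hg) (cf.flip hf) hD hDN
          (fun D' h1 h2 => (ih' D' h1 h2).flip) k4⟩⟩⟩
  intro D h1 h2
  exact main ((N - D).toNat + 1) D h1 h2 (by omega)

/-- Two rankings that are consistent with the same data have the same negative items. -/
theorem neg_iff_of_consistent (hL : 1 ≤ L) (hQ : ∀ y, Q 0 y) (hN : 32 ≤ N)
    (hf : IsRanking a b f) (hg : IsRanking a b g)
    (cf : Consistent N L lev side Q R a b f) (cg : Consistent N L lev side Q R a b g) (x : V) :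
    f x < 0 ↔ g x < 0 := by
  have h := allClean hL hQ hN hf hg cf cg 1 le_rfl (by omega)
  obtain ⟨⟨⟨h1, h1'⟩, ⟨h2, h2'⟩⟩, -⟩ := h
  rcases Nat.eq_zero_or_pos (lev x) with h0 | h0
  · have := h1 x h0
    have := h2 x h0
    omega
  · by_cases hxL : lev x < L
    · have := h1' x h0 hxL
      have := h2' x h0 hxL
      omega
    · rw [← cf.resolved x (by omega), ← cg.resolved x (by omega)]

end Decoding

/-! ### From algorithms to independent errors: repetition and majority votes -/

namespace Simulation

open FinProb

/-- Majority vote. -/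
def majority {c : ℕ} (b : Fin c → Bool) : Bool :=
  decide (c < 2 * (Finset.univ.filter fun s => b s = true).card)

/-- The probability that the majority of `c` answers is wrong. -/
noncomputable def majorityError (c : ℕ) : ℝ :=
  prob (piW (Fin c) (coinW (2 / 3))) (fun b => majority b = false)

/-- An odd number of votes excludes ties, so the vote treats the two answers symmetrically. -/
theorem majority_not {c : ℕ} (hc : Odd c) (b : Fin c → Bool) :
    majority (fun s => !b s) = !majority b := by
  have h := Finset.card_filter_add_card_filter_not (s := (Finset.univ : Finset (Fin c)))
    (fun s => b s = true)
  rw [Finset.card_univ, Fintype.card_fin] at h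
  obtain ⟨d, rfl⟩ := hc
  unfold majority
  simp only [Bool.not_eq_true', Bool.not_eq_true] at h ⊢
  rw [← decide_not, decide_eq_decide]
  omega

/-- Weight a correct answer by `3 / 4` and a wrong one by `4 / 3`. The product is at least `1` when
the vote fails, and each factor has mean `2 / 3 * 3 / 4 + 1 / 3 * 4 / 3 = 17 / 18`. -/
theorem majorityError_le (c : ℕ) : majorityError c ≤ (17 / 18 : ℝ) ^ c := by
  have hw : IsWeight (coinW (2 / 3)) := isWeight_coinW (by norm_num) (by norm_num)
  have h1 : majorityError c ≤ expect (piW (Fin c) (coinW (2 / 3)))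
      (fun b => ∏ s, (if b s then (3 / 4 : ℝ) else 4 / 3)) := by
    unfold majorityError
    rw [prob_eq_expect]
    refine expect_mono hw.piW fun b => ?_
    rw [Finset.prod_ite, Finset.prod_const, Finset.prod_const]
    have h := Finset.card_filter_add_card_filter_not (s := (Finset.univ : Finset (Fin c)))
      (fun s => b s = true)
    rw [Finset.card_univ, Fintype.card_fin] at h
    split_ifs with hm
    · unfold majority at hm
      rw [decide_eq_false_iff_not] at hm
      obtain ⟨d, hd⟩ := Nat.exists_eq_add_of_le (show
        (Finset.univ.filter fun s => b s = true).card ≤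
          (Finset.univ.filter fun s => ¬ b s = true).card by omega)
      rw [hd, pow_add, ← mul_assoc, ← mul_pow]
      norm_num
      exact one_le_pow₀ (by norm_num)
    · positivity
  refine h1.trans_eq ?_
  rw [expect_piW_prod (fun _ (a : Bool) => if a then (3 / 4 : ℝ) else 4 / 3)]
  simp [expect, coinW]
  norm_num

theorem exists_majorityError_le {ε : ℝ} (hε : 0 < ε) : ∃ c : ℕ, Odd c ∧ majorityError c ≤ ε := by
  obtain ⟨m, hm⟩ := exists_pow_lt_of_lt_one hε (show (17 / 18 : ℝ) < 1 by norm_num)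
  refine ⟨2 * m + 1, ⟨m, rfl⟩, (majorityError_le _).trans (le_trans ?_ hm.le)⟩
  exact pow_le_pow_of_le_one (by norm_num) (by norm_num) (by omega)

theorem majorityError_nonneg (c : ℕ) : 0 ≤ majorityError c :=
  prob_nonneg (isWeight_coinW (by norm_num) (by norm_num)).piW _

theorem majorityError_le_one (c : ℕ) : majorityError c ≤ 1 :=
  prob_le_one (isWeight_coinW (by norm_num) (by norm_num)).piW _

theorem noisyAnswerProb_toReal (t b : Bool) :
    (noisyAnswerProb t b).toReal = coinW (2 / 3) (b == t) := by
  cases t <;> cases b <;> simp [noisyAnswerProb, coinW] <;> norm_num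

theorem sum_pushforward {I β γ : Type*} [Fintype I] [DecidableEq I] [Fintype β] [Fintype γ]
    [DecidableEq γ] (W : I → β → ℝ) (M : β → γ) (G : (I → γ) → ℝ) :
    ∑ b : I → β, (∏ i, W i (b i)) * G (fun i => M (b i)) =
      ∑ z : I → γ, (∏ i, ∑ x, if M x = z i then W i x else 0) * G z := by
  have h1 : ∀ z : I → γ, (∏ i, ∑ x, if M x = z i then W i x else 0) =
      ∑ b : I → β, ∏ i, if M (b i) = z i then W i (b i) else 0 := fun z =>
    Fintype.prod_sum fun i x => if M x = z i then W i x else 0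
  simp only [h1, Finset.sum_mul]
  rw [Finset.sum_comm]
  refine Finset.sum_congr rfl fun b _ => ?_
  rw [Finset.sum_eq_single (fun i => M (b i))]
  · simp
  · intro z _ hz
    obtain ⟨i, hi⟩ := Function.ne_iff.1 hz
    rw [Finset.prod_eq_zero (Finset.mem_univ i), zero_mul]
    rw [if_neg (fun h => hi h.symm)]
  · simp

/-- Whatever the true answer `t` is, the vote is distributed as `t` xored with a coin of bias
`majorityError c`; the noise can thus be treated independently of the order. -/
theorem sum_majority {c : ℕ} (hc : Odd c) (t z : Bool) :
    (∑ b : Fin c → Bool, if majority b = z then ∏ s, coinW (2 / 3) (b s == t) else 0) =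
      coinW (majorityError c) (t ^^ z) := by
  have hw : IsWeight (piW (Fin c) (coinW (2 / 3))) :=
    (isWeight_coinW (by norm_num) (by norm_num)).piW
  have base : ∀ z, (∑ b : Fin c → Bool, if majority b = z then ∏ s, coinW (2 / 3) (b s) else 0) =
      coinW (majorityError c) (!z) := by
    intro z
    have h0 : (∑ b : Fin c → Bool, if majority b = z then ∏ s, coinW (2 / 3) (b s) else 0) =
        prob (piW (Fin c) (coinW (2 / 3))) (fun b => majority b = z) := by
      rw [prob_def]
      exact Finset.sum_congr rfl fun b _ => by simp [piW]
    rw [h0]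
    cases z
    · simp [coinW, majorityError]
    · have := prob_not hw (fun b => majority b = false)
      simp only [Bool.not_eq_false] at this
      simp [coinW, this, majorityError]
  cases t
  · have h2 := base (!z)
    rw [Bool.not_not] at h2
    rw [Bool.false_xor, ← h2]
    refine Fintype.sum_equiv (Equiv.arrowCongr (Equiv.refl _) Equiv.boolNot) _ _ fun b => ?_
    have h3 : (Equiv.arrowCongr (Equiv.refl (Fin c)) Equiv.boolNot) b = fun s => !b s := by
      funext s; simp [Equiv.boolNot]
    rw [h3, majority_not hc]
    simp
  · have h2 := base z
    simpa using h2

/-- The probability of an output, as a real number. -/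
noncomputable def outProb {n r : ℕ} (σ : Equiv.Perm (Fin n)) (D : DetAlgorithm n r)
    (T : Finset (Fin n)) : ℝ := (D.outputLaw σ T).toReal

theorem outProb_output {n : ℕ} (σ : Equiv.Perm (Fin n)) (S T : Finset (Fin n)) :
    outProb σ (.output S) T = if S = T then 1 else 0 := by
  unfold outProb
  simp only [DetAlgorithm.outputLaw, PMF.pure_apply]
  by_cases h : S = T
  · simp [h]
  · rw [if_neg (fun h' => h h'.symm), if_neg h, ENNReal.toReal_zero]

theorem outProb_round {n r m : ℕ} (σ : Equiv.Perm (Fin n)) (q : Fin m → ItemPair n)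
    (next : (Fin m → Bool) → DetAlgorithm n r) (T : Finset (Fin n)) :
    outProb σ (.round m q next) T =
      ∑ a, (∏ i, coinW (2 / 3) (a i == trueAnswer σ (q i))) * outProb σ (next a) T := by
  unfold outProb
  simp only [DetAlgorithm.outputLaw, PMF.bind_apply, tsum_fintype]
  rw [ENNReal.toReal_sum fun a _ => ENNReal.mul_ne_top (PMF.apply_ne_top _ _)
    (PMF.apply_ne_top _ _)]
  refine Finset.sum_congr rfl fun a _ => ?_
  rw [ENNReal.toReal_mul]
  congr 1
  simp only [answerLaw, PMF.ofFintype_apply, ENNReal.toReal_prod, noisyAnswerProb_toReal]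

/-- One round in which every comparison of a finite family is made `c` times, followed by majority
votes. -/
noncomputable def repeatRound {n r : ℕ} {I : Type} [Fintype I] (q : I → ItemPair n) (c : ℕ)
    (next : (I → Bool) → DetAlgorithm n r) : DetAlgorithm n (r + 1) :=
  .round (Fintype.card (I × Fin c)) (fun j => q ((Fintype.equivFin (I × Fin c)).symm j).1)
    (fun a => next fun i => majority fun s => a (Fintype.equivFin (I × Fin c) (i, s)))

theorem outProb_repeatRound {n r : ℕ} {I : Type} [Fintype I] [DecidableEq I] (q : I → ItemPair n)
    {c : ℕ} (hc : Odd c) (next : (I → Bool) → DetAlgorithm n r) (σ : Equiv.Perm (Fin n))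
    (T : Finset (Fin n)) :
    outProb σ (repeatRound q c next) T = expect (piW I (coinW (majorityError c)))
      (fun e => outProb σ (next fun i => trueAnswer σ (q i) ^^ e i) T) := by
  unfold repeatRound
  rw [outProb_round]
  have h1 : (∑ a : Fin (Fintype.card (I × Fin c)) → Bool,
      (∏ j, coinW (2 / 3) (a j == trueAnswer σ (q ((Fintype.equivFin (I × Fin c)).symm j).1))) *
        outProb σ (next fun i => majority fun s => a (Fintype.equivFin (I × Fin c) (i, s))) T) =
      ∑ b : I → Fin c → Bool, (∏ i, ∏ s, coinW (2 / 3) (b i s == trueAnswer σ (q i))) *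
        outProb σ (next fun i => majority (b i)) T := by
    refine Fintype.sum_equiv
      ((Equiv.arrowCongr (Fintype.equivFin (I × Fin c)).symm (Equiv.refl Bool)).trans
        (Equiv.curry I (Fin c) Bool)) _ _ fun a => ?_
    congr 1
    rw [← Fintype.prod_prod_type' (f := fun (i : I) (s : Fin c) => coinW (2 / 3)
      (((Equiv.arrowCongr (Fintype.equivFin (I × Fin c)).symm (Equiv.refl Bool)).trans
        (Equiv.curry I (Fin c) Bool)) a i s == trueAnswer σ (q i)))]
    refine Fintype.prod_equiv (Fintype.equivFin (I × Fin c)).symm _ _ fun j => ?_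
    simp [Equiv.arrowCongr, Function.curry]
  rw [h1, sum_pushforward (fun i (b : Fin c → Bool) =>
    ∏ s, coinW (2 / 3) (b s == trueAnswer σ (q i))) majority
    (fun z => outProb σ (next z) T)]
  simp only [sum_majority hc]
  unfold expect piW
  refine Fintype.sum_equiv
    (Equiv.piCongrRight fun i => (Function.Involutive.toPerm (fun z => trueAnswer σ (q i) ^^ z)
      (fun z => by simp))) _ _ fun z => ?_
  have h2 : ∀ i, (trueAnswer σ (q i) ^^ (trueAnswer σ (q i) ^^ z i)) = z i := fun i => by simp
  change _ = (∏ i, coinW (majorityError c) (trueAnswer σ (q i) ^^ z i)) *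
    outProb σ (next fun i => trueAnswer σ (q i) ^^ (trueAnswer σ (q i) ^^ z i)) T
  simp only [h2]

/-- Errors may be drawn for all indices, also those not compared. This keeps the error space fixed
when the set of comparisons depends on earlier answers. -/
theorem expect_restrict {Z : Type*} [Fintype Z] [DecidableEq Z] (p : Z → Prop) [DecidablePred p]
    {w : Bool → ℝ} (hw : IsWeight w) (G : ({i // p i} → Bool) → ℝ) :
    expect (piW {i // p i} w) G = expect (piW Z w) (fun e => G fun i => e i) := by
  have hw' : IsWeight (piW {i // ¬ p i} w) := hw.piW
  have h1 : expect (piW Z w) (fun e => G fun i => e i) =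
      expect (prodW (piW {i // p i} w) (piW {i // ¬ p i} w)) (fun x => G x.1) := by
    unfold expect
    refine Fintype.sum_equiv (Equiv.piEquivPiSubtypeProd p fun _ => Bool) _ _ fun e => ?_
    simp only [piW, prodW, Equiv.piEquivPiSubtypeProd_apply]
    rw [Fintype.prod_subtype_mul_prod_subtype p fun i => w (e i)]
  rw [h1, expect_prodW]
  simp only [expect_const hw']

/-- One round in which the comparisons with an index satisfying `p` are made `c` times each. -/
noncomputable def maskedRound {n r : ℕ} {Z : Type} [Fintype Z] (pair : Z → Fin n × Fin n)
    (p : Z → Prop) [DecidablePred p] (hp : ∀ i, p i → (pair i).1 ≠ (pair i).2) (c : ℕ)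
    (next : (Z → Bool) → DetAlgorithm n r) : DetAlgorithm n (r + 1) :=
  repeatRound (I := {i // p i}) (fun i => ⟨pair i, hp i i.2⟩) c
    (fun a => next fun i => if h : p i then a ⟨i, h⟩ else false)

/-- The masked answers: the truth with errors added, `false` at the comparisons not made. -/
def observed {n : ℕ} {Z : Type} (σ : Equiv.Perm (Fin n)) (pair : Z → Fin n × Fin n)
    (p : Z → Prop) [DecidablePred p] (e : Z → Bool) : Z → Bool :=
  fun i => if p i then (decide (σ (pair i).1 < σ (pair i).2) ^^ e i) else false

theorem outProb_maskedRound {n r : ℕ} {Z : Type} [Fintype Z] [DecidableEq Z]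
    (pair : Z → Fin n × Fin n) (p : Z → Prop) [DecidablePred p]
    (hp : ∀ i, p i → (pair i).1 ≠ (pair i).2) {c : ℕ} (hc : Odd c)
    (next : (Z → Bool) → DetAlgorithm n r) (σ : Equiv.Perm (Fin n)) (T : Finset (Fin n)) :
    outProb σ (maskedRound pair p hp c next) T = expect (piW Z (coinW (majorityError c)))
      (fun e => outProb σ (next (observed σ pair p e)) T) := by
  unfold maskedRound
  rw [outProb_repeatRound _ hc, expect_restrict p
    (isWeight_coinW (majorityError_nonneg c) (majorityError_le_one c))]
  rfl

theorem maxComparisons_maskedRound_le {n r : ℕ} {Z : Type} [Fintype Z]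
    (pair : Z → Fin n × Fin n) (p : Z → Prop) [DecidablePred p]
    (hp : ∀ i, p i → (pair i).1 ≠ (pair i).2) (c : ℕ)
    (next : (Z → Bool) → DetAlgorithm n r) (B : ℕ) (hB : ∀ z, (next z).maxComparisons ≤ B) :
    (maskedRound pair p hp c next).maxComparisons ≤ (Finset.univ.filter p).card * c + B := by
  unfold maskedRound repeatRound
  simp only [DetAlgorithm.maxComparisons]
  refine add_le_add ?_ (Finset.sup_le fun a _ => hB _)
  rw [Fintype.card_prod, Fintype.card_fin, Fintype.card_subtype]

/-- A weight as a probability mass function. -/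
noncomputable def weightPMF {S : Type*} [Fintype S] (w : S → ℝ) (hw : IsWeight w) : PMF S :=
  PMF.ofFintype (fun s => ENNReal.ofReal (w s)) (by
    rw [← ENNReal.ofReal_sum_of_nonneg fun s _ => hw.nonneg s, hw.sum_one, ENNReal.ofReal_one])

theorem outputLaw_map_weightPMF {n r : ℕ} {S : Type} [Fintype S] (w : S → ℝ) (hw : IsWeight w)
    (D : S → DetAlgorithm n r) (σ : Equiv.Perm (Fin n)) (T : Finset (Fin n)) :
    (RandAlgorithm.outputLaw ((weightPMF w hw).map D : RandAlgorithm n r) σ T).toReal =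
      expect w (fun s => outProb σ (D s) T) := by
  unfold RandAlgorithm.outputLaw
  rw [PMF.bind_map, PMF.bind_apply, tsum_fintype]
  rw [ENNReal.toReal_sum fun a _ => ENNReal.mul_ne_top (PMF.apply_ne_top _ _)
    (PMF.apply_ne_top _ _)]
  refine Finset.sum_congr rfl fun s _ => ?_
  rw [ENNReal.toReal_mul]
  congr 1
  simp [weightPMF, hw.nonneg s]

theorem comparisonsLE_map_weightPMF {n r : ℕ} {S : Type} [Fintype S] (w : S → ℝ)
    (hw : IsWeight w) (D : S → DetAlgorithm n r) {B : ℝ}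
    (hB : ∀ s, ((D s).maxComparisons : ℝ) ≤ B) :
    RandAlgorithm.ComparisonsLE ((weightPMF w hw).map D : RandAlgorithm n r) B := by
  intro E hE
  rw [PMF.mem_support_map_iff] at hE
  obtain ⟨s, -, rfl⟩ := hE
  exact hB s

theorem two_thirds_le {x : ℝ≥0∞} (hx : 2 / 3 ≤ x.toReal) : 2 / 3 ≤ x := by
  by_cases h : x = ⊤
  · simp [h]
  · rw [← ENNReal.ofReal_toReal h]
    refine le_trans (le_of_eq ?_) (ENNReal.ofReal_le_ofReal hx)
    rw [ENNReal.ofReal_div_of_pos (by norm_num)]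
    simp

open scoped Classical in
/-- A one-round algorithm with random seeds, in terms of independent errors. -/
theorem exists_oneRound {n k c : ℕ} (hc : Odd c) {S : Type} [Fintype S] {w : S → ℝ}
    (hw : IsWeight w) (out : S → (Fin n × Fin n → Bool) → Finset (Fin n))
    (hout : ∀ σ : Equiv.Perm (Fin n),
      prob (prodW w (piW (Fin n × Fin n) (coinW (majorityError c)))) (fun x =>
        out x.1 (observed σ id (fun i => i.1 ≠ i.2) x.2) ≠ topK σ k) ≤ 1 / 3) :
    ∃ A : RandAlgorithm n 1, A.ComparisonsLE ((c : ℝ) * (n : ℝ) ^ 2) ∧ A.SolvesTopK k := by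
  have he : IsWeight (piW (Fin n × Fin n) (coinW (majorityError c))) :=
    (isWeight_coinW (majorityError_nonneg c) (majorityError_le_one c)).piW
  refine ⟨(weightPMF w hw).map fun s => maskedRound (Z := Fin n × Fin n) id
    (fun i => i.1 ≠ i.2) (fun _ h => h) c (fun z => .output (out s z)), ?_, ?_⟩
  · refine comparisonsLE_map_weightPMF w hw _ fun s => ?_
    have h1 := maxComparisons_maskedRound_le (Z := Fin n × Fin n) id
      (fun i => i.1 ≠ i.2) (fun _ h => h) c
      (fun z => DetAlgorithm.output (out s z)) 0 (fun z => le_rfl)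
    have h2 : (Finset.univ.filter fun i : Fin n × Fin n => i.1 ≠ i.2).card ≤ n * n := by
      refine (Finset.card_filter_le _ _).trans ?_
      simp
    have h3 := Nat.mul_le_mul_right c h2
    have h4 := h1.trans (Nat.add_le_add_right h3 0)
    have h5 : ((_ : ℕ) : ℝ) ≤ ((n * n * c + 0 : ℕ) : ℝ) := Nat.cast_le.2 h4
    refine h5.trans_eq ?_
    push_cast; ring
  · intro σ
    refine two_thirds_le ?_
    rw [outputLaw_map_weightPMF]
    have h1 := prob_not (hw.prodW he) (fun x =>
        out x.1 (observed σ id (fun i => i.1 ≠ i.2) x.2) ≠ topK σ k)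
    have h2 := hout σ
    simp only [not_not] at h1
    have h3 : expect w (fun s => outProb σ (maskedRound (Z := Fin n × Fin n) id
        (fun i => i.1 ≠ i.2) (fun _ h => h) c (fun z => .output (out s z))) (topK σ k)) =
        prob (prodW w (piW (Fin n × Fin n) (coinW (majorityError c)))) (fun x =>
          out x.1 (observed σ id (fun i => i.1 ≠ i.2) x.2) = topK σ k) := by
      rw [prob_prodW]
      congr 1
      funext s
      rw [outProb_maskedRound _ _ _ hc, prob_eq_expect]
      simp only [outProb_output]
    rw [h3]
    linarith

open scoped Classical in
/-- A two-round algorithm with random seeds, in terms of independent errors. -/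
theorem exists_twoRound {n k c : ℕ} (hc : Odd c) {S : Type} [Fintype S] {w : S → ℝ}
    (hw : IsWeight w) {Z : Type} [Fintype Z] [DecidableEq Z] (pair : S → Z → Fin n × Fin n)
    (query : S → (Z → Bool) → Fin n × Fin n → Prop) (B : ℕ)
    (hquery : ∀ s z, (Finset.univ.filter (query s z)).card ≤ B)
    (out : S → (Z → Bool) → (Fin n × Fin n → Bool) → Finset (Fin n))
    (hout : ∀ σ : Equiv.Perm (Fin n),
      prob (prodW w (prodW (piW Z (coinW (majorityError c)))
        (piW (Fin n × Fin n) (coinW (majorityError c))))) (fun x =>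
        out x.1 (observed σ (pair x.1) (fun i => (pair x.1 i).1 ≠ (pair x.1 i).2) x.2.1)
          (observed σ id (fun i => query x.1 (observed σ (pair x.1)
            (fun i => (pair x.1 i).1 ≠ (pair x.1 i).2) x.2.1) i ∧ i.1 ≠ i.2) x.2.2) ≠
          topK σ k) ≤ 1 / 3) :
    ∃ A : RandAlgorithm n 2, A.ComparisonsLE ((c : ℝ) * (Fintype.card Z + B)) ∧
      A.SolvesTopK k := by
  have he : IsWeight (piW (Fin n × Fin n) (coinW (majorityError c))) :=
    (isWeight_coinW (majorityError_nonneg c) (majorityError_le_one c)).piW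
  have he' : IsWeight (piW Z (coinW (majorityError c))) :=
    (isWeight_coinW (majorityError_nonneg c) (majorityError_le_one c)).piW
  let second : S → (Z → Bool) → DetAlgorithm n 1 := fun s z1 =>
    maskedRound (Z := Fin n × Fin n) id (fun i => query s z1 i ∧ i.1 ≠ i.2) (fun _ h => h.2) c
      (fun z2 => .output (out s z1 z2))
  refine ⟨(weightPMF w hw).map fun s => maskedRound (Z := Z) (pair s)
    (fun i => (pair s i).1 ≠ (pair s i).2) (fun _ h => h) c (second s), ?_, ?_⟩
  · refine comparisonsLE_map_weightPMF w hw _ fun s => ?_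
    have h0 : ∀ z1, (second s z1).maxComparisons ≤ B * c := by
      intro z1
      have h1 := maxComparisons_maskedRound_le (Z := Fin n × Fin n) id
        (fun i => query s z1 i ∧ i.1 ≠ i.2) (fun _ h => h.2) c
        (fun z2 => DetAlgorithm.output (out s z1 z2)) 0 (fun z => le_rfl)
      refine h1.trans ?_
      rw [add_zero]
      refine Nat.mul_le_mul_right c (le_trans (Finset.card_le_card ?_) (hquery s z1))
      intro i hi
      simp only [Finset.mem_filter] at hi ⊢
      exact ⟨hi.1, hi.2.1⟩
    have h1 := maxComparisons_maskedRound_le (Z := Z) (pair s)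
      (fun i => (pair s i).1 ≠ (pair s i).2) (fun _ h => h) c (second s) (B * c) h0
    have h2 : (Finset.univ.filter fun i : Z => (pair s i).1 ≠ (pair s i).2).card ≤
      Fintype.card Z := Finset.card_filter_le _ _
    have h3 := Nat.mul_le_mul_right c h2
    have h4 := h1.trans (Nat.add_le_add_right h3 (B * c))
    have h5 : ((_ : ℕ) : ℝ) ≤ ((Fintype.card Z * c + B * c : ℕ) : ℝ) := Nat.cast_le.2 h4
    refine h5.trans_eq ?_
    push_cast; ring
  · intro σ
    refine two_thirds_le ?_
    rw [outputLaw_map_weightPMF]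
    have h1 := prob_not (hw.prodW (he'.prodW he)) (fun x =>
        out x.1 (observed σ (pair x.1) (fun i => (pair x.1 i).1 ≠ (pair x.1 i).2) x.2.1)
          (observed σ id (fun i => query x.1 (observed σ (pair x.1)
            (fun i => (pair x.1 i).1 ≠ (pair x.1 i).2) x.2.1) i ∧ i.1 ≠ i.2) x.2.2) ≠
          topK σ k)
    have h2 := hout σ
    simp only [not_not] at h1
    refine le_trans (by linarith) (h1.symm.le.trans (le_of_eq ?_))
    rw [prob_prodW]
    congr 1
    funext s
    rw [outProb_maskedRound _ _ _ hc, prob_prodW]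
    congr 1
    funext e1
    simp only [second]
    rw [outProb_maskedRound _ _ _ hc, prob_eq_expect]
    simp only [outProb_output]

end Simulation

/-! ### The second round: nested samples and the probability of consistency -/

namespace Decoding

open FinProb

theorem sum_Icc_pow_le {ρ : ℝ} (h0 : 0 ≤ ρ) (h1 : ρ ≤ 1 / 2) (N : ℕ) :
    ∑ D ∈ Finset.Icc 1 N, ρ ^ D ≤ 2 * ρ := by
  have h2 : ∀ N : ℕ, ∑ D ∈ Finset.Icc 1 N, ρ ^ D ≤ 2 * ρ - ρ ^ N * (2 * ρ) := by
    intro N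
    induction N with
    | zero => simp
    | succ N ih =>
      rw [Finset.sum_Icc_succ_top (by omega)]
      have h3 : ρ ^ (N + 1) = ρ ^ N * ρ := pow_succ _ _
      have h4 : 0 ≤ ρ ^ N := pow_nonneg h0 N
      rw [h3]
      nlinarith [mul_nonneg h4 h0]
  have := h2 N
  have h4 : 0 ≤ ρ ^ N * (2 * ρ) := by positivity
  linarith

theorem exp_neg_le_pow (m : ℕ) : Real.exp (-(m : ℝ)) ≤ (1 / 2.7 : ℝ) ^ m := by
  have h1 : Real.exp (-1) ≤ 1 / 2.7 := by
    rw [Real.exp_neg, inv_eq_one_div]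
    exact one_div_le_one_div_of_le (by norm_num) (by linarith [Real.exp_one_gt_d9])
  have h2 : Real.exp (-(m : ℝ)) = Real.exp (-1) ^ m := by
    rw [← Real.exp_nat_mul]; congr 1; ring
  rw [h2]
  exact pow_le_pow_left₀ (Real.exp_pos _).le h1 m

theorem sum_Icc_exp_le (m N : ℕ) (hm : 1 ≤ m) :
    ∑ D ∈ Finset.Icc 1 N, Real.exp (-((m : ℝ) * D)) ≤ 2 * (1 / 2.7 : ℝ) ^ m := by
  have h1 := sum_Icc_pow_le (ρ := (1 / 2.7 : ℝ) ^ m) (by positivity) (by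
    calc (1 / 2.7 : ℝ) ^ m ≤ (1 / 2.7 : ℝ) ^ 1 :=
        pow_le_pow_of_le_one (by norm_num) (by norm_num) hm
      _ ≤ _ := by norm_num) N
  refine le_trans (Finset.sum_le_sum fun D _ => ?_) h1
  rw [← pow_mul]
  have := exp_neg_le_pow (m * D)
  push_cast at this
  exact this

/-- The item `y` belongs to the sample of rate `2 ^ (-t)`. -/
def Sampled {V : Type*} {L : ℕ} (label : V → Fin (2 ^ L)) (t : ℕ) (y : V) : Prop :=
  (label y : ℕ) * 2 ^ t < 2 ^ L

theorem sampled_zero {V : Type*} {L : ℕ} (label : V → Fin (2 ^ L)) (y : V) : Sampled label 0 y := by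
  simp [Sampled]

variable {V : Type*} [Fintype V] [DecidableEq V]

/-- The random data attached to an item before the second round: a label, which decides in which
samples the item takes part, and the errors of its comparisons with all other items. -/
noncomputable abbrev columnW (V : Type*) [Fintype V] (L : ℕ) (η : ℝ) :
    Fin (2 ^ L) × (V → Bool) → ℝ :=
  prodW (unifW (Fin (2 ^ L))) (piW V (coinW η))

theorem isWeight_columnW (L : ℕ) {η : ℝ} (h0 : 0 ≤ η) (h1 : η ≤ 1) :
    IsWeight (columnW V L η) :=
  (isWeight_unifW _).prodW (isWeight_coinW h0 h1).piW

theorem prob_label {L t : ℕ} (ht : t ≤ L) :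
    prob (unifW (Fin (2 ^ L))) (fun l => (l : ℕ) * 2 ^ t < 2 ^ L) = 1 / 2 ^ t := by
  rw [prob_unifW]
  have h1 : (2 : ℕ) ^ L = 2 ^ (L - t) * 2 ^ t := by rw [← pow_add]; congr 1; omega
  have h2 : (Finset.univ.filter fun l : Fin (2 ^ L) => (l : ℕ) * 2 ^ t < 2 ^ L).card =
      2 ^ (L - t) := by
    have h3 : (Finset.univ.filter fun l : Fin (2 ^ L) => (l : ℕ) * 2 ^ t < 2 ^ L) =
        (Finset.univ.filter fun l : Fin (2 ^ L) => (l : ℕ) < 2 ^ (L - t)) := by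
      refine Finset.filter_congr fun l _ => ?_
      have h4 := Nat.mul_lt_mul_right (a := 2 ^ t) (b := (l : ℕ)) (c := 2 ^ (L - t))
        (by positivity)
      rw [← h1] at h4
      exact h4
    rw [h3, Fin.card_filter_val_lt]
    exact min_eq_right (Nat.pow_le_pow_right (by norm_num) (by omega))
  rw [h2, Fintype.card_fin]
  have h4 : ((2 ^ L : ℕ) : ℝ) = 2 ^ (L - t) * 2 ^ t := by rw [h1]; push_cast; ring
  rw [h4]
  push_cast
  field_simp

theorem prob_column_label {L t : ℕ} {η : ℝ} (h0 : 0 ≤ η) (h1 : η ≤ 1) (ht : t ≤ L) :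
    prob (columnW V L η) (fun c => (c.1 : ℕ) * 2 ^ t < 2 ^ L) = 1 / 2 ^ t := by
  rw [prob_prodW_fst (isWeight_coinW h0 h1).piW
    (S := fun l : Fin (2 ^ L) => (l : ℕ) * 2 ^ t < 2 ^ L), prob_label ht]

theorem prob_column_error {L t : ℕ} {η : ℝ} (h0 : 0 ≤ η) (h1 : η ≤ 1) (ht : t ≤ L) (x : V) :
    prob (columnW V L η) (fun c => (c.1 : ℕ) * 2 ^ t < 2 ^ L ∧ c.2 x = true) = 1 / 2 ^ t * η := by
  have h := prob_prodW_and (u := unifW (Fin (2 ^ L))) (v := piW V (coinW η))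
    (fun l : Fin (2 ^ L) => (l : ℕ) * 2 ^ t < 2 ^ L) (fun e => e x = true)
  rw [h, prob_label ht, prob_piW_apply (isWeight_coinW h0 h1) x (fun b => b = true), prob_coinW]

open scoped Classical in
/-- The number of sampled core items satisfying `P` whose comparison with `x` is erroneous. -/
noncomputable def errorCount {L : ℕ} (lev : V → ℕ) (x : V) (P : V → Prop)
    (ω : V → Fin (2 ^ L) × (V → Bool)) : ℕ :=
  (Finset.univ.filter fun y => lev y = 0 ∧ y ≠ x ∧ Sampled (fun v => (ω v).1) (lev x) y ∧
    P y ∧ (ω y).2 x = true).card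

open scoped Classical in
/-- The number of sampled core items satisfying `P`. -/
noncomputable def sampleCount {L : ℕ} (lev : V → ℕ) (x : V) (P : V → Prop)
    (ω : V → Fin (2 ^ L) × (V → Bool)) : ℕ :=
  (Finset.univ.filter fun y => lev y = 0 ∧ Sampled (fun v => (ω v).1) (lev x) y ∧ P y).card

open scoped Classical in
-- With `s = D / 2 ^ lev x`, the parameter `672 = 21 * 32` makes the threshold `s / 32` contribute
-- `-21 * s`, while `hη` limits the mean term to `s`.
theorem prob_errors_le {L : ℕ} {η : ℝ} (h0 : 0 ≤ η) (h1 : η ≤ 1) {B : ℝ}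
    (hη : Real.exp 672 * η * B ≤ 1) (lev : V → ℕ) (x : V) (hx : lev x ≤ L) (P : V → Prop)
    {D : ℕ} (hP : ((Finset.univ.filter P).card : ℝ) ≤ B * D) :
    prob (piW V (columnW V L η)) (fun ω =>
      ¬ (32 * 2 ^ lev x * (errorCount lev x P ω : ℤ) ≤ (D : ℤ))) ≤ Real.exp (-(20 * (D / 2 ^ lev x))) := by
  have key := upper_tail (isWeight_columnW (V := V) L h0 h1) (Finset.univ.filter P)
    (fun _ c => (c.1 : ℕ) * 2 ^ lev x < 2 ^ L ∧ c.2 x = true) (q := 1 / 2 ^ lev x * η) (l := 672)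
    (r := D / (32 * 2 ^ lev x)) (by norm_num) (fun y _ => (prob_column_error h0 h1 hx x).le)
  refine le_trans (prob_mono (isWeight_columnW L h0 h1).piW fun ω h => ?_) (key.trans ?_)
  · rw [not_le] at h
    rw [div_le_iff₀ (by positivity)]
    have h2 : (D : ℝ) < 32 * 2 ^ lev x * (errorCount lev x P ω : ℝ) := by exact_mod_cast h
    rw [mul_comm] at h2
    refine h2.le.trans (mul_le_mul_of_nonneg_right
      (Nat.cast_le.2 (Finset.card_le_card fun y hy => ?_)) (by positivity))
    simp only [Finset.mem_filter, Finset.mem_univ, true_and] at hy ⊢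
    exact ⟨hy.2.2.2.1, hy.2.2.1, hy.2.2.2.2⟩
  · refine Real.exp_le_exp.2 ?_
    set s : ℝ := D / 2 ^ lev x with hs
    have hs0 : 0 ≤ s := by positivity
    have e1 : (D : ℝ) / (32 * 2 ^ lev x) = s / 32 := by rw [hs]; field_simp
    have e2 : Real.exp 672 * (1 / 2 ^ lev x * η) * ((Finset.univ.filter P).card : ℝ) ≤
        Real.exp 672 * (1 / 2 ^ lev x * η) * (B * D) :=
      mul_le_mul_of_nonneg_left hP (by positivity)
    have e3 : Real.exp 672 * (1 / 2 ^ lev x * η) * (B * D) = (Real.exp 672 * η * B) * s := by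
      rw [hs]; field_simp
    have e4 := mul_le_mul_of_nonneg_right hη hs0
    rw [e1]
    linarith

open scoped Classical in
-- The mean is at least `7 / 16 * D / 2 ^ lev x`, and `3 / 5 * 7 / 16` exceeds twice the threshold
-- coefficient `1 / 8`.
theorem prob_samples_le {L : ℕ} {η : ℝ} (h0 : 0 ≤ η) (h1 : η ≤ 1) (lev : V → ℕ) (x : V)
    (hx : lev x ≤ L) (P : V → Prop) {D : ℕ}
    (hP : 7 * (D : ℤ) ≤ 16 * ((Finset.univ.filter fun y => lev y = 0 ∧ P y).card : ℤ)) :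
    prob (piW V (columnW V L η)) (fun ω =>
      ¬ ((D : ℤ) < 8 * 2 ^ lev x * (sampleCount lev x P ω : ℤ))) ≤ Real.exp (-(D / (8 * 2 ^ lev x))) := by
  have key := lower_tail (isWeight_columnW (V := V) L h0 h1)
    (Finset.univ.filter fun y => lev y = 0 ∧ P y)
    (fun _ c => (c.1 : ℕ) * 2 ^ lev x < 2 ^ L) (q := 1 / 2 ^ lev x)
    (r := D / (8 * 2 ^ lev x)) (fun y _ => (prob_column_label h0 h1 hx).ge)
  refine le_trans (prob_mono (isWeight_columnW L h0 h1).piW fun ω h => ?_) (key.trans ?_)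
  · rw [not_lt] at h
    rw [le_div_iff₀ (by positivity)]
    have h2 : 8 * 2 ^ lev x * (sampleCount lev x P ω : ℝ) ≤ (D : ℝ) := by exact_mod_cast h
    rw [mul_comm] at h2
    refine le_trans (mul_le_mul_of_nonneg_right
      (Nat.cast_le.2 (Finset.card_le_card fun y hy => ?_)) (by positivity)) h2
    simp only [Finset.mem_filter, Finset.mem_univ, true_and] at hy ⊢
    exact ⟨hy.1.1, hy.2, hy.1.2⟩
  · refine Real.exp_le_exp.2 ?_
    have hP' : 7 * (D : ℝ) ≤ 16 * ((Finset.univ.filter fun y => lev y = 0 ∧ P y).card : ℝ) := by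
      exact_mod_cast hP
    have e1 : (D : ℝ) / (8 * 2 ^ lev x) = 1 / 2 ^ lev x * (D / 8) := by field_simp
    have e2 : (0 : ℝ) < 1 / 2 ^ lev x := by positivity
    rw [e1]
    have e3 := mul_le_mul_of_nonneg_left hP' e2.le
    have e4 : 0 ≤ 1 / 2 ^ lev x * (D : ℝ) := by positivity
    nlinarith

end Decoding

namespace FinProb

theorem prob_exists₂_le {Ω ι κ : Type*} [Fintype Ω] {w : Ω → ℝ} (hw : IsWeight w) (s : Finset ι)
    (F : ι → Finset κ) (S : ι → κ → Ω → Prop) (β : ι → κ → ℝ)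
    (h : ∀ i ∈ s, ∀ x ∈ F i, prob w (S i x) ≤ β i x) :
    prob w (fun ω => ∃ i ∈ s, ∃ x ∈ F i, S i x ω) ≤ ∑ i ∈ s, ∑ x ∈ F i, β i x :=
  (prob_exists_le hw s fun i ω => ∃ x ∈ F i, S i x ω).trans (Finset.sum_le_sum fun i hi =>
    (prob_exists_le hw (F i) (S i)).trans (Finset.sum_le_sum (h i hi)))

end FinProb

namespace Decoding

open FinProb

variable {V : Type*} [Fintype V]

open scoped Classical in
/-- Levels and provisional sides on which a second round can build. -/
structure GoodLevels (N L : ℕ) (B ε : ℝ) (lev : V → ℕ) (side : V → Prop) (f : V → ℤ) : Prop where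
  few_outer : ∀ D : ℤ, 1 ≤ D → D ≤ N →
    32 * ((Finset.univ.filter fun v => lev v ≠ 0 ∧ sdist f v ≤ D).card : ℤ) ≤ D
  few_wrong : 32 * ((Finset.univ.filter fun v => lev v ≠ 0 ∧ ¬ (side v ↔ f v < 0)).card : ℤ) ≤ N
  resolved : ∀ v, L ≤ lev v → (side v ↔ f v < 0)
  core_card : ((Finset.univ.filter fun v => lev v = 0).card : ℝ) ≤ B * N
  outer_weight : ∑ x ∈ Finset.univ.filter (fun v => lev v < L), 1 / (2 : ℝ) ^ lev x ≤ B * N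
  risk : ∑ D ∈ Finset.Icc 1 N, ∑ x ∈ Finset.univ.filter (fun v => 1 ≤ lev v ∧ lev v < L ∧
    min (sdist f v) N ≤ D), Real.exp (-((D : ℝ) / (8 * 2 ^ lev x))) ≤ ε

open scoped Classical in
theorem card_sdist_le {f : V → ℤ} (hf : Function.Injective f) (D : ℕ) :
    (Finset.univ.filter fun v => sdist f v ≤ D).card ≤ 2 * D := by
  have h := Finset.card_le_card_of_injOn (s := Finset.univ.filter fun v => sdist f v ≤ D)
    (t := Finset.Ico (-(D : ℤ)) D) f (fun v hv => by
      simp only [Finset.coe_filter, Finset.mem_univ, true_and, Set.mem_ofPred_eq, sdist,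
        max_le_iff] at hv
      simp only [Finset.coe_Ico, Set.mem_Ico]
      omega) hf.injOn
  rw [Int.card_Ico] at h
  omega

variable [DecidableEq V]

/-- A union bound over scales and items. Core items contribute the `1 / 100`; for ring items the
errors and the two sample conditions cost one `risk` each. The relation `R` is arbitrary away from
the comparisons made, as the decoder may see anything there. -/
theorem second_round {N L : ℕ} (hL : 1 ≤ L) {B ε η : ℝ} (hB2 : 2 ≤ B)
    (hB : B ≤ 100000) (h0 : 0 ≤ η) (h1 : η ≤ 1) (hη : Real.exp 672 * η * B ≤ 1) {a b : ℤ}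
    (ha : 0 ≤ a) (hb : 0 ≤ b) {f : V → ℤ} (hf : IsRanking a b f) {lev : V → ℕ} {side : V → Prop}
    (hg : GoodLevels N L B ε lev side f) :
    prob (piW V (columnW V L η)) (fun ω => ¬ ∀ R : V → V → Prop,
      (∀ x y, lev x < L → lev y = 0 → Sampled (fun v => (ω v).1) (lev x) y → y ≠ x →
        ((R x y ↔ ¬ f x < f y) ↔ (ω y).2 x = true)) →
      Consistent N L lev side (Sampled (fun v => (ω v).1)) R a b f) ≤ 3 * ε + 1 / 100 := by
  classical
  have hw := isWeight_columnW (V := V) L h0 h1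
  -- Below `N` the window holds at most `2 * D` items. At `D = N` the truncated distance admits the
  -- whole core, whence the need for `core_card`.
  have hwin : ∀ D : ℕ, D ≤ N → ((Finset.univ.filter fun y => lev y = 0 ∧
      min (sdist f y) N ≤ D).card : ℝ) ≤ B * D := by
    intro D hD
    rcases hD.lt_or_eq with hlt | rfl
    · have h2 : (Finset.univ.filter fun y => lev y = 0 ∧ min (sdist f y) N ≤ D).card ≤ 2 * D := by
        refine (Finset.card_le_card fun y hy => ?_).trans (card_sdist_le hf.inj D)
        simp only [Finset.mem_filter, Finset.mem_univ, true_and] at hy ⊢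
        omega
      have h3 : ((Finset.univ.filter fun y => lev y = 0 ∧
        min (sdist f y) N ≤ D).card : ℝ) ≤ 2 * D := by exact_mod_cast h2
      nlinarith [Nat.cast_nonneg (α := ℝ) D]
    · refine le_trans (Nat.cast_le.2 (Finset.card_le_card fun y hy => ?_)) hg.core_card
      simp only [Finset.mem_filter, Finset.mem_univ, true_and] at hy ⊢
      exact hy.1
  let F0 : ℕ → Finset V := fun D => Finset.univ.filter fun x => lev x = 0 ∧
    min (sdist f x) N ≤ D
  let F1 : ℕ → Finset V := fun D => Finset.univ.filter fun v => 1 ≤ lev v ∧ lev v < L ∧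
    min (sdist f v) N ≤ D
  let ErrBad : ℕ → V → (V → Fin (2 ^ L) × (V → Bool)) → Prop := fun D x ω =>
    ¬ (32 * 2 ^ lev x *
      (errorCount lev x (fun y => lev y = 0 ∧ min (sdist f y) N ≤ D) ω : ℤ) ≤ (D : ℤ))
  let TopBad : ℕ → V → (V → Fin (2 ^ L) × (V → Bool)) → Prop := fun D x ω =>
    (32 ≤ D ∧ (D : ℤ) ≤ a) ∧ ¬ ((D : ℤ) < 8 * 2 ^ lev x *
      (sampleCount lev x (fun y => -(D : ℤ) ≤ 2 * f y ∧ f y < 0) ω : ℤ))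
  let BotBad : ℕ → V → (V → Fin (2 ^ L) × (V → Bool)) → Prop := fun D x ω =>
    (32 ≤ D ∧ (D : ℤ) ≤ b) ∧ ¬ ((D : ℤ) < 8 * 2 ^ lev x *
      (sampleCount lev x (fun y => 0 ≤ f y ∧ 2 * f y ≤ (D : ℤ) - 2) ω : ℤ))
  have hErr : ∀ D ∈ Finset.Icc 1 N, ∀ x, lev x < L →
      prob (piW V (columnW V L η)) (ErrBad D x) ≤ Real.exp (-(20 * (D / 2 ^ lev x))) := by
    intro D hD x hx
    exact prob_errors_le h0 h1 hη lev x hx.le _ (by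
      convert hwin D (Finset.mem_Icc.1 hD).2)
  have b0 : prob (piW V (columnW V L η)) (fun ω => ∃ D ∈ Finset.Icc 1 N, ∃ x ∈ F0 D,
      ErrBad D x ω) ≤ 1 / 100 := by
    refine (prob_exists₂_le hw.piW (Finset.Icc 1 N) F0 ErrBad
      (fun D x => Real.exp (-(20 * D))) (fun D hD x hx => ?_)).trans ?_
    · have hx' := (Finset.mem_filter.1 hx).2
      have := hErr D hD x (by omega)
      rw [hx'.1] at this
      simpa using this
    -- The window size is absorbed by `D ≤ exp D`, at the price of one unit in the exponent.
    · have h2 : ∀ D ∈ Finset.Icc 1 N, ∑ x ∈ F0 D, Real.exp (-(20 * (D : ℝ))) ≤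
          B * Real.exp (-((19 : ℕ) * (D : ℝ))) := by
        intro D hD
        rw [Finset.sum_const, nsmul_eq_mul]
        have h3 := hwin D (Finset.mem_Icc.1 hD).2
        have h4 : (D : ℝ) ≤ Real.exp D := by linarith [Real.add_one_le_exp (D : ℝ)]
        have h5 : Real.exp (-((19 : ℕ) * (D : ℝ))) = Real.exp D * Real.exp (-(20 * (D : ℝ))) := by
          rw [← Real.exp_add]; congr 1; push_cast; ring
        rw [h5, ← mul_assoc]
        refine mul_le_mul_of_nonneg_right (h3.trans ?_) (Real.exp_pos _).le
        exact mul_le_mul_of_nonneg_left h4 (by linarith)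
      refine (Finset.sum_le_sum h2).trans ?_
      rw [← Finset.mul_sum]
      have h6 := sum_Icc_exp_le 19 N (by norm_num)
      have h7 : (0 : ℝ) ≤ 2 * (1 / 2.7) ^ 19 := by positivity
      calc B * _ ≤ B * (2 * (1 / 2.7 : ℝ) ^ 19) := mul_le_mul_of_nonneg_left h6 (by linarith)
        _ ≤ 100000 * (2 * (1 / 2.7 : ℝ) ^ 19) := mul_le_mul_of_nonneg_right hB h7
        _ ≤ 1 / 100 := by norm_num
  have b1 : prob (piW V (columnW V L η)) (fun ω => ∃ D ∈ Finset.Icc 1 N, ∃ x ∈ F1 D,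
      ErrBad D x ω) ≤ ε := by
    refine (prob_exists₂_le hw.piW (Finset.Icc 1 N) F1 ErrBad
      (fun D x => Real.exp (-((D : ℝ) / (8 * 2 ^ lev x)))) (fun D hD x hx => ?_)).trans hg.risk
    have hx' := (Finset.mem_filter.1 hx).2
    refine (hErr D hD x hx'.2.1).trans (Real.exp_le_exp.2 ?_)
    have e1 : (D : ℝ) / (8 * 2 ^ lev x) = (D / 2 ^ lev x) / 8 := by field_simp
    have e2 : (0 : ℝ) ≤ D / 2 ^ lev x := by positivity
    rw [e1]
    linarith
  -- Removing at most `D / 32` outer items from about `D / 2` leaves `7 / 16 * D`; `32 ≤ D` absorbs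
  -- the rounding.
  have houter : ∀ D : ℕ, 32 ≤ D → D ≤ N → ∀ P : V → Prop, (∀ y, P y → sdist f y ≤ D) →
      (D : ℤ) / 2 ≤ ((Finset.univ.filter P).card : ℤ) →
      7 * (D : ℤ) ≤ 16 * ((Finset.univ.filter fun y => lev y = 0 ∧ P y).card : ℤ) := by
    intro D hD hDN P hP hPc
    have h2 := hg.few_outer D (by omega) (by omega)
    have h3 : Finset.univ.filter P ⊆ (Finset.univ.filter fun y => lev y = 0 ∧ P y) ∪
        (Finset.univ.filter fun v => lev v ≠ 0 ∧ sdist f v ≤ D) := by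
      intro y hy
      simp only [Finset.mem_filter, Finset.mem_univ, true_and, Finset.mem_union] at hy ⊢
      by_cases h : lev y = 0
      · exact Or.inl ⟨h, hy⟩
      · exact Or.inr ⟨h, hP y hy⟩
    have h4 := (Finset.card_le_card h3).trans (Finset.card_union_le _ _)
    omega
  have b2 : prob (piW V (columnW V L η)) (fun ω => ∃ D ∈ Finset.Icc 1 N, ∃ x ∈ F1 D,
      TopBad D x ω) ≤ ε := by
    refine (prob_exists₂_le hw.piW (Finset.Icc 1 N) F1 TopBad
      (fun D x => Real.exp (-((D : ℝ) / (8 * 2 ^ lev x)))) (fun D hD x hx => ?_)).trans hg.risk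
    have hx' := (Finset.mem_filter.1 hx).2
    by_cases hc : 32 ≤ D ∧ (D : ℤ) ≤ a
    · refine (prob_mono hw.piW (fun ω h => h.2)).trans (prob_samples_le h0 h1 lev x hx'.2.1.le
        (fun y => -(D : ℤ) ≤ 2 * f y ∧ f y < 0) ?_)
      refine houter D hc.1 (Finset.mem_Icc.1 hD).2 _ (fun y hy => ?_) ?_
      · simp only [sdist]; omega
      · have h3 := hf.card_interval (l := -((D : ℤ) / 2)) (u := 0) (by omega) (by omega) hb
        refine le_trans (by omega) (h3.symm.le.trans (Nat.cast_le.2 (Finset.card_le_card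
          fun y hy => ?_)))
        simp only [Finset.mem_filter, Finset.mem_univ, true_and] at hy ⊢
        omega
    · refine le_trans (prob_mono hw.piW (T := fun _ => False) fun ω h => hc h.1) ?_
      rw [prob_false]
      exact (Real.exp_pos _).le
  have b3 : prob (piW V (columnW V L η)) (fun ω => ∃ D ∈ Finset.Icc 1 N, ∃ x ∈ F1 D,
      BotBad D x ω) ≤ ε := by
    refine (prob_exists₂_le hw.piW (Finset.Icc 1 N) F1 BotBad
      (fun D x => Real.exp (-((D : ℝ) / (8 * 2 ^ lev x)))) (fun D hD x hx => ?_)).trans hg.risk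
    have hx' := (Finset.mem_filter.1 hx).2
    by_cases hc : 32 ≤ D ∧ (D : ℤ) ≤ b
    · refine (prob_mono hw.piW (fun ω h => h.2)).trans (prob_samples_le h0 h1 lev x hx'.2.1.le
        (fun y => 0 ≤ f y ∧ 2 * f y ≤ (D : ℤ) - 2) ?_)
      refine houter D hc.1 (Finset.mem_Icc.1 hD).2 _ (fun y hy => ?_) ?_
      · simp only [sdist]; omega
      · have h3 := hf.card_interval (l := 0) (u := (D : ℤ) / 2) (by omega)
          (by omega) (by omega)
        refine le_trans (by omega) (h3.symm.le.trans (Nat.cast_le.2 (Finset.card_le_card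
          fun y hy => ?_)))
        simp only [Finset.mem_filter, Finset.mem_univ, true_and] at hy ⊢
        omega
    · refine le_trans (prob_mono hw.piW (T := fun _ => False) fun ω h => hc h.1) ?_
      rw [prob_false]
      exact (Real.exp_pos _).le
  have hall : prob (piW V (columnW V L η)) (fun ω =>
      ((∃ D ∈ Finset.Icc 1 N, ∃ x ∈ F0 D, ErrBad D x ω) ∨
        (∃ D ∈ Finset.Icc 1 N, ∃ x ∈ F1 D, ErrBad D x ω)) ∨
      ((∃ D ∈ Finset.Icc 1 N, ∃ x ∈ F1 D, TopBad D x ω) ∨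
        (∃ D ∈ Finset.Icc 1 N, ∃ x ∈ F1 D, BotBad D x ω))) ≤ 3 * ε + 1 / 100 := by
    refine (prob_or_le hw.piW _ _).trans ((add_le_add (prob_or_le hw.piW _ _)
      (prob_or_le hw.piW _ _)).trans ?_)
    linarith
  refine le_trans (prob_mono hw.piW fun ω h => ?_) hall
  by_contra hn
  push Not at hn
  obtain ⟨⟨n0, n1⟩, n2, n3⟩ := hn
  refine h fun R hR => ⟨hg.few_outer, hg.few_wrong, hg.resolved, ?_, ?_, ?_⟩
  · intro x hx D hD hDN hxD
    lift D to ℕ using by omega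
    have hDm : D ∈ Finset.Icc 1 N := Finset.mem_Icc.2 ⟨by omega, by omega⟩
    have key : ¬ ErrBad D x ω := by
      rcases Nat.eq_zero_or_pos (lev x) with hx0 | hx0
      · exact n0 D hDm x (Finset.mem_filter.2 ⟨Finset.mem_univ _, hx0, hxD⟩)
      · exact n1 D hDm x (Finset.mem_filter.2 ⟨Finset.mem_univ _, hx0, hx, hxD⟩)
    refine le_trans (mul_le_mul_of_nonneg_left (Nat.cast_le.2 (Finset.card_le_card
      fun y hy => ?_)) (by positivity)) (not_not.1 key)
    simp only [Finset.mem_filter, Finset.mem_univ, true_and] at hy ⊢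
    exact ⟨hy.1, hy.2.1, hy.2.2.1, ⟨hy.1, hy.2.2.2.1⟩,
      (hR x y hx hy.1 hy.2.2.1 hy.2.1).1 hy.2.2.2.2⟩
  · intro x hx1 hx D hD hDN hxD hDa
    lift D to ℕ using by omega
    have hDm : D ∈ Finset.Icc 1 N := Finset.mem_Icc.2 ⟨by omega, by omega⟩
    have key := n2 D hDm x (Finset.mem_filter.2 ⟨Finset.mem_univ _, hx1, hx, hxD⟩)
    have key' := not_not.1 fun hc => key ⟨⟨by omega, hDa⟩, hc⟩
    refine key'.trans_le (mul_le_mul_of_nonneg_left (Nat.cast_le.2 (Finset.card_le_card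
      fun y hy => ?_)) (by positivity))
    simp only [Finset.mem_filter, Finset.mem_univ, true_and] at hy ⊢
    exact hy
  · intro x hx1 hx D hD hDN hxD hDb
    lift D to ℕ using by omega
    have hDm : D ∈ Finset.Icc 1 N := Finset.mem_Icc.2 ⟨by omega, by omega⟩
    have key := n3 D hDm x (Finset.mem_filter.2 ⟨Finset.mem_univ _, hx1, hx, hxD⟩)
    have key' := not_not.1 fun hc => key ⟨⟨by omega, hDb⟩, hc⟩
    refine key'.trans_le (mul_le_mul_of_nonneg_left (Nat.cast_le.2 (Finset.card_le_card
      fun y hy => ?_)) (by positivity))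
    simp only [Finset.mem_filter, Finset.mem_univ, true_and] at hy ⊢
    exact hy

open scoped Classical in
/-- The comparisons of the second round. -/
noncomputable def secondQueries {L : ℕ} (lev : V → ℕ) (label : V → Fin (2 ^ L)) :
    Finset (V × V) :=
  Finset.univ.filter fun p => lev p.1 < L ∧ lev p.2 = 0 ∧ Sampled label (lev p.1) p.2

/-- Markov's inequality: the expected number of comparisons is the core size times the sum of the
sampling rates, at most `(B * N) ^ 2`. -/
theorem second_round_queries {N L : ℕ} {B ε : ℝ} (hB : 0 < B) (hN : 0 < N)
    {f : V → ℤ} {lev : V → ℕ} {side : V → Prop} (hg : GoodLevels N L B ε lev side f) :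
    prob (piW V (unifW (Fin (2 ^ L)))) (fun l =>
      100 * (B * N) ^ 2 ≤ ((secondQueries lev l).card : ℝ)) ≤ 1 / 100 := by
  classical
  have hw : IsWeight (piW V (unifW (Fin (2 ^ L)))) := (isWeight_unifW _).piW
  have hpos : 0 < 100 * (B * N) ^ 2 := by positivity
  refine (prob_le_expect_div hw (fun l => Nat.cast_nonneg _) hpos).trans ?_
  rw [div_le_iff₀ hpos]
  have h1 : ∀ l : V → Fin (2 ^ L), ((secondQueries lev l).card : ℝ) =
      ∑ x ∈ Finset.univ.filter (fun v => lev v < L), ∑ y ∈ Finset.univ.filter (fun v => lev v = 0),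
        if ((l y : Fin (2 ^ L)) : ℕ) * 2 ^ lev x < 2 ^ L then (1 : ℝ) else 0 := by
    intro l
    rw [← Finset.sum_product' (f := fun x y =>
      if ((l y : Fin (2 ^ L)) : ℕ) * 2 ^ lev x < 2 ^ L then (1 : ℝ) else 0), Finset.sum_boole]
    congr 2
    ext p
    simp only [secondQueries, Finset.mem_filter, Finset.mem_univ, true_and, Finset.mem_product]
    exact ⟨fun h => ⟨⟨h.1, h.2.1⟩, h.2.2⟩, fun h => ⟨h.1.1, h.1.2, h.2⟩⟩
  simp only [h1]
  rw [expect_sum]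
  have h2 : ∀ x ∈ Finset.univ.filter (fun v => lev v < L),
      expect (piW V (unifW (Fin (2 ^ L)))) (fun l =>
        ∑ y ∈ Finset.univ.filter (fun v => lev v = 0),
        if ((l y : Fin (2 ^ L)) : ℕ) * 2 ^ lev x < 2 ^ L then (1 : ℝ) else 0) =
      ((Finset.univ.filter fun v => lev v = 0).card : ℝ) * (1 / 2 ^ lev x) := by
    intro x hx
    rw [expect_sum]
    have h3 : ∀ y ∈ Finset.univ.filter (fun v => lev v = 0),
        expect (piW V (unifW (Fin (2 ^ L)))) (fun l =>
          if ((l y : Fin (2 ^ L)) : ℕ) * 2 ^ lev x < 2 ^ L then (1 : ℝ) else 0) =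
          1 / 2 ^ lev x := by
      intro y _
      rw [← prob_eq_expect, prob_piW_apply (isWeight_unifW _) y
        (fun l : Fin (2 ^ L) => (l : ℕ) * 2 ^ lev x < 2 ^ L),
        prob_label (Finset.mem_filter.1 hx).2.le]
    rw [Finset.sum_congr rfl h3, Finset.sum_const, nsmul_eq_mul]
  rw [Finset.sum_congr rfl h2, ← Finset.mul_sum]
  have h4 := mul_le_mul hg.core_card hg.outer_weight
    (Finset.sum_nonneg fun x _ => by positivity) (by positivity)
  have h5 : (1 : ℝ) / 100 * (100 * (B * N) ^ 2) = B * N * (B * N) := by ring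
  rw [h5]
  exact h4

end Decoding

/-! ### Levels from pivots: a misleading level forces many errors -/

namespace Pivots

open FinProb Decoding

variable {V J : Type*} [Fintype J]

open scoped Classical in
/-- The number of pivots, estimated to lie at most `j` units above the boundary, that `x` beats. -/
noncomputable def topWins (N : ℕ) (piv : J → V) (est : J → ℝ) (z : V → J → Bool) (x : V) (j : ℕ) :
    ℕ :=
  (Finset.univ.filter fun i => -((j * (256 * N) : ℕ) : ℝ) ≤ est i ∧ est i < 0 ∧ piv i ≠ x ∧
    z x i = true).card

open scoped Classical in
/-- The number of pivots, estimated to lie at most `j` units below the boundary, that beat `x`. -/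
noncomputable def botLosses (N : ℕ) (piv : J → V) (est : J → ℝ) (z : V → J → Bool) (x : V)
    (j : ℕ) : ℕ :=
  (Finset.univ.filter fun i => 0 ≤ est i ∧ est i < ((j * (256 * N) : ℕ) : ℝ) ∧ piv i ≠ x ∧
    z x i = false).card

/-- `x` looks like an item at least `j` units above the boundary. -/
def ResTop (N : ℕ) (piv : J → V) (est : J → ℝ) (z : V → J → Bool) (x : V) (j : ℕ) : Prop :=
  10000 * j ≤ 4 * topWins N piv est z x j

/-- `x` looks like an item at least `j` units below the boundary. -/
def ResBot (N : ℕ) (piv : J → V) (est : J → ℝ) (z : V → J → Bool) (x : V) (j : ℕ) : Prop :=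
  10000 * j ≤ 4 * botLosses N piv est z x j

open scoped Classical in
/-- The largest scale, up to `L`, at which `x` looks like an item away from the boundary. -/
noncomputable def level (N L : ℕ) (piv : J → V) (est : J → ℝ) (z : V → J → Bool) (x : V) : ℕ :=
  Nat.findGreatest (fun j => 1 ≤ j ∧ (ResTop N piv est z x j ∨ ResBot N piv est z x j)) L

/-- The side of the boundary on which `x` appears at its level. -/
def topSide (N L : ℕ) (piv : J → V) (est : J → ℝ) (z : V → J → Bool) (x : V) : Prop :=
  ResTop N piv est z x (level N L piv est z x)

open scoped Classical in
/-- Many errors among the comparisons with the pivots within about `j` units of the boundary. -/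
def BadRow (N : ℕ) (f : V → ℤ) (piv : J → V) (j : ℕ) (r : J → Bool) : Prop :=
  10000 * j ≤ 8 * (Finset.univ.filter fun i => sdist f (piv i) ≤ ((j + 1) * (256 * N) : ℕ) ∧
    r i = true).card

open scoped Classical in
/-- The pivots are spread around the boundary as expected. -/
structure GoodPivots (N L : ℕ) (a b : ℤ) (f : V → ℤ) (piv : J → V) : Prop where
  near : 8 * (Finset.univ.filter fun i => sdist f (piv i) ≤ (2 * N : ℕ)).card ≤ 10000
  upper : ∀ j ∈ Finset.Icc 1 L, (Finset.univ.filter fun i =>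
    sdist f (piv i) ≤ ((j + 1) * (256 * N) : ℕ)).card ≤ 320000 * j
  top : ∀ j ∈ Finset.Icc 1 L, ((j * (256 * N) : ℕ) : ℤ) ≤ a → 10000 * j ≤
    2 * (Finset.univ.filter fun i => -((j * (256 * N) : ℕ) : ℤ) + N ≤ f (piv i) ∧
      f (piv i) < -N).card
  bot : ∀ j ∈ Finset.Icc 1 L, ((j * (256 * N) : ℕ) : ℤ) ≤ b → 10000 * j ≤
    2 * (Finset.univ.filter fun i => (N : ℤ) ≤ f (piv i) ∧
      f (piv i) < ((j * (256 * N) : ℕ) : ℤ) - N).card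

variable {N L : ℕ} {a b : ℤ} {f : V → ℤ} {piv : J → V} {est : J → ℝ} {z e : V → J → Bool}

section facts

variable (hf : IsRanking a b f) (hp : GoodPivots N L a b f piv)
  (hest : ∀ i, |est i - f (piv i)| ≤ N)
  (hobs : ∀ x i, piv i ≠ x → z x i = (decide (f x < f (piv i)) ^^ e x i))

include hp hest hobs

/-- At least `2500 * j` wins were seen. As `x` is not more than `N` above the boundary, the honest
ones are against pivots within `2 * N`, at most `1250` of them; the remaining `1250 * j` or more are
errors. -/
theorem badRow_of_resTop {x : V} {j : ℕ} (hj : 1 ≤ j) (hx : -(N : ℤ) ≤ f x)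
    (h : ResTop N piv est z x j) : BadRow N f piv j (e x) := by
  classical
  unfold ResTop topWins at h
  unfold BadRow
  have hsub : (Finset.univ.filter fun i => -((j * (256 * N) : ℕ) : ℝ) ≤ est i ∧ est i < 0 ∧
      piv i ≠ x ∧ z x i = true) ⊆ (Finset.univ.filter fun i => sdist f (piv i) ≤ (2 * N : ℕ)) ∪
      (Finset.univ.filter fun i => sdist f (piv i) ≤ ((j + 1) * (256 * N) : ℕ) ∧
        e x i = true) := by
    intro i hi
    simp only [Finset.mem_filter, Finset.mem_univ, true_and, Finset.mem_union] at hi ⊢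
    obtain ⟨h1, h2, h3, h4⟩ := hi
    have h5 := abs_le.1 (hest i)
    have h6 : (-((j * (256 * N) : ℕ) : ℤ) - N : ℤ) ≤ f (piv i) := by
      have : ((-((j * (256 * N) : ℕ) : ℤ) - N : ℤ) : ℝ) ≤ f (piv i) := by
        push_cast at h1 ⊢; linarith
      exact_mod_cast this
    have h7 : f (piv i) < (N : ℤ) := by
      have : (f (piv i) : ℝ) < ((N : ℤ) : ℝ) := by push_cast; linarith
      exact_mod_cast this
    have h8 := hobs x i h3
    rw [h4] at h8
    by_cases hlt : f x < f (piv i)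
    · left
      simp only [sdist]; push_cast; omega
    · right
      refine ⟨?_, by simpa [hlt] using h8.symm⟩
      simp only [sdist]
      push_cast at h6 ⊢
      rw [max_le_iff]
      have h9 : (0 : ℤ) ≤ j * (256 * N) := by positivity
      constructor <;> linarith
  have hc := (Finset.card_le_card hsub).trans (Finset.card_union_le _ _)
  have := hp.near
  omega

theorem badRow_of_resBot {x : V} {j : ℕ} (hj : 1 ≤ j) (hx : f x ≤ N)
    (h : ResBot N piv est z x j) : BadRow N f piv j (e x) := by
  classical
  unfold ResBot botLosses at h
  unfold BadRow
  have hsub : (Finset.univ.filter fun i => 0 ≤ est i ∧ est i < ((j * (256 * N) : ℕ) : ℝ) ∧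
      piv i ≠ x ∧ z x i = false) ⊆ (Finset.univ.filter fun i => sdist f (piv i) ≤ (2 * N : ℕ)) ∪
      (Finset.univ.filter fun i => sdist f (piv i) ≤ ((j + 1) * (256 * N) : ℕ) ∧
        e x i = true) := by
    intro i hi
    simp only [Finset.mem_filter, Finset.mem_univ, true_and, Finset.mem_union] at hi ⊢
    obtain ⟨h1, h2, h3, h4⟩ := hi
    have h5 := abs_le.1 (hest i)
    have h6 : f (piv i) < (((j * (256 * N) : ℕ) : ℤ) + N : ℤ) := by
      have : (f (piv i) : ℝ) < ((((j * (256 * N) : ℕ) : ℤ) + N : ℤ) : ℝ) := by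
        push_cast at h2 ⊢; linarith
      exact_mod_cast this
    have h7 : -(N : ℤ) ≤ f (piv i) := by
      have : ((-(N : ℤ) : ℤ) : ℝ) ≤ f (piv i) := by push_cast; linarith
      exact_mod_cast this
    have h8 := hobs x i h3
    rw [h4] at h8
    by_cases hlt : f x < f (piv i)
    · right
      refine ⟨?_, by simpa [hlt] using h8.symm⟩
      simp only [sdist]
      push_cast at h6 ⊢
      rw [max_le_iff]
      have h9 : (0 : ℤ) ≤ j * (256 * N) := by positivity
      constructor <;> linarith
    · left
      have hN : 1 ≤ N := by
        by_contra h0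
        have : N = 0 := by omega
        subst this
        simp at h2
        linarith
      simp only [sdist]; push_cast; omega
  have hc := (Finset.card_le_card hsub).trans (Finset.card_union_le _ _)
  have := hp.near
  omega

include hf

/-- At least `5000 * j` pivots lie safely inside the window and below `x`; fewer than `2500 * j`
wins leave more than enough losses, all of them errors. -/
theorem badRow_of_far_top {x : V} {j : ℕ} (hj : j ∈ Finset.Icc 1 L)
    (hx : f x < -(((j + 1) * (256 * N) : ℕ) : ℤ))
    (h : ¬ ResTop N piv est z x j) : BadRow N f piv j (e x) := by
  classical
  unfold ResTop topWins at h
  unfold BadRow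
  have hx' : f x < -((j * (256 * N) : ℕ) : ℤ) - 256 * N := by push_cast at hx ⊢; linarith
  have hp3 := hp.top j hj (by have := hf.lower x; omega)
  have hsub : (Finset.univ.filter fun i => -((j * (256 * N) : ℕ) : ℤ) + N ≤ f (piv i) ∧
      f (piv i) < -N) ⊆ (Finset.univ.filter fun i => -((j * (256 * N) : ℕ) : ℝ) ≤ est i ∧
      est i < 0 ∧ piv i ≠ x ∧ z x i = true) ∪
      (Finset.univ.filter fun i => sdist f (piv i) ≤ ((j + 1) * (256 * N) : ℕ) ∧
        e x i = true) := by
    intro i hi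
    simp only [Finset.mem_filter, Finset.mem_univ, true_and, Finset.mem_union] at hi ⊢
    obtain ⟨h1, h2⟩ := hi
    have h5 := abs_le.1 (hest i)
    have hne : piv i ≠ x := by rintro rfl; omega
    have h8 := hobs x i hne
    have hlt : f x < f (piv i) := by omega
    have h1' : ((-((j * (256 * N) : ℕ) : ℤ) + N : ℤ) : ℝ) ≤ f (piv i) := by exact_mod_cast h1
    have h2' : (f (piv i) : ℝ) < ((-N : ℤ) : ℝ) := by exact_mod_cast h2
    by_cases he : e x i = true
    · right
      refine ⟨?_, he⟩
      simp only [sdist]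
      push_cast at h1 ⊢
      rw [max_le_iff]
      have h9 : (0 : ℤ) ≤ j * (256 * N) := by positivity
      constructor <;> linarith
    · left
      refine ⟨?_, ?_, hne, by simpa [hlt, he] using h8⟩
      · push_cast at h1' ⊢; linarith
      · push_cast at h2'; linarith
  have hc := (Finset.card_le_card hsub).trans (Finset.card_union_le _ _)
  omega

theorem badRow_of_far_bot {x : V} {j : ℕ} (hj : j ∈ Finset.Icc 1 L)
    (hx : (((j + 1) * (256 * N) : ℕ) : ℤ) ≤ f x)
    (h : ¬ ResBot N piv est z x j) : BadRow N f piv j (e x) := by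
  classical
  unfold ResBot botLosses at h
  unfold BadRow
  have hx' : ((j * (256 * N) : ℕ) : ℤ) + 256 * N ≤ f x := by push_cast at hx ⊢; linarith
  have hp3 := hp.bot j hj (by have := hf.upper x; omega)
  have hsub : (Finset.univ.filter fun i => (N : ℤ) ≤ f (piv i) ∧
      f (piv i) < ((j * (256 * N) : ℕ) : ℤ) - N) ⊆ (Finset.univ.filter fun i => 0 ≤ est i ∧
      est i < ((j * (256 * N) : ℕ) : ℝ) ∧ piv i ≠ x ∧ z x i = false) ∪
      (Finset.univ.filter fun i => sdist f (piv i) ≤ ((j + 1) * (256 * N) : ℕ) ∧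
        e x i = true) := by
    intro i hi
    simp only [Finset.mem_filter, Finset.mem_univ, true_and, Finset.mem_union] at hi ⊢
    obtain ⟨h1, h2⟩ := hi
    have h5 := abs_le.1 (hest i)
    have hne : piv i ≠ x := by rintro rfl; omega
    have h8 := hobs x i hne
    have hlt : ¬ f x < f (piv i) := by omega
    have h1' : ((N : ℤ) : ℝ) ≤ f (piv i) := by exact_mod_cast h1
    have h2' : (f (piv i) : ℝ) < ((((j * (256 * N) : ℕ) : ℤ) - N : ℤ) : ℝ) := by exact_mod_cast h2
    by_cases he : e x i = true
    · right
      refine ⟨?_, he⟩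
      simp only [sdist]
      push_cast at h2 ⊢
      rw [max_le_iff]
      have h9 : (0 : ℤ) ≤ j * (256 * N) := by positivity
      constructor <;> linarith
    · left
      refine ⟨?_, ?_, hne, by simpa [hlt, he] using h8⟩
      · push_cast at h1'; linarith
      · push_cast at h2' ⊢; linarith
  have hc := (Finset.card_le_card hsub).trans (Finset.card_union_le _ _)
  omega

end facts

open scoped Classical in
theorem level_le (x : V) : level N L piv est z x ≤ L := Nat.findGreatest_le _

open scoped Classical in
theorem res_level {x : V} (h : level N L piv est z x ≠ 0) :
    ResTop N piv est z x (level N L piv est z x) ∨ ResBot N piv est z x (level N L piv est z x) := by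
  unfold level at h ⊢
  exact (Nat.findGreatest_of_ne_zero rfl h).2

open scoped Classical in
theorem not_res {x : V} {j : ℕ} (h : level N L piv est z x < j) (hj : j ≤ L) :
    ¬ (ResTop N piv est z x j ∨ ResBot N piv est z x j) := by
  unfold level at h
  exact fun h' => Nat.findGreatest_is_greatest h hj ⟨by omega, h'⟩

/-- Errors at a scale that is comparable to the distance of `x` from the boundary. -/
def Unlucky (N L : ℕ) (f : V → ℤ) (piv : J → V) (e : V → J → Bool) (x : V) : Prop :=
  ∃ s ∈ Finset.Icc 1 L, BadRow N f piv s (e x) ∧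
    (sdist f x ≤ ((s + 2) * (256 * N) : ℕ) ∨ s = L)

section consequences

variable (hf : IsRanking a b f) (hp : GoodPivots N L a b f piv)
  (hest : ∀ i, |est i - f (piv i)| ≤ N)
  (hobs : ∀ x i, piv i ≠ x → z x i = (decide (f x < f (piv i)) ^^ e x i))

include hp hest hobs

theorem badRow_of_near {x : V} (hx : sdist f x ≤ N) (h : level N L piv est z x ≠ 0) :
    BadRow N f piv (level N L piv est z x) (e x) := by
  simp only [sdist] at hx
  rcases res_level h with h1 | h1
  · exact badRow_of_resTop hp hest hobs (by omega) (by omega) h1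
  · exact badRow_of_resBot hp hest hobs (by omega) (by omega) h1

theorem badRow_of_wrong {x : V} (h : level N L piv est z x ≠ 0)
    (hw : ¬ (topSide N L piv est z x ↔ f x < 0)) :
    BadRow N f piv (level N L piv est z x) (e x) := by
  by_cases ht : topSide N L piv est z x
  · have : ¬ f x < 0 := fun h' => hw ⟨fun _ => h', fun _ => ht⟩
    exact badRow_of_resTop hp hest hobs (by omega) (by omega) ht
  · have : f x < 0 := by
      by_contra h'
      exact hw ⟨fun h'' => absurd h'' ht, fun h'' => absurd h'' h'⟩
    exact badRow_of_resBot hp hest hobs (by omega) (by omega) ((res_level h).resolve_left ht)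

include hf

/-- Maximality of the level means that `x` failed the test at every larger scale up to `L`, in
particular at the scale matching its true distance, where it should have passed. -/
theorem unlucky_of_far (hN : 1 ≤ N) {x : V} (hL : level N L piv est z x < L)
    (hx : (((level N L piv est z x + 2) * (256 * N) : ℕ) : ℤ) < sdist f x) :
    Unlucky N L f piv e x := by
  set t := level N L piv est z x with ht
  obtain ⟨d, hd⟩ : ∃ d : ℕ, sdist f x = d + 1 := ⟨(sdist f x - 1).toNat, by
    simp only [sdist]; omega⟩
  have hd2 : (t + 2) * (256 * N) ≤ d := by
    rw [hd] at hx
    exact_mod_cast Int.lt_add_one_iff.1 hx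
  set q := d / (256 * N) with hq
  have hq1 : t + 2 ≤ q := (Nat.le_div_iff_mul_le (by omega)).2 hd2
  have hq2 : q * (256 * N) ≤ d := Nat.div_mul_le_self _ _
  have hq3 : d < (q + 1) * (256 * N) := by
    have := Nat.lt_mul_div_succ d (show 0 < 256 * N by omega)
    rw [mul_comm]; exact this
  -- One unit less than the distance `q` in whole units leaves the margin `(j + 1)` required for a
  -- far item, and the distance is still at most `j + 2` units unless `j = L`.
  set j := min L (q - 1) with hj
  have hjm : j ∈ Finset.Icc 1 L := Finset.mem_Icc.2 ⟨by omega, by omega⟩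
  have hnot := not_res (N := N) (L := L) (piv := piv) (est := est) (z := z) (x := x) (j := j)
    (by omega) (by omega)
  rw [not_or] at hnot
  have hjd : (j + 1) * (256 * N) ≤ d :=
    (Nat.mul_le_mul_right _ (by omega : j + 1 ≤ q)).trans hq2
  refine ⟨j, hjm, ?_, ?_⟩
  · by_cases hneg : f x < 0
    · refine badRow_of_far_top hf hp hest hobs hjm ?_ hnot.1
      simp only [sdist] at hd
      omega
    · refine badRow_of_far_bot hf hp hest hobs hjm ?_ hnot.2
      simp only [sdist] at hd
      omega
  · rcases Nat.lt_or_ge L q with h | h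
    · right; omega
    · left
      have h1 : j + 2 = q + 1 := by omega
      rw [h1, hd]
      exact_mod_cast hq3

theorem unlucky_of_wrong (hN : 1 ≤ N) {x : V} (h : level N L piv est z x ≠ 0)
    (hw : ¬ (topSide N L piv est z x ↔ f x < 0)) : Unlucky N L f piv e x := by
  by_cases hL : level N L piv est z x < L
  · by_cases hx : (((level N L piv est z x + 2) * (256 * N) : ℕ) : ℤ) < sdist f x
    · exact unlucky_of_far hf hp hest hobs hN hL hx
    · exact ⟨_, Finset.mem_Icc.2 ⟨by omega, hL.le⟩, badRow_of_wrong hp hest hobs h hw,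
        Or.inl (by omega)⟩
  · have := level_le (N := N) (L := L) (piv := piv) (est := est) (z := z) x
    exact ⟨_, Finset.mem_Icc.2 ⟨by omega, this⟩, badRow_of_wrong hp hest hobs h hw,
      Or.inr (by omega)⟩

end consequences

end Pivots

/-! ### Probabilities of misleading rows -/

namespace Pivots

open FinProb Decoding

theorem sum_Icc_inv_sq_le {N : ℕ} (hN : 1 ≤ N) :
    ∑ D ∈ Finset.Icc 1 N, 1 / (D : ℝ) ^ 2 ≤ 2 - 1 / (N : ℝ) := by
  induction N, hN using Nat.le_induction with
  | base => norm_num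
  | succ N hN ih =>
    rw [Finset.sum_Icc_succ_top (by omega)]
    have hN' : (1 : ℝ) ≤ N := by exact_mod_cast hN
    have h1 : 1 / (((N + 1 : ℕ) : ℝ)) ^ 2 ≤ 1 / N - 1 / ((N + 1 : ℕ) : ℝ) := by
      push_cast
      rw [div_sub_div _ _ (by positivity) (by positivity), div_le_div_iff₀ (by positivity)
        (by positivity)]
      nlinarith
    linarith

theorem sum_range_linear_geometric_le (L : ℕ) :
    ∑ t ∈ Finset.range L, ((t : ℝ) + 2) * (1 / 2 ^ t) ≤ 6 := by
  have h : ∑ t ∈ Finset.range L, ((t : ℝ) + 2) * (1 / 2 ^ t) = 6 - (2 * L + 6) * (1 / 2 ^ L) := by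
    induction L with
    | zero => norm_num
    | succ L ih =>
      rw [Finset.sum_range_succ, ih, pow_succ]
      push_cast
      field_simp
      ring
  rw [h]
  have : (0 : ℝ) ≤ (2 * L + 6) * (1 / 2 ^ L) := by positivity
  linarith

theorem exp_neg_le_inv_cube {y : ℝ} (hy : 0 < y) : Real.exp (-y) ≤ 6 / y ^ 3 := by
  have h := Real.pow_div_factorial_le_exp y hy.le 3
  rw [Real.exp_neg, inv_eq_one_div, div_le_div_iff₀ (Real.exp_pos _) (by positivity)]
  norm_num [Nat.factorial] at h
  rw [div_le_iff₀ (by norm_num)] at h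
  linarith

theorem sum_Icc_exp_pow_le {m : ℕ} (hm : 1 ≤ m) (L : ℕ) :
    ∑ s ∈ Finset.Icc 1 L, Real.exp (-((m : ℝ) * s)) ≤ 2 * Real.exp (-(m : ℝ)) := by
  have h1 : Real.exp (-(m : ℝ)) ≤ 1 / 2 := by
    refine (exp_neg_le_pow m).trans ?_
    calc (1 / 2.7 : ℝ) ^ m ≤ (1 / 2.7 : ℝ) ^ 1 :=
          pow_le_pow_of_le_one (by norm_num) (by norm_num) hm
      _ ≤ _ := by norm_num
  refine le_trans (le_of_eq ?_) (sum_Icc_pow_le (Real.exp_pos _).le h1 L)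
  refine Finset.sum_congr rfl fun s _ => ?_
  rw [← Real.exp_nat_mul]; congr 1; ring

variable {V J : Type*} [Fintype J] [DecidableEq J]

/-- At least `1250 * j` errors among at most `320000 * j` comparisons, while `η ≤ 10 ^ (-6)` gives a
mean below `j`; the exponent `400` is not tight. -/
theorem prob_badRow_le {N L : ℕ} {a b : ℤ} {f : V → ℤ} {piv : J → V}
    (hp : GoodPivots N L a b f piv) {η : ℝ} (h0 : 0 ≤ η) (hη : η * 1000000 ≤ 1) {j : ℕ}
    (hj : j ∈ Finset.Icc 1 L) :
    prob (piW J (coinW η)) (BadRow N f piv j) ≤ Real.exp (-((400 : ℕ) * (j : ℝ))) := by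
  classical
  have hw : IsWeight (coinW η) := isWeight_coinW h0 (by linarith)
  have key := upper_tail hw (Finset.univ.filter fun i =>
    sdist f (piv i) ≤ ((j + 1) * (256 * N) : ℕ)) (fun _ b => b = true) (q := η) (l := 1)
    (r := 1250 * j) (by norm_num) (fun i _ => (prob_coinW η).le)
  refine (prob_mono hw.piW fun r hr => ?_).trans (key.trans (Real.exp_le_exp.2 ?_))
  · unfold BadRow at hr
    have h2 : 1250 * j ≤ (Finset.univ.filter fun i =>
      sdist f (piv i) ≤ ((j + 1) * (256 * N) : ℕ) ∧ r i = true).card := by omega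
    have h3 : (1250 * (j : ℝ)) ≤ ((Finset.univ.filter fun i =>
      sdist f (piv i) ≤ ((j + 1) * (256 * N) : ℕ) ∧ r i = true).card : ℝ) := by exact_mod_cast h2
    refine h3.trans (Nat.cast_le.2 (Finset.card_le_card fun i hi => ?_))
    simp only [Finset.mem_filter, Finset.mem_univ, true_and] at hi ⊢
    exact hi
  · have h2 : ((Finset.univ.filter fun i =>
      sdist f (piv i) ≤ ((j + 1) * (256 * N) : ℕ)).card : ℝ) ≤ 320000 * j := by
      refine le_trans (Nat.cast_le.2 (Finset.card_le_card fun i hi => ?_))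
        (le_trans (Nat.cast_le.2 (hp.upper j hj)) (by push_cast; rfl))
      simpa using hi
    have h3 : Real.exp 1 * η ≤ 3 * η :=
      mul_le_mul_of_nonneg_right (by linarith [Real.exp_one_lt_d9]) h0
    have h4 : Real.exp 1 * η * ((Finset.univ.filter fun i =>
        sdist f (piv i) ≤ ((j + 1) * (256 * N) : ℕ)).card : ℝ) ≤ 3 * η * (320000 * j) :=
      mul_le_mul h3 h2 (Nat.cast_nonneg _) (by linarith)
    have hj0 : (0 : ℝ) ≤ j := Nat.cast_nonneg j
    have h5 := mul_le_mul_of_nonneg_right hη hj0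
    simp only [Nat.cast_ofNat]
    nlinarith

variable [Fintype V] [DecidableEq V]

/-- Among at most `2 * D` items, each with a bad row with probability at most `2 * exp (-400)`, a
fraction of order `1 / 32` is bad with probability `exp (-9 * D)`: the parameter `320` gives `-10 *
D` and the mean term costs at most `D`. This is summable over scales. -/
theorem prob_few_outer {N L : ℕ} {a b : ℤ} {f : V → ℤ} (hf : Function.Injective f) {piv : J → V}
    (hp : GoodPivots N L a b f piv) {η : ℝ} (h0 : 0 ≤ η) (hη : η * 1000000 ≤ 1) :
    prob (piW V (piW J (coinW η))) (fun e => ∃ D ∈ Finset.Icc 1 N, ∃ A : Finset V,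
      (∀ v ∈ A, sdist f v ≤ D ∧ ∃ s ∈ Finset.Icc 1 L, BadRow N f piv s (e v)) ∧
        D < 32 * A.card) ≤ 1 / 1000 := by
  classical
  have hw : IsWeight (piW J (coinW η)) := (isWeight_coinW h0 (by linarith)).piW
  have hq : prob (piW J (coinW η)) (fun r => ∃ s ∈ Finset.Icc 1 L, BadRow N f piv s r) ≤
      2 * Real.exp (-400) := by
    refine (prob_exists_le hw _ _).trans ((Finset.sum_le_sum fun s hs =>
      prob_badRow_le hp h0 hη hs).trans ?_)
    have := sum_Icc_exp_pow_le (m := 400) (by norm_num) L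
    push_cast at this ⊢
    exact this
  refine (prob_exists_le hw.piW (Finset.Icc 1 N) fun D e => ∃ A : Finset V,
      (∀ v ∈ A, sdist f v ≤ D ∧ ∃ s ∈ Finset.Icc 1 L, BadRow N f piv s (e v)) ∧
        D < 32 * A.card).trans ?_
  have hD : ∀ D ∈ Finset.Icc 1 N, prob (piW V (piW J (coinW η))) (fun e => ∃ A : Finset V,
      (∀ v ∈ A, sdist f v ≤ D ∧ ∃ s ∈ Finset.Icc 1 L, BadRow N f piv s (e v)) ∧
        D < 32 * A.card) ≤ Real.exp (-((9 : ℕ) * (D : ℝ))) := by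
    intro D hD
    have key := upper_tail hw (Finset.univ.filter fun v => sdist f v ≤ D)
      (fun _ r => ∃ s ∈ Finset.Icc 1 L, BadRow N f piv s r) (q := 2 * Real.exp (-400)) (l := 320)
      (r := D / 32) (by norm_num) (fun i _ => hq)
    refine (prob_mono hw.piW fun e he => ?_).trans (key.trans (Real.exp_le_exp.2 ?_))
    · obtain ⟨A, hA, hAc⟩ := he
      rw [div_le_iff₀ (by norm_num)]
      have h2 : (D : ℝ) ≤ A.card * 32 := by rw [mul_comm]; exact_mod_cast hAc.le
      refine h2.trans (mul_le_mul_of_nonneg_right (Nat.cast_le.2 (Finset.card_le_card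
        fun v hv => ?_)) (by norm_num))
      simp only [Finset.mem_filter, Finset.mem_univ, true_and]
      exact hA v hv
    · have h2 : ((Finset.univ.filter fun v => sdist f v ≤ D).card : ℝ) ≤ 2 * D := by
        have h3 : ((Finset.univ.filter fun v => sdist f v ≤ D).card : ℝ) ≤ ((2 * D : ℕ) : ℝ) := by
          refine le_trans (Nat.cast_le.2 (Finset.card_le_card fun v hv => ?_))
            (Nat.cast_le.2 (card_sdist_le hf D))
          simpa using hv
        push_cast at h3
        exact h3
      have h4 : Real.exp 320 * (2 * Real.exp (-400)) ≤ 1 / 2 := by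
        have h5 : Real.exp 320 * (2 * Real.exp (-400)) = 2 * Real.exp (-((80 : ℕ) : ℝ)) := by
          rw [mul_left_comm, ← Real.exp_add]; norm_num
        rw [h5]
        have := exp_neg_le_pow 80
        have h6 : (1 / 2.7 : ℝ) ^ 80 ≤ 1 / 4 := by norm_num
        linarith
      have h5 : Real.exp 320 * (2 * Real.exp (-400)) *
          ((Finset.univ.filter fun v => sdist f v ≤ D).card : ℝ) ≤ 1 / 2 * (2 * D) :=
        mul_le_mul h4 h2 (Nat.cast_nonneg _) (by norm_num)
      push_cast
      linarith
  refine (Finset.sum_le_sum hD).trans ((sum_Icc_exp_le 9 N (by norm_num)).trans ?_)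
  norm_num

open scoped Classical in
-- Markov's inequality. Scale `s` matters only for the `O(s * N)` items within `s + 2` units, each
-- bad with probability `exp (-400 * s)`. Only the last scale concerns all items, and `hnL` handles
-- it.
theorem prob_many_unlucky {N L : ℕ} (hN : 1 ≤ N) {a b : ℤ} {f : V → ℤ}
    (hf : Function.Injective f) {piv : J → V}
    (hp : GoodPivots N L a b f piv) {η : ℝ} (h0 : 0 ≤ η) (hη : η * 1000000 ≤ 1)
    (hnL : (Fintype.card V : ℝ) * Real.exp (-((400 : ℕ) * (L : ℝ))) ≤ 1 / 10000) :
    prob (piW V (piW J (coinW η))) (fun e =>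
      (N : ℝ) / 32 ≤ ∑ x, if Unlucky N L f piv e x then (1 : ℝ) else 0) ≤ 1 / 100 := by
  have hw : IsWeight (piW J (coinW η)) := (isWeight_coinW h0 (by linarith)).piW
  have hN' : (1 : ℝ) ≤ N := by exact_mod_cast hN
  refine (prob_le_expect_div hw.piW (fun e => Finset.sum_nonneg fun x _ => by
    split_ifs <;> norm_num) (by positivity)).trans ?_
  rw [div_le_iff₀ (by positivity), expect_sum]
  have h1 : ∀ x, expect (piW V (piW J (coinW η)))
      (fun e => if Unlucky N L f piv e x then (1 : ℝ) else 0) ≤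
      ∑ s ∈ Finset.Icc 1 L, Real.exp (-((400 : ℕ) * (s : ℝ))) *
        ((if sdist f x ≤ ((s + 2) * (256 * N) : ℕ) then 1 else 0) + if s = L then 1 else 0) := by
    intro x
    rw [← prob_eq_expect]
    refine (prob_exists_le hw.piW (Finset.Icc 1 L) fun s e => BadRow N f piv s (e x) ∧
      (sdist f x ≤ ((s + 2) * (256 * N) : ℕ) ∨ s = L)).trans (Finset.sum_le_sum fun s hs => ?_)
    have h2 := prob_piW_apply hw x (BadRow N f piv s)
    have h3 := prob_badRow_le hp h0 hη hs
    have h4 := Real.exp_pos (-((400 : ℕ) * (s : ℝ)))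
    by_cases hc : sdist f x ≤ ((s + 2) * (256 * N) : ℕ) ∨ s = L
    · refine (prob_mono hw.piW (fun e he => he.1)).trans (h2.le.trans (h3.trans ?_))
      have : (1 : ℝ) ≤ (if sdist f x ≤ ((s + 2) * (256 * N) : ℕ) then 1 else 0) +
          if s = L then 1 else 0 := by
        rcases hc with hc | hc <;> simp only [hc, if_true] <;> split_ifs <;> norm_num
      nlinarith
    · refine (prob_mono hw.piW (T := fun _ => False) (fun e he => hc he.2)).trans ?_
      rw [prob_false]
      refine mul_nonneg h4.le (add_nonneg ?_ ?_) <;> split_ifs <;> norm_num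
  refine (Finset.sum_le_sum fun x _ => h1 x).trans ?_
  rw [Finset.sum_comm]
  have h2 : ∀ s ∈ Finset.Icc 1 L, ∑ x : V, Real.exp (-((400 : ℕ) * (s : ℝ))) *
        ((if sdist f x ≤ ((s + 2) * (256 * N) : ℕ) then 1 else 0) + if s = L then 1 else 0) ≤
      1536 * N * Real.exp (-((399 : ℕ) * (s : ℝ))) +
        if s = L then (Fintype.card V : ℝ) * Real.exp (-((400 : ℕ) * (L : ℝ))) else 0 := by
    intro s hs
    rw [← Finset.mul_sum, Finset.sum_add_distrib, mul_add, Finset.sum_boole]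
    refine add_le_add ?_ ?_
    · have h3 : (((Finset.univ.filter fun x => sdist f x ≤ ((s + 2) * (256 * N) : ℕ)).card : ℕ) : ℝ)
          ≤ ((2 * ((s + 2) * (256 * N)) : ℕ) : ℝ) := by
        refine le_trans (Nat.cast_le.2 (Finset.card_le_card fun v hv => ?_))
          (Nat.cast_le.2 (card_sdist_le hf ((s + 2) * (256 * N))))
        simpa using hv
      have hs1 : (1 : ℝ) ≤ s := by exact_mod_cast (Finset.mem_Icc.1 hs).1
      have h4 : (s : ℝ) ≤ Real.exp s := by linarith [Real.add_one_le_exp (s : ℝ)]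
      have h5 : Real.exp (-((399 : ℕ) * (s : ℝ))) =
          Real.exp (-((400 : ℕ) * (s : ℝ))) * Real.exp s := by
        rw [← Real.exp_add]; congr 1; push_cast; ring
      have h6 := Real.exp_pos (-((400 : ℕ) * (s : ℝ)))
      rw [h5]
      have h7 : ((2 * ((s + 2) * (256 * N)) : ℕ) : ℝ) ≤ 1536 * N * Real.exp s := by
        push_cast
        nlinarith
      calc _ ≤ Real.exp (-((400 : ℕ) * (s : ℝ))) * (1536 * N * Real.exp s) :=
            mul_le_mul_of_nonneg_left (h3.trans h7) h6.le
        _ = _ := by ring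
    · split_ifs with h
      · rw [h]; simp [mul_comm]
      · simp
  refine (Finset.sum_le_sum h2).trans ?_
  rw [Finset.sum_add_distrib, ← Finset.mul_sum]
  have h3 := sum_Icc_exp_le 399 L (by norm_num)
  have h4 : (∑ s ∈ Finset.Icc 1 L, if s = L then
      (Fintype.card V : ℝ) * Real.exp (-((400 : ℕ) * (L : ℝ))) else 0) ≤ 1 / 10000 := by
    rw [Finset.sum_ite_eq']
    split_ifs
    · exact hnL
    · norm_num
  have h5 : 2 * (1 / 2.7 : ℝ) ^ 399 ≤ 1 / 100000000 := by
    calc 2 * (1 / 2.7 : ℝ) ^ 399 ≤ 2 * (1 / 2.7 : ℝ) ^ 30 := by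
          refine mul_le_mul_of_nonneg_left ?_ (by norm_num)
          exact pow_le_pow_of_le_one (by norm_num) (by norm_num) (by norm_num)
      _ ≤ _ := by norm_num
  have h6 := mul_le_mul_of_nonneg_left (h3.trans h5) (show (0 : ℝ) ≤ 1536 * N by positivity)
  linarith

open scoped Classical in
-- Markov's inequality again. With `exp (-y) ≤ 6 / y ^ 3` and `3072 = 6 * 8 ^ 3`, level `t` costs
-- `3072 * 8 ^ t / D ^ 3`; the factor `8 ^ t` is beaten by `exp (-400 * t)`, and the `2 * D` items
-- at scale `D` leave a summable `1 / D ^ 2`.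
theorem prob_risk {N L : ℕ} (hN : 1 ≤ N) {a b : ℤ} {f : V → ℤ}
    (hf : Function.Injective f) {piv : J → V}
    (hp : GoodPivots N L a b f piv) {η : ℝ} (h0 : 0 ≤ η) (hη : η * 1000000 ≤ 1) :
    prob (piW V (piW J (coinW η))) (fun e => (1 : ℝ) / 100 ≤
      ∑ D ∈ Finset.Icc 1 N, ∑ x ∈ Finset.univ.filter (fun v => sdist f v ≤ D),
        ∑ t ∈ Finset.Icc 1 L, if BadRow N f piv t (e x) then
          Real.exp (-((D : ℝ) / (8 * 2 ^ t))) else 0) ≤ 1 / 100 := by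
  have hw : IsWeight (piW J (coinW η)) := (isWeight_coinW h0 (by linarith)).piW
  refine (prob_le_expect_div hw.piW (fun e => Finset.sum_nonneg fun D _ =>
    Finset.sum_nonneg fun x _ => Finset.sum_nonneg fun t _ => by
      split_ifs
      · exact (Real.exp_pos _).le
      · exact le_rfl) (by norm_num)).trans ?_
  rw [div_le_iff₀ (by norm_num), expect_sum]
  have h1 : ∀ D ∈ Finset.Icc 1 N, expect (piW V (piW J (coinW η))) (fun e =>
      ∑ x ∈ Finset.univ.filter (fun v => sdist f v ≤ D),
        ∑ t ∈ Finset.Icc 1 L, if BadRow N f piv t (e x) then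
          Real.exp (-((D : ℝ) / (8 * 2 ^ t))) else 0) ≤
      (1 / (D : ℝ) ^ 2) * (6144 * (2 * (1 / 2.7 : ℝ) ^ 397)) := by
    intro D hD
    have hD1 : (1 : ℝ) ≤ D := by exact_mod_cast (Finset.mem_Icc.1 hD).1
    rw [expect_sum]
    have h2 : ∀ x ∈ Finset.univ.filter (fun v => sdist f v ≤ D),
        expect (piW V (piW J (coinW η))) (fun e => ∑ t ∈ Finset.Icc 1 L,
          if BadRow N f piv t (e x) then Real.exp (-((D : ℝ) / (8 * 2 ^ t))) else 0) ≤
        (1 / (D : ℝ) ^ 3) * (3072 * (2 * (1 / 2.7 : ℝ) ^ 397)) := by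
      intro x _
      rw [expect_sum]
      refine le_trans (Finset.sum_le_sum (g := fun t : ℕ => (1 / (D : ℝ) ^ 3) *
        (3072 * Real.exp (-((397 : ℕ) * (t : ℝ))))) fun t ht => ?_) ?_
      · have h3 : (fun e : V → J → Bool => if BadRow N f piv t (e x) then
            Real.exp (-((D : ℝ) / (8 * 2 ^ t))) else 0) =
            fun e => Real.exp (-((D : ℝ) / (8 * 2 ^ t))) *
              (if BadRow N f piv t (e x) then 1 else 0) := by
          funext e; split_ifs <;> simp
        rw [h3, expect_const_mul, ← prob_eq_expect, prob_piW_apply hw x (BadRow N f piv t)]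
        have h4 := prob_badRow_le hp h0 hη ht
        have h5 : Real.exp (-((D : ℝ) / (8 * 2 ^ t))) ≤ 3072 * (2 ^ t) ^ 3 / (D : ℝ) ^ 3 := by
          refine (exp_neg_le_inv_cube (by positivity)).trans (le_of_eq ?_)
          field_simp
          norm_num
        have h6 : ((2 : ℝ) ^ t) ^ 3 ≤ Real.exp ((3 : ℝ) * t) := by
          have h7 : (2 : ℝ) ^ t ≤ Real.exp t := by
            have : (2 : ℝ) ^ t ≤ Real.exp 1 ^ t := pow_le_pow_left₀ (by norm_num)
              (by linarith [Real.exp_one_gt_d9]) t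
            rwa [← Real.exp_nat_mul, mul_one] at this
          calc ((2 : ℝ) ^ t) ^ 3 ≤ Real.exp t ^ 3 := pow_le_pow_left₀ (by positivity) h7 3
            _ = _ := by rw [← Real.exp_nat_mul]; norm_num
        have h8 : Real.exp (-((397 : ℕ) * (t : ℝ))) =
            Real.exp ((3 : ℝ) * t) * Real.exp (-((400 : ℕ) * (t : ℝ))) := by
          rw [← Real.exp_add]; congr 1; push_cast; ring
        calc _ ≤ (3072 * (2 ^ t) ^ 3 / (D : ℝ) ^ 3) * Real.exp (-((400 : ℕ) * (t : ℝ))) :=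
              mul_le_mul h5 h4 (prob_nonneg hw _) (by positivity)
          _ = (1 / (D : ℝ) ^ 3 * 3072) * ((2 ^ t) ^ 3 * Real.exp (-((400 : ℕ) * (t : ℝ)))) := by
              ring
          _ ≤ (1 / (D : ℝ) ^ 3 * 3072) *
              (Real.exp ((3 : ℝ) * t) * Real.exp (-((400 : ℕ) * (t : ℝ)))) :=
              mul_le_mul_of_nonneg_left (mul_le_mul_of_nonneg_right h6 (Real.exp_pos _).le)
                (by positivity)
          _ = _ := by rw [h8]; ring
      · rw [← Finset.mul_sum, ← Finset.mul_sum]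
        refine mul_le_mul_of_nonneg_left (mul_le_mul_of_nonneg_left
          (sum_Icc_exp_le 397 L (by norm_num)) (by norm_num)) (by positivity)
    refine (Finset.sum_le_sum h2).trans ?_
    rw [Finset.sum_const, nsmul_eq_mul]
    have h3 : ((Finset.univ.filter fun v => sdist f v ≤ D).card : ℝ) ≤ 2 * D := by
      have h3 : ((Finset.univ.filter fun v => sdist f v ≤ D).card : ℝ) ≤ ((2 * D : ℕ) : ℝ) := by
        refine le_trans (Nat.cast_le.2 (Finset.card_le_card fun v hv => ?_))
          (Nat.cast_le.2 (card_sdist_le hf D))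
        simpa using hv
      push_cast at h3
      exact h3
    refine (mul_le_mul_of_nonneg_right h3 (by positivity)).trans (le_of_eq ?_)
    field_simp
    ring
  refine (Finset.sum_le_sum h1).trans ?_
  rw [← Finset.sum_mul]
  have h2 := sum_Icc_inv_sq_le hN
  have h3 : (0 : ℝ) ≤ 1 / N := by positivity
  have h5 : 6144 * (2 * (1 / 2.7 : ℝ) ^ 397) ≤ 1 / 100000 := by
    calc 6144 * (2 * (1 / 2.7 : ℝ) ^ 397) ≤ 6144 * (2 * (1 / 2.7 : ℝ) ^ 30) := by
          refine mul_le_mul_of_nonneg_left (mul_le_mul_of_nonneg_left ?_ (by norm_num))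
            (by norm_num)
          exact pow_le_pow_of_le_one (by norm_num) (by norm_num) (by norm_num)
      _ ≤ _ := by norm_num
  calc _ ≤ 2 * (1 / 100000 : ℝ) := mul_le_mul (by linarith) h5 (by positivity) (by norm_num)
    _ ≤ _ := by norm_num

end Pivots

/-! ### Assembling good levels -/

namespace Pivots

open FinProb Decoding

variable {V J : Type*} [Fintype J] [Fintype V] [DecidableEq V]

open scoped Classical in
theorem goodLevels_of_few_errors {N L : ℕ} (hN : 1 ≤ N) (hL : 1 ≤ L) {a b : ℤ} {f : V → ℤ}
    (hf : IsRanking a b f) {piv : J → V} (hp : GoodPivots N L a b f piv) {est : J → ℝ}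
    (hest : ∀ i, |est i - f (piv i)| ≤ N) {z e : V → J → Bool}
    (hobs : ∀ x i, piv i ≠ x → z x i = (decide (f x < f (piv i)) ^^ e x i))
    (hnN : (Fintype.card V : ℝ) * Real.exp (-((N : ℝ) / (8 * 2 ^ L))) ≤ 1 / 100)
    (h1 : ¬ ∃ D ∈ Finset.Icc 1 N, ∃ A : Finset V,
      (∀ v ∈ A, sdist f v ≤ D ∧ ∃ s ∈ Finset.Icc 1 L, BadRow N f piv s (e v)) ∧ D < 32 * A.card)
    (h2 : ¬ (N : ℝ) / 32 ≤ ∑ x, if Unlucky N L f piv e x then (1 : ℝ) else 0)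
    (h3 : ¬ ∃ x ∈ (Finset.univ : Finset V), BadRow N f piv L (e x))
    (h4 : ¬ (1 : ℝ) / 100 ≤ ∑ D ∈ Finset.Icc 1 N, ∑ x ∈ Finset.univ.filter (fun v => sdist f v ≤ D),
        ∑ t ∈ Finset.Icc 1 L, if BadRow N f piv t (e x) then
          Real.exp (-((D : ℝ) / (8 * 2 ^ t))) else 0) :
    GoodLevels N L 4000 (2 / 100) (level N L piv est z) (topSide N L piv est z) f := by
  have hUc : ((Finset.univ.filter fun x => Unlucky N L f piv e x).card : ℝ) < N / 32 := by
    rw [Finset.sum_boole] at h2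
    exact not_le.1 h2
  have hN' : (1 : ℝ) ≤ N := by exact_mod_cast hN
  constructor
  · intro D hD1 hDN
    lift D to ℕ using by omega
    by_contra hc
    refine h1 ⟨D, Finset.mem_Icc.2 ⟨by omega, by omega⟩,
      Finset.univ.filter fun v => level N L piv est z v ≠ 0 ∧ sdist f v ≤ D, fun v hv => ?_, ?_⟩
    · have hv' := (Finset.mem_filter.1 hv).2
      exact ⟨hv'.2, _, Finset.mem_Icc.2 ⟨Nat.one_le_iff_ne_zero.2 hv'.1, level_le v⟩,
        badRow_of_near hp hest hobs (by omega) hv'.1⟩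
    · exact_mod_cast not_le.1 hc
  · have h5 : (Finset.univ.filter fun v => level N L piv est z v ≠ 0 ∧
        ¬ (topSide N L piv est z v ↔ f v < 0)).card ≤
        (Finset.univ.filter fun x => Unlucky N L f piv e x).card := by
      refine Finset.card_le_card fun v hv => ?_
      simp only [Finset.mem_filter, Finset.mem_univ, true_and] at hv ⊢
      exact unlucky_of_wrong hf hp hest hobs hN hv.1 hv.2
    have h6 : 32 * (((Finset.univ.filter fun v => level N L piv est z v ≠ 0 ∧
        ¬ (topSide N L piv est z v ↔ f v < 0)).card : ℕ) : ℝ) ≤ N := by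
      have : (((Finset.univ.filter fun v => level N L piv est z v ≠ 0 ∧
        ¬ (topSide N L piv est z v ↔ f v < 0)).card : ℕ) : ℝ) ≤
        (((Finset.univ.filter fun x => Unlucky N L f piv e x).card : ℕ) : ℝ) := by exact_mod_cast h5
      linarith
    exact_mod_cast h6
  · intro v hv
    by_contra hw
    have hl : level N L piv est z v = L := le_antisymm (level_le v) hv
    have := badRow_of_wrong hp hest hobs (by omega) hw
    rw [hl] at this
    exact h3 ⟨v, Finset.mem_univ _, this⟩
  -- A core item is within two units of the boundary or unlucky: `1024 * N + N / 32` items at most.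
  · have hsub : (Finset.univ.filter fun v => level N L piv est z v = 0) ⊆
        (Finset.univ.filter fun v => sdist f v ≤ ((2 * (256 * N) : ℕ) : ℤ)) ∪
        (Finset.univ.filter fun x => Unlucky N L f piv e x) := by
      intro v hv
      simp only [Finset.mem_filter, Finset.mem_univ, true_and, Finset.mem_union] at hv ⊢
      by_cases hd : sdist f v ≤ ((2 * (256 * N) : ℕ) : ℤ)
      · exact Or.inl hd
      · refine Or.inr (unlucky_of_far hf hp hest hobs hN (by omega) ?_)
        rw [hv]
        simpa using not_le.1 hd
    have h5 := (Finset.card_le_card hsub).trans (Finset.card_union_le _ _)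
    have h6 := card_sdist_le hf.inj (2 * (256 * N))
    have h7 : ((Finset.univ.filter fun v => level N L piv est z v = 0).card : ℝ) ≤
        2 * (2 * (256 * N)) +
          ((Finset.univ.filter fun x => Unlucky N L f piv e x).card : ℝ) := by
      exact_mod_cast h5.trans (Nat.add_le_add_right h6 _)
    linarith
  -- A lucky item of level `t` is within `t + 2` units, so the weight is at most `512 * N * ∑ (t +
  -- 2) / 2 ^ t ≤ 3072 * N`, plus one for each unlucky item; this fits in `4000 * N`.
  · have hx : ∀ x ∈ Finset.univ.filter (fun v => level N L piv est z v < L),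
        1 / (2 : ℝ) ^ level N L piv est z x ≤
        (∑ t ∈ Finset.range L, if sdist f x ≤ (((t + 2) * (256 * N) : ℕ) : ℤ) then
          1 / (2 : ℝ) ^ t else 0) + if Unlucky N L f piv e x then 1 else 0 := by
      intro x hx
      have hxL := (Finset.mem_filter.1 hx).2
      have hnn : ∀ t ∈ Finset.range L, (0 : ℝ) ≤ if sdist f x ≤ (((t + 2) * (256 * N) : ℕ) : ℤ)
          then 1 / (2 : ℝ) ^ t else 0 := by
        intro t _; split_ifs <;> positivity
      by_cases hd : sdist f x ≤ (((level N L piv est z x + 2) * (256 * N) : ℕ) : ℤ)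
      · have h5 := Finset.single_le_sum hnn (Finset.mem_range.2 hxL)
        rw [if_pos hd] at h5
        refine h5.trans (le_add_of_nonneg_right ?_)
        split_ifs <;> norm_num
      · have hu := unlucky_of_far hf hp hest hobs hN hxL (not_le.1 hd)
        rw [if_pos hu]
        have h5 := Finset.sum_nonneg hnn
        have h6 : 1 / (2 : ℝ) ^ level N L piv est z x ≤ 1 := by
          rw [div_le_one (by positivity)]
          exact one_le_pow₀ (by norm_num)
        linarith
    refine (Finset.sum_le_sum hx).trans ?_
    refine (Finset.sum_le_sum_of_subset_of_nonneg (Finset.filter_subset _ _)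
      fun x _ _ => add_nonneg (Finset.sum_nonneg fun t _ => by split_ifs <;> positivity)
        (by split_ifs <;> norm_num)).trans ?_
    rw [Finset.sum_add_distrib, Finset.sum_comm, Finset.sum_boole]
    have h5 : ∀ t ∈ Finset.range L, (∑ x : V, if sdist f x ≤ (((t + 2) * (256 * N) : ℕ) : ℤ) then
          1 / (2 : ℝ) ^ t else 0) ≤ 512 * N * (((t : ℝ) + 2) * (1 / 2 ^ t)) := by
      intro t _
      rw [← Finset.sum_filter, Finset.sum_const, nsmul_eq_mul]
      have h6 : ((Finset.univ.filter fun x => sdist f x ≤ (((t + 2) * (256 * N) : ℕ) : ℤ)).card : ℝ)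
          ≤ 2 * ((t + 2) * (256 * N)) := by
        exact_mod_cast card_sdist_le hf.inj ((t + 2) * (256 * N))
      refine (mul_le_mul_of_nonneg_right h6 (by positivity)).trans (le_of_eq (by ring))
    have h6 := Finset.sum_le_sum h5
    rw [← Finset.mul_sum] at h6
    have h7 := mul_le_mul_of_nonneg_left (sum_range_linear_geometric_le L)
      (show (0 : ℝ) ≤ 512 * N by positivity)
    linarith
  -- An item within distance `D ≤ N` has positive level only through a bad row at that level. More
  -- distant items enter only at `D = N`, where all of them together cost at most `1 / 100` by
  -- `hnN`.
  · have hD : ∀ D ∈ Finset.Icc 1 N, ∑ x ∈ Finset.univ.filter (fun v =>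
        1 ≤ level N L piv est z v ∧ level N L piv est z v < L ∧ min (sdist f v) N ≤ D),
        Real.exp (-((D : ℝ) / (8 * 2 ^ level N L piv est z x))) ≤
        (∑ x ∈ Finset.univ.filter (fun v => sdist f v ≤ D),
          ∑ t ∈ Finset.Icc 1 L, if BadRow N f piv t (e x) then
          Real.exp (-((D : ℝ) / (8 * 2 ^ t))) else 0) +
        if D = N then (Fintype.card V : ℝ) * Real.exp (-((N : ℝ) / (8 * 2 ^ L))) else 0 := by
      intro D hD
      have hnn : ∀ x, ∀ t ∈ Finset.Icc 1 L, (0 : ℝ) ≤ if BadRow N f piv t (e x) then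
          Real.exp (-((D : ℝ) / (8 * 2 ^ t))) else 0 := by
        intro x t _; split_ifs
        · exact (Real.exp_pos _).le
        · exact le_rfl
      have hx : ∀ x ∈ Finset.univ.filter (fun v => 1 ≤ level N L piv est z v ∧
          level N L piv est z v < L ∧ min (sdist f v) N ≤ D),
          Real.exp (-((D : ℝ) / (8 * 2 ^ level N L piv est z x))) ≤
          (if sdist f x ≤ D then ∑ t ∈ Finset.Icc 1 L, if BadRow N f piv t (e x) then
          Real.exp (-((D : ℝ) / (8 * 2 ^ t))) else 0 else 0) +
          if D = N then Real.exp (-((N : ℝ) / (8 * 2 ^ L))) else 0 := by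
        intro x hx
        obtain ⟨hx1, hx2, hx3⟩ := (Finset.mem_filter.1 hx).2
        by_cases hd : sdist f x ≤ D
        · have hDN := (Finset.mem_Icc.1 hD).2
          have hbad := badRow_of_near hp hest hobs (x := x) (by omega) (by omega)
          have h5 := Finset.single_le_sum (hnn x) (Finset.mem_Icc.2 ⟨hx1, hx2.le⟩)
          rw [if_pos hbad] at h5
          rw [if_pos hd]
          refine h5.trans (le_add_of_nonneg_right ?_)
          split_ifs
          · exact (Real.exp_pos _).le
          · exact le_rfl
        · have hDN : D = N := by
            have := (Finset.mem_Icc.1 hD).2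
            omega
          rw [if_neg hd, if_pos hDN, zero_add, hDN]
          refine Real.exp_le_exp.2 (neg_le_neg ?_)
          refine div_le_div_of_nonneg_left (by positivity) (by positivity) ?_
          exact mul_le_mul_of_nonneg_left (pow_le_pow_right₀ (by norm_num) hx2.le) (by norm_num)
      refine (Finset.sum_le_sum hx).trans ?_
      refine (Finset.sum_le_sum_of_subset_of_nonneg (Finset.filter_subset _ _)
        fun x _ _ => add_nonneg ?_ ?_).trans ?_
      · split_ifs
        · exact Finset.sum_nonneg (hnn x)
        · exact le_rfl
      · split_ifs
        · exact (Real.exp_pos _).le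
        · exact le_rfl
      · rw [Finset.sum_add_distrib, ← Finset.sum_filter]
        refine add_le_add le_rfl ?_
        rw [Finset.sum_const, nsmul_eq_mul, Finset.card_univ]
        split_ifs <;> simp
    refine (Finset.sum_le_sum hD).trans ?_
    rw [Finset.sum_add_distrib, Finset.sum_ite_eq', if_pos (Finset.mem_Icc.2 ⟨hN, le_rfl⟩)]
    linarith [not_le.1 h4]

theorem prob_not_goodLevels [DecidableEq J] {N L : ℕ} (hN : 1 ≤ N) (hL : 1 ≤ L) {a b : ℤ} {f : V → ℤ}
    (hf : IsRanking a b f) {piv : J → V} (hp : GoodPivots N L a b f piv) {est : J → ℝ}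
    (hest : ∀ i, |est i - f (piv i)| ≤ N) (z : (V → J → Bool) → V → J → Bool)
    (hobs : ∀ e x i, piv i ≠ x → z e x i = (decide (f x < f (piv i)) ^^ e x i))
    {η : ℝ} (h0 : 0 ≤ η) (hη : η * 1000000 ≤ 1)
    (hnL : (Fintype.card V : ℝ) * Real.exp (-((400 : ℕ) * (L : ℝ))) ≤ 1 / 10000)
    (hnN : (Fintype.card V : ℝ) * Real.exp (-((N : ℝ) / (8 * 2 ^ L))) ≤ 1 / 100) :
    prob (piW V (piW J (coinW η))) (fun e => ¬ GoodLevels N L 4000 (2 / 100)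
      (level N L piv est (z e)) (topSide N L piv est (z e)) f) ≤ 3 / 100 := by
  classical
  have hw : IsWeight (piW J (coinW η)) := (isWeight_coinW h0 (by linarith)).piW
  have p1 := prob_few_outer hf.inj hp h0 hη
  have p2 := prob_many_unlucky hN hf.inj hp h0 hη hnL
  have p3 : prob (piW V (piW J (coinW η)))
      (fun e => ∃ x ∈ (Finset.univ : Finset V), BadRow N f piv L (e x)) ≤ 1 / 10000 := by
    refine (prob_exists_le hw.piW _ _).trans ((Finset.sum_le_sum fun x _ =>
      (prob_piW_apply hw x (BadRow N f piv L)).le.trans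
        (prob_badRow_le hp h0 hη (Finset.mem_Icc.2 ⟨hL, le_rfl⟩))).trans ?_)
    rw [Finset.sum_const, nsmul_eq_mul, Finset.card_univ]
    exact hnL
  have p4 := prob_risk hN hf.inj hp h0 hη
  refine (prob_mono hw.piW fun e he => ?_).trans ((prob_or_le hw.piW _ _).trans
    ((add_le_add ((prob_or_le hw.piW _ _).trans (add_le_add p1 p2))
      ((prob_or_le hw.piW _ _).trans (add_le_add p3 p4))).trans (by norm_num)))
  by_contra hn
  obtain ⟨h12, h34⟩ := not_or.1 hn
  obtain ⟨h1, h2⟩ := not_or.1 h12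
  obtain ⟨h3, h4⟩ := not_or.1 h34
  exact he (goodLevels_of_few_errors hN hL hf hp hest (hobs e) hnN h1 h2 h3 h4)

end Pivots

/-! ### Random pivots and estimates of their ranks -/

namespace Pivots

open FinProb Decoding

variable {V J : Type*} [Fintype J] [DecidableEq J] [Fintype V]

/-- The hypotheses say that `256 * N` consecutive ranks receive between `10000` and `20000` pivots
on average. Every requirement is a Chernoff bound whose threshold is a constant factor away from the
mean. -/
theorem prob_not_goodPivots [Nonempty V] {N L : ℕ} (hN : 1 ≤ N) {a b : ℤ} (ha : 0 ≤ a) (hb : 0 ≤ b)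
    {f : V → ℤ} (hf : IsRanking a b f)
    (hm1 : (Fintype.card J : ℝ) * (256 * N) ≤ 20000 * Fintype.card V)
    (hm2 : 10000 * (Fintype.card V : ℝ) ≤ Fintype.card J * (256 * N)) :
    prob (piW J (unifW V)) (fun piv => ¬ GoodPivots N L a b f piv) ≤ 1 / 100 := by
  classical
  have hw : IsWeight (unifW V) := isWeight_unifW V
  have hn : (0 : ℝ) < Fintype.card V := by exact_mod_cast Fintype.card_pos
  set n : ℝ := (Fintype.card V : ℝ) with hn_def
  set m : ℝ := (Fintype.card J : ℝ) with hm_def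
  have hm0 : 0 ≤ m := Nat.cast_nonneg _
  have he := Real.exp_one_lt_d9
  have hup : ∀ d : ℕ, ∀ r : ℝ, prob (piW J (unifW V)) (fun piv => r ≤
      ((Finset.univ.filter fun i => sdist f (piv i) ≤ d).card : ℝ)) ≤
      Real.exp (-r + 3 * (2 * d * m / n)) := by
    intro d r
    have key := upper_tail (ι := J) hw Finset.univ (fun _ v => sdist f v ≤ d) (q := 2 * d / n)
      (l := 1) (r := r) (by norm_num) (fun i _ => by
        rw [prob_unifW]
        refine div_le_div_of_nonneg_right ?_ hn.le
        have h := card_sdist_le hf.inj d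
        have h2 : ((Finset.univ.filter fun v => sdist f v ≤ d).card : ℝ) ≤ 2 * d := by
          exact_mod_cast (by convert h)
        convert h2)
    refine (prob_mono hw.piW fun piv h => ?_).trans (key.trans (Real.exp_le_exp.2 ?_))
    · convert h
    · rw [Finset.card_univ, ← hm_def]
      have h1 : 0 ≤ 2 * d * m / n := by positivity
      have h2 : Real.exp 1 * (2 * d / n) * m = Real.exp 1 * (2 * d * m / n) := by ring
      rw [h2]
      nlinarith
  have hlow : ∀ j : ℕ, 1 ≤ j → ∀ l u : ℤ, -a ≤ l → u ≤ b → l ≤ u →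
      u - l = ((j * (256 * N) : ℕ) : ℤ) - 2 * N →
      prob (piW J (unifW V)) (fun piv => ¬ (10000 * j ≤
        2 * (Finset.univ.filter fun i => l ≤ f (piv i) ∧ f (piv i) < u).card)) ≤
      Real.exp (-((400 : ℕ) * (j : ℝ))) := by
    intro j hj l u hl hu hlu hd
    have hc := hf.card_interval hl hlu hu
    have hj' : (1 : ℝ) ≤ j := by exact_mod_cast hj
    have hN' : (1 : ℝ) ≤ N := by exact_mod_cast hN
    have key := lower_tail (ι := J) hw Finset.univ (fun _ v => l ≤ f v ∧ f v < u)
      (q := (j * (254 * N)) / n) (r := 5000 * j) (fun i _ => by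
        rw [prob_unifW]
        refine div_le_div_of_nonneg_right ?_ hn.le
        rw [hd] at hc
        have h2 : ((Finset.univ.filter fun x => l ≤ f x ∧ f x < u).card : ℝ) =
            j * (256 * N) - 2 * N := by exact_mod_cast hc
        have h3 : (j : ℝ) * (254 * N) ≤
            ((Finset.univ.filter fun x => l ≤ f x ∧ f x < u).card : ℝ) := by
          rw [h2]; nlinarith
        convert h3)
    refine (prob_mono hw.piW fun piv h => ?_).trans (key.trans (Real.exp_le_exp.2 ?_))
    · have h1 : (Finset.univ.filter fun i => l ≤ f (piv i) ∧ f (piv i) < u).card ≤ 5000 * j := by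
        omega
      have h2 : ((Finset.univ.filter fun i => l ≤ f (piv i) ∧ f (piv i) < u).card : ℝ) ≤
          5000 * j := by exact_mod_cast h1
      convert h2
    · rw [Finset.card_univ, ← hm_def]
      have h1 : (j : ℝ) * 9900 ≤ j * (254 * N) / n * m := by
        rw [div_mul_eq_mul_div, le_div_iff₀ hn]
        nlinarith
      simp only [Nat.cast_ofNat]
      nlinarith
  have hmn : m * N / n ≤ 20000 / 256 := by
    rw [div_le_iff₀ hn]; linarith
  have b1 : prob (piW J (unifW V)) (fun piv => ¬ (8 * (Finset.univ.filter fun i =>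
      sdist f (piv i) ≤ (2 * N : ℕ)).card ≤ 10000)) ≤ 1 / 800 := by
    refine (prob_mono hw.piW fun piv h => ?_).trans ((hup (2 * N) 1250).trans
      ((Real.exp_le_exp.2 (show _ ≤ -((10 : ℕ) : ℝ) from ?_)).trans ((exp_neg_le_pow 10).trans
        (by norm_num))))
    · have h1 : 1250 ≤ (Finset.univ.filter fun i => sdist f (piv i) ≤ (2 * N : ℕ)).card := by
        omega
      exact_mod_cast h1
    · have h2 : 2 * ((2 * N : ℕ) : ℝ) * m / n = 4 * (m * N / n) := by push_cast; ring
      rw [h2]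
      push_cast
      linarith
  have b2 : prob (piW J (unifW V)) (fun piv => ∃ j ∈ Finset.Icc 1 L, ¬ ((Finset.univ.filter fun i =>
      sdist f (piv i) ≤ ((j + 1) * (256 * N) : ℕ)).card ≤ 320000 * j)) ≤
      2 * Real.exp (-(400 : ℕ)) := by
    refine (prob_exists_le hw.piW _ _).trans ((Finset.sum_le_sum fun j hj => ?_).trans
      (sum_Icc_exp_pow_le (m := 400) (by norm_num) L))
    have hj' : (1 : ℝ) ≤ j := by exact_mod_cast (Finset.mem_Icc.1 hj).1
    refine (prob_mono hw.piW fun piv h => ?_).trans ((hup ((j + 1) * (256 * N)) (320000 * j)).trans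
      (Real.exp_le_exp.2 ?_))
    · have h1 := (not_le.1 h).le
      exact_mod_cast h1
    · have h2 : 2 * (((j + 1) * (256 * N) : ℕ) : ℝ) * m / n = 512 * (j + 1) * (m * N / n) := by
        push_cast; ring
      rw [h2]
      simp only [Nat.cast_ofNat]
      nlinarith
  have b3 : prob (piW J (unifW V)) (fun piv => ∃ j ∈ Finset.Icc 1 L,
      ((j * (256 * N) : ℕ) : ℤ) ≤ a ∧ ¬ (10000 * j ≤
      2 * (Finset.univ.filter fun i => -((j * (256 * N) : ℕ) : ℤ) + N ≤ f (piv i) ∧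
      f (piv i) < -N).card)) ≤ 2 * Real.exp (-(400 : ℕ)) := by
    refine (prob_exists_le hw.piW _ _).trans ((Finset.sum_le_sum fun j hj => ?_).trans
      (sum_Icc_exp_pow_le (m := 400) (by norm_num) L))
    have hj1 := (Finset.mem_Icc.1 hj).1
    have hjM : 256 * N ≤ j * (256 * N) := Nat.le_mul_of_pos_left _ hj1
    by_cases hc : ((j * (256 * N) : ℕ) : ℤ) ≤ a
    · refine (prob_mono hw.piW fun piv h => h.2).trans ?_
      exact hlow j hj1 _ _ (by omega) (by omega) (by omega) (by ring)
    · refine (prob_mono hw.piW (T := fun _ => False) fun piv h => hc h.1).trans ?_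
      rw [prob_false]
      exact (Real.exp_pos _).le
  have b4 : prob (piW J (unifW V)) (fun piv => ∃ j ∈ Finset.Icc 1 L,
      ((j * (256 * N) : ℕ) : ℤ) ≤ b ∧ ¬ (10000 * j ≤
      2 * (Finset.univ.filter fun i => (N : ℤ) ≤ f (piv i) ∧
      f (piv i) < ((j * (256 * N) : ℕ) : ℤ) - N).card)) ≤ 2 * Real.exp (-(400 : ℕ)) := by
    refine (prob_exists_le hw.piW _ _).trans ((Finset.sum_le_sum fun j hj => ?_).trans
      (sum_Icc_exp_pow_le (m := 400) (by norm_num) L))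
    have hj1 := (Finset.mem_Icc.1 hj).1
    have hjM : 256 * N ≤ j * (256 * N) := Nat.le_mul_of_pos_left _ hj1
    by_cases hc : ((j * (256 * N) : ℕ) : ℤ) ≤ b
    · refine (prob_mono hw.piW fun piv h => h.2).trans ?_
      exact hlow j hj1 _ _ (by omega) (by omega) (by omega) (by ring)
    · refine (prob_mono hw.piW (T := fun _ => False) fun piv h => hc h.1).trans ?_
      rw [prob_false]
      exact (Real.exp_pos _).le
  have hnum : Real.exp (-(400 : ℕ)) ≤ 1 / 800 := by
    have h2 : (1 / 2.7 : ℝ) ^ 400 ≤ (1 / 2.7 : ℝ) ^ 10 :=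
      pow_le_pow_of_le_one (by norm_num) (by norm_num) (by norm_num)
    have h3 : (1 / 2.7 : ℝ) ^ 10 ≤ 1 / 800 := by norm_num
    exact (exp_neg_le_pow 400).trans (h2.trans h3)
  refine (prob_mono hw.piW fun piv he => ?_).trans ((prob_or_le hw.piW _ _).trans
    ((add_le_add ((prob_or_le hw.piW _ _).trans (add_le_add b1 b2))
      ((prob_or_le hw.piW _ _).trans (add_le_add b3 b4))).trans (by linarith)))
  by_contra hnn
  obtain ⟨h12, h34⟩ := not_or.1 hnn
  obtain ⟨h1, h2⟩ := not_or.1 h12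
  obtain ⟨h3, h4⟩ := not_or.1 h34
  refine he ⟨?_, ?_, ?_, ?_⟩
  · convert not_not.1 h1
  · intro j hj
    by_contra hc
    exact h2 ⟨j, hj, by convert hc⟩
  · intro j hj hja
    by_contra hc
    exact h3 ⟨j, hj, hja, by convert hc⟩
  · intro j hj hja
    by_contra hc
    exact h4 ⟨j, hj, hja, by convert hc⟩

variable [DecidableEq V]

open scoped Classical in
/-- The estimated signed ranks of the pivots, from their comparisons with all items. -/
noncomputable def rankEst (η : ℝ) (a : ℤ) (piv : J → V) (z : V → J → Bool) (i : J) : ℝ :=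
  (((Finset.univ.filter fun x => x ≠ piv i ∧ z x i = true).card : ℝ) -
    η * (Fintype.card V - 1)) / (1 - 2 * η) - a

/-- The number of items reported above a pivot of true position `ρ` has mean `(1 - 2 * η) * ρ + η *
(n - 1)`, which `rankEst` inverts. Since `η ≤ 1 / 4`, an estimate off by `N` means a sum off by at
least `N / 2`. -/
theorem prob_rankEst [Nonempty V] {N : ℕ} (hN : 1 ≤ N) (hNn : N ≤ 4 * Fintype.card V) {a b : ℤ}
    {f : V → ℤ} (hf : IsRanking a b f) (piv : J → V) (z : (V → J → Bool) → V → J → Bool)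
    (hobs : ∀ e x i, piv i ≠ x → z e x i = (decide (f x < f (piv i)) ^^ e x i))
    {η : ℝ} (h0 : 0 ≤ η) (hη : η ≤ 1 / 4)
    (hm : 2 * (Fintype.card J : ℝ) *
      Real.exp (-((N : ℝ) ^ 2 / (16 * Fintype.card V))) ≤ 1 / 100) :
    prob (piW V (piW J (coinW η))) (fun e => ¬ ∀ i, |rankEst η a piv (z e) i - f (piv i)| ≤ N) ≤
      1 / 100 := by
  classical
  have hc : IsWeight (coinW η) := isWeight_coinW h0 (by linarith)
  have hw : IsWeight (piW J (coinW η)) := hc.piW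
  have hn : (0 : ℝ) < Fintype.card V := by exact_mod_cast Fintype.card_pos
  have hN' : (1 : ℝ) ≤ N := by exact_mod_cast hN
  set n : ℝ := (Fintype.card V : ℝ) with hn_def
  -- The effect of an error at `x` on the count: `-1` if `x` is above the pivot, `1` if below, `0`
  -- for the pivot itself.
  let sgn : J → V → ℝ := fun i x =>
    (if x ≠ piv i then 1 else 0) - 2 * (if f x < f (piv i) then 1 else 0)
  have hsgn : ∀ i x, |sgn i x| ≤ 1 := by
    intro i x
    simp only [sgn]
    by_cases h1 : x = piv i
    · subst h1; simp
    · by_cases h2 : f x < f (piv i) <;> simp [h1, h2] <;> norm_num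
  let h : J → V → (J → Bool) → ℝ := fun i x r => sgn i x * ((if r i = true then 1 else 0) + -η)
  have hdev : ∀ i, prob (piW V (piW J (coinW η))) (fun e => (N : ℝ) / 2 ≤ |∑ x, h i x (e x)|) ≤
      2 * Real.exp (-((N : ℝ) ^ 2 / (16 * n))) := by
    intro i
    have hNn' : (N : ℝ) ≤ 4 * n := by
      have : (N : ℝ) ≤ ((4 * Fintype.card V : ℕ) : ℝ) := by exact_mod_cast hNn
      rw [hn_def]; push_cast at this; exact this
    -- The choice `l = N / (4 * n)` minimizes `-(l * N / 2) + l ^ 2 * n`, with value `-N ^ 2 / (16 *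
    -- n)`.
    refine (deviation_bound hw (h i) (fun x r => ?_) (fun x => ?_) (l := N / (4 * n))
      (r := N / 2) (by positivity) (by rw [div_le_one (by positivity)]; exact hNn')).trans
      (le_of_eq ?_)
    · simp only [h]
      rw [abs_mul]
      have h1 : |((if r i = true then (1 : ℝ) else 0) + -η)| ≤ 1 := by
        rw [abs_le]; split_ifs <;> constructor <;> linarith
      calc _ ≤ 1 * 1 := mul_le_mul (hsgn i x) h1 (abs_nonneg _) zero_le_one
        _ = 1 := one_mul 1
    · simp only [h]
      rw [expect_const_mul, expect_add, expect_const hw,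
        ← prob_eq_expect _ (fun r : J → Bool => r i = true),
        prob_piW_apply hc i (fun c => c = true), prob_coinW]
      ring
    · rw [← hn_def]
      congr 2
      field_simp
      ring
  refine (prob_mono hw.piW (T := fun e => ∃ i ∈ (Finset.univ : Finset J),
    (N : ℝ) / 2 ≤ |∑ x, h i x (e x)|) fun e he => ?_).trans ((prob_exists_le hw.piW _ _).trans
      ((Finset.sum_le_sum fun i _ => hdev i).trans ?_))
  · obtain ⟨i, hi⟩ := not_forall.1 he
    refine ⟨i, Finset.mem_univ _, ?_⟩
    have hρ : (∑ x, if f x < f (piv i) then (1 : ℝ) else 0) = f (piv i) + a := by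
      have h1 := hf.card_interval (l := -a) (u := f (piv i)) le_rfl (hf.lower _) (hf.upper _).le
      have h2 : (Finset.univ.filter fun x => -a ≤ f x ∧ f x < f (piv i)) =
          Finset.univ.filter fun x => f x < f (piv i) :=
        Finset.filter_congr fun x _ => ⟨fun h => h.2, fun h => ⟨hf.lower x, h⟩⟩
      rw [h2] at h1
      rw [Finset.sum_boole]
      have h3 : (((Finset.univ.filter fun x => f x < f (piv i)).card : ℤ) : ℝ) =
          ((f (piv i) - -a : ℤ) : ℝ) := by rw [h1]
      push_cast at h3
      rw [h3]; ring
    have hne : (∑ x, if x ≠ piv i then (1 : ℝ) else 0) = n - 1 := by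
      have h1 : ∀ x, (if x ≠ piv i then (1 : ℝ) else 0) = 1 - if x = piv i then 1 else 0 := by
        intro x; by_cases hx : x = piv i <;> simp [hx]
      simp only [h1]
      rw [Finset.sum_sub_distrib]
      simp [hn_def]
    have hS : ((Finset.univ.filter fun x => x ≠ piv i ∧ z e x i = true).card : ℝ) =
        ∑ x, ((if f x < f (piv i) then (1 : ℝ) else 0) +
          sgn i x * (if e x i = true then 1 else 0)) := by
      rw [← Finset.sum_boole]
      refine Finset.sum_congr rfl fun x _ => ?_
      by_cases hx : x = piv i
      · subst hx; simp [sgn]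
      · rw [hobs e x i (fun h' => hx h'.symm)]
        by_cases h1 : f x < f (piv i) <;> by_cases h2 : e x i = true <;>
          simp [sgn, hx, h1, h2] <;> norm_num
    have hsum : ∑ x, h i x (e x) = (1 - 2 * η) * (rankEst η a piv (z e) i - f (piv i)) := by
      have h1 : ∑ x, h i x (e x) =
          (∑ x, sgn i x * (if e x i = true then 1 else 0)) - η * ∑ x, sgn i x := by
        rw [Finset.mul_sum, ← Finset.sum_sub_distrib]
        exact Finset.sum_congr rfl fun x _ => by simp only [h]; ring
      have h2 : ∑ x, sgn i x = (n - 1) - 2 * (f (piv i) + a) := by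
        simp only [sgn]
        rw [Finset.sum_sub_distrib, ← Finset.mul_sum, hne, hρ]
      have h3 : ∑ x, sgn i x * (if e x i = true then 1 else 0) =
          ((Finset.univ.filter fun x => x ≠ piv i ∧ z e x i = true).card : ℝ) -
            (f (piv i) + a) := by
        rw [hS, Finset.sum_add_distrib, hρ]; ring
      have h4 : (1 - 2 * η) * rankEst η a piv (z e) i =
          ((Finset.univ.filter fun x => x ≠ piv i ∧ z e x i = true).card : ℝ) - η * (n - 1) -
            (1 - 2 * η) * a := by
        unfold rankEst
        have h5 : (1 - 2 * η) ≠ 0 := by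
          have : 0 < 1 - 2 * η := by linarith
          exact this.ne'
        rw [mul_sub, mul_div_cancel₀ _ h5]
      rw [mul_sub, h4, h1, h2, h3]
      ring
    rw [hsum, abs_mul, abs_of_nonneg (by linarith : 0 ≤ 1 - 2 * η)]
    have := not_le.1 hi
    nlinarith
  · rw [Finset.sum_const, nsmul_eq_mul, Finset.card_univ]
    linarith

end Pivots

/-! ### Rearranging independent coordinates -/

namespace FinProb

variable {Ω Ω' : Type*} [Fintype Ω] [Fintype Ω'] {w : Ω → ℝ} {w' : Ω' → ℝ}

theorem prob_equiv (e : Ω ≃ Ω') (hw : ∀ ω, w ω = w' (e ω)) (S : Ω' → Prop) :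
    prob w (fun ω => S (e ω)) = prob w' S :=
  Fintype.sum_equiv e _ _ fun ω => by rw [hw]

variable {α β γ δ : Type*} [Fintype α] [Fintype β] [Fintype γ] [Fintype δ]

theorem prob_piW_prod [DecidableEq α] [DecidableEq β] (S : (α → β → γ) → Prop) (u : γ → ℝ) :
    prob (piW (α × β) u) (fun e => S fun a b => e (a, b)) = prob (piW α (piW β u)) S :=
  prob_equiv (Equiv.curry α β γ)
    (fun ω => Fintype.prod_prod_type fun p => u (ω p)) S

theorem prob_piW_sum [DecidableEq α] [DecidableEq β] (S : (α → γ) × (β → γ) → Prop) (u : γ → ℝ) :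
    prob (piW (α ⊕ β) u) (fun e => S (fun a => e (.inl a), fun b => e (.inr b))) =
      prob (prodW (piW α u) (piW β u)) S :=
  prob_equiv (Equiv.sumArrowEquivProdArrow α β γ)
    (fun ω => Fintype.prod_sum_type fun p => u (ω p)) S

theorem prob_piW_prod_sum [DecidableEq α] [DecidableEq β]
    (S : (α → β → γ) × (α → β → γ) → Prop) (u : γ → ℝ) :
    prob (piW ((α × β) ⊕ (α × β)) u)
        (fun e => S (fun a b => e (.inl (a, b)), fun a b => e (.inr (a, b)))) =
      prob (prodW (piW α (piW β u)) (piW α (piW β u))) S := by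
  refine (prob_piW_sum (fun e : (α × β → γ) × (α × β → γ) =>
    S (fun a b => e.1 (a, b), fun a b => e.2 (a, b))) u).trans ?_
  refine prob_equiv ((Equiv.curry α β γ).prodCongr (Equiv.curry α β γ)) (fun ω => ?_) S
  exact congrArg₂ (· * ·) (Fintype.prod_prod_type fun p => u (ω.1 p))
    (Fintype.prod_prod_type fun p => u (ω.2 p))

theorem prob_piW_prodW [DecidableEq α] (S : (α → β) × (α → γ) → Prop) (u : β → ℝ) (v : γ → ℝ) :
    prob (piW α (prodW u v)) (fun e => S (fun a => (e a).1, fun a => (e a).2)) =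
      prob (prodW (piW α u) (piW α v)) S :=
  prob_equiv (Equiv.arrowProdEquivProdArrow α (fun _ => β) (fun _ => γ))
    (fun _ => Finset.prod_mul_distrib) S

theorem prob_prodW_congr_right {u : α → ℝ} {v : β → ℝ} {v' : γ → ℝ} (S : α × β → Prop)
    (T : α × γ → Prop)
    (h : ∀ a, prob v (fun b => S (a, b)) = prob v' (fun c => T (a, c))) :
    prob (prodW u v) S = prob (prodW u v') T := by
  rw [prob_prodW, prob_prodW]
  simp only [h]

/-- Labels together with errors on all pairs, read column by column. -/
theorem prob_columns [DecidableEq α] (S : (α → β) × (α → α → γ) → Prop) (u : β → ℝ)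
    (v : γ → ℝ) :
    prob (prodW (piW α u) (piW (α × α) v)) (fun x => S (x.1, fun y x' => x.2 (x', y))) =
      prob (piW α (prodW u (piW α v))) (fun ω => S (fun y => (ω y).1, fun y => (ω y).2)) := by
  rw [prob_piW_prodW]
  refine prob_prodW_congr_right _ _ fun l => ?_
  rw [← prob_piW_prod]
  exact prob_equiv (Equiv.arrowCongr (Equiv.prodComm α α) (Equiv.refl γ))
    (fun ω => Fintype.prod_equiv (Equiv.prodComm α α) (fun p => v (ω p)) (fun p => v (ω p.swap))
      fun p => by simp)
    (fun e => S (l, fun y x' => e (y, x')))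

/-- Puts the randomness in the order of conditioning: pivots, first-round errors, then labels and
second-round errors. The labels are seeds, but play no role before the second round. -/
theorem prob_prodW_middle_swap {u₁ : α → ℝ} {u₂ : β → ℝ} {u₃ : γ → ℝ} {u₄ : δ → ℝ}
    (S : (α × β) × (γ × δ) → Prop) :
    prob (prodW (prodW u₁ u₂) (prodW u₃ u₄)) S =
      prob (prodW u₁ (prodW u₃ (prodW u₂ u₄))) (fun x => S ((x.1, x.2.2.1), (x.2.1, x.2.2.2))) :=
  (prob_equiv (w := prodW u₁ (prodW u₃ (prodW u₂ u₄))) (w' := prodW (prodW u₁ u₂) (prodW u₃ u₄))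
    ⟨fun x => ((x.1, x.2.2.1), (x.2.1, x.2.2.2)), fun x => (x.1.1, (x.2.1, (x.1.2, x.2.2))),
      fun _ => rfl, fun _ => rfl⟩ (fun x => by simp only [prodW, Equiv.coe_fn_mk]; ring) S).symm

end FinProb

/-! ### The decoder -/

namespace TopK

open FinProb Decoding Simulation Pivots

/-- The signed rank of an item, relative to the boundary of the top-`k` set. -/
def signedRank {n : ℕ} (σ : Equiv.Perm (Fin n)) (k : ℕ) (x : Fin n) : ℤ := ((σ x : ℕ) : ℤ) - k

theorem isRanking_signedRank {n k : ℕ} (σ : Equiv.Perm (Fin n)) :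
    IsRanking (k : ℤ) ((n : ℤ) - k) (signedRank σ k) where
  inj x y h := by
    simp only [signedRank] at h
    exact σ.injective (Fin.ext (by omega))
  lower x := by simp only [signedRank]; omega
  upper x := by have := (σ x).isLt; simp only [signedRank]; omega
  surj z h1 h2 := by
    refine ⟨σ.symm ⟨(z + k).toNat, by omega⟩, ?_⟩
    simp only [signedRank, Equiv.apply_symm_apply]
    omega

theorem signedRank_lt {n k : ℕ} (σ : Equiv.Perm (Fin n)) (x y : Fin n) :
    signedRank σ k x < signedRank σ k y ↔ σ x < σ y := by
  simp only [signedRank, Fin.lt_def]; omega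

theorem signedRank_neg {n k : ℕ} (σ : Equiv.Perm (Fin n)) (x : Fin n) :
    signedRank σ k x < 0 ↔ (σ x : ℕ) < k := by
  simp only [signedRank]; omega

open scoped Classical in
/-- The top-`k` set of some order that is consistent with the data. -/
noncomputable def decode {n : ℕ} (k N L : ℕ) (lev : Fin n → ℕ) (side : Fin n → Prop)
    (label : Fin n → Fin (2 ^ L)) (R : Fin n → Fin n → Prop) : Finset (Fin n) :=
  if h : ∃ π : Equiv.Perm (Fin n),
      Consistent N L lev side (Sampled label) R k ((n : ℤ) - k) (signedRank π k) then
    topK h.choose k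
  else ∅

theorem decode_eq {n k N L : ℕ} (hL : 1 ≤ L) (hN : 32 ≤ N) {lev : Fin n → ℕ} {side : Fin n → Prop}
    {label : Fin n → Fin (2 ^ L)} {R : Fin n → Fin n → Prop} {σ : Equiv.Perm (Fin n)}
    (h : Consistent N L lev side (Sampled label) R k ((n : ℤ) - k) (signedRank σ k)) :
    decode k N L lev side label R = topK σ k := by
  have h' : ∃ π : Equiv.Perm (Fin n),
      Consistent N L lev side (Sampled label) R k ((n : ℤ) - k) (signedRank π k) := ⟨σ, h⟩
  unfold decode
  rw [dif_pos h']
  ext x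
  simp only [topK, Finset.mem_filter, Finset.mem_univ, true_and]
  rw [← signedRank_neg, ← signedRank_neg]
  exact neg_iff_of_consistent hL (sampled_zero label) (by exact_mod_cast hN)
    (isRanking_signedRank _) (isRanking_signedRank _) h'.choose_spec h x

open scoped Classical in
-- Quantifying over every `q` that contains the required comparisons covers both the comparison of
-- all pairs and the capped second round.
theorem prob_decode_ne {n k N L : ℕ} (hk : k ≤ n) (hL : 1 ≤ L) (hN : 32 ≤ N) {B ε η : ℝ}
    (hB2 : 2 ≤ B) (hB : B ≤ 100000) (h0 : 0 ≤ η) (h1 : η ≤ 1) (hη : Real.exp 672 * η * B ≤ 1)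
    (σ : Equiv.Perm (Fin n)) {lev : Fin n → ℕ} {side : Fin n → Prop}
    (hg : GoodLevels N L B ε lev side (signedRank σ k)) :
    prob (prodW (piW (Fin n) (unifW (Fin (2 ^ L)))) (piW (Fin n × Fin n) (coinW η)))
      (fun x => ¬ ∀ q : Fin n × Fin n → Prop, (∀ p ∈ secondQueries lev x.1, q p) →
        decode k N L lev side x.1
          (fun u v => observed σ id (fun i => q i ∧ i.1 ≠ i.2) x.2 (u, v) = true) =
            topK σ k) ≤ 3 * ε + 1 / 100 := by
  have hw : IsWeight (prodW (piW (Fin n) (unifW (Fin (2 ^ L))))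
      (piW (Fin n × Fin n) (coinW η))) :=
    (isWeight_unifW _).piW.prodW (isWeight_coinW h0 h1).piW
  have key := second_round hL hB2 hB h0 h1 hη (Nat.cast_nonneg k)
    (sub_nonneg.2 (Nat.cast_le.2 hk)) (isRanking_signedRank σ) hg
  unfold columnW at key
  rw [← prob_columns (fun p => ¬ ∀ R : Fin n → Fin n → Prop,
      (∀ x y, lev x < L → lev y = 0 → Sampled p.1 (lev x) y → y ≠ x →
        ((R x y ↔ ¬ signedRank σ k x < signedRank σ k y) ↔ p.2 y x = true)) →
      Consistent N L lev side (Sampled p.1) R k ((n : ℤ) - k) (signedRank σ k))] at key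
  refine (prob_mono hw fun x h => ?_).trans key
  refine fun h' => h fun q hq => ?_
  refine decode_eq hL hN (h' _ fun u v hu hv hs hne => ?_)
  have h2 : q (u, v) := hq _ (by
    simp only [secondQueries, Finset.mem_filter, Finset.mem_univ, true_and]
    exact ⟨hu, hv, hs⟩)
  have h3 : observed σ id (fun i => q i ∧ i.1 ≠ i.2) x.2 (u, v) =
      (decide (σ u < σ v) ^^ x.2 (u, v)) := by
    simp only [observed, id]
    rw [if_pos ⟨h2, hne.symm⟩]
  change _ ↔ x.2 (u, v) = true
  rw [signedRank_lt, h3]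
  by_cases h4 : σ u < σ v <;> cases x.2 (u, v) <;> simp [h4]

end TopK

/-! ### The algorithms, with their parameters left open -/

namespace TopK

open FinProb Decoding Simulation Pivots

theorem exists_repetitions : ∃ c, Odd c ∧ Real.exp 672 * majorityError c * 4000 ≤ 1 ∧
    majorityError c * 1000000 ≤ 1 ∧ majorityError c ≤ 1 / 4 := by
  obtain ⟨c, hc, h⟩ := exists_majorityError_le
    (ε := (Real.exp 672 * 1000000)⁻¹) (by positivity)
  have h0 := majorityError_nonneg c
  have h1 : (1 : ℝ) ≤ Real.exp 672 := Real.one_le_exp (by norm_num)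
  have h2 : majorityError c * (Real.exp 672 * 1000000) ≤ 1 := by
    rwa [← le_div_iff₀ (by positivity), one_div]
  have h3 : 0 ≤ (Real.exp 672 - 1) * majorityError c := mul_nonneg (by linarith) h0
  have h4 : 0 ≤ Real.exp 672 * majorityError c := by positivity
  refine ⟨c, hc, ?_, ?_, ?_⟩ <;> linarith

/-- With all items in the core there are no ring items, so the risk is zero; the summand `32` only
serves the lower bound on `N` needed for decoding. -/
theorem goodLevels_zero {n k : ℕ} (σ : Equiv.Perm (Fin n)) :
    GoodLevels (n + 32) 1 2 0 (fun _ => 0) (fun _ => False) (signedRank σ k) where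
  few_outer D h1 _ := by simp; omega
  few_wrong := by simp; omega
  resolved v h := absurd h (by norm_num)
  core_card := by simp; linarith [Nat.cast_nonneg (α := ℝ) n]
  outer_weight := by simp; linarith [Nat.cast_nonneg (α := ℝ) n]
  risk := by simp

open scoped Classical in
/-- Decoding from the comparisons of all pairs. -/
noncomputable def decodeAll {n : ℕ} (k : ℕ) (label : Fin n → Fin (2 ^ 1))
    (z : Fin n × Fin n → Bool) : Finset (Fin n) :=
  decode k (n + 32) 1 (fun _ => 0) (fun _ => False) label (fun u v => z (u, v) = true)

open scoped Classical in
theorem prob_decodeAll_ne {n k : ℕ} (hk : k ≤ n) {η : ℝ} (h0 : 0 ≤ η) (h1 : η ≤ 1)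
    (hη : Real.exp 672 * η * 2 ≤ 1) (σ : Equiv.Perm (Fin n)) :
    prob (prodW (piW (Fin n) (unifW (Fin (2 ^ 1)))) (piW (Fin n × Fin n) (coinW η)))
      (fun x => decodeAll k x.1 (observed σ id (fun i => i.1 ≠ i.2) x.2) ≠ topK σ k) ≤ 1 / 3 := by
  have hw : IsWeight (prodW (piW (Fin n) (unifW (Fin (2 ^ 1))))
      (piW (Fin n × Fin n) (coinW η))) :=
    (isWeight_unifW _).piW.prodW (isWeight_coinW h0 h1).piW
  refine (prob_mono hw fun x h => ?_).trans ((prob_decode_ne hk le_rfl (by omega) le_rfl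
    (by norm_num) h0 h1 hη σ (goodLevels_zero σ)).trans (by norm_num))
  intro h'
  refine h ?_
  have := h' (fun _ => True) (fun _ _ => trivial)
  simp only [true_and] at this
  exact this

theorem exists_oneRound_solves {c : ℕ} (hc : Odd c)
    (hη : Real.exp 672 * majorityError c * 4000 ≤ 1) {n k : ℕ} (hk : k ≤ n) :
    ∃ A : RandAlgorithm n 1, A.ComparisonsLE ((c : ℝ) * (n : ℝ) ^ 2) ∧ A.SolvesTopK k := by
  classical
  have h0 := majorityError_nonneg c
  refine exists_oneRound hc (S := Fin n → Fin (2 ^ 1))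
    (w := piW (Fin n) (unifW (Fin (2 ^ 1)))) (isWeight_unifW _).piW (decodeAll k) fun σ => ?_
  refine prob_decodeAll_ne hk h0 (majorityError_le_one c) ?_ σ
  have : 0 ≤ Real.exp 672 * majorityError c := by positivity
  linarith

theorem exists_twoRound_solves_sq {c : ℕ} (hc : Odd c)
    (hη : Real.exp 672 * majorityError c * 4000 ≤ 1) {n k : ℕ} (hk : k ≤ n) :
    ∃ A : RandAlgorithm n 2, A.ComparisonsLE ((c : ℝ) * (n : ℝ) ^ 2) ∧ A.SolvesTopK k := by
  classical
  have h0 := majorityError_nonneg c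
  have he : IsWeight (piW (Fin n × Fin n) (coinW (majorityError c))) :=
    (isWeight_coinW h0 (majorityError_le_one c)).piW
  obtain ⟨A, h1, h2⟩ := exists_twoRound (k := k) hc (S := Fin n → Fin (2 ^ 1))
    (w := piW (Fin n) (unifW (Fin (2 ^ 1)))) (isWeight_unifW _).piW (Z := Fin n × Fin n)
    (fun _ => id) (fun _ _ _ => False) 0 (fun _ _ => by simp) (fun l z _ => decodeAll k l z)
    (fun σ => by
      have h3 : 0 ≤ Real.exp 672 * majorityError c := by positivity
      refine le_trans (le_of_eq ?_) (prob_decodeAll_ne hk h0 (majorityError_le_one c)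
        (by linarith) σ)
      refine prob_prodW_congr_right _ _ fun l => ?_
      exact prob_prodW_fst he
        (fun e => decodeAll k l (observed σ id (fun i => i.1 ≠ i.2) e) ≠ topK σ k))
  refine ⟨A, ?_, h2⟩
  convert h1 using 2
  simp [pow_two]

open scoped Classical in
/-- The two-round algorithm, under explicit conditions on its parameters. -/
theorem exists_twoRound_solves {c : ℕ} (hc : Odd c)
    (hη : Real.exp 672 * majorityError c * 4000 ≤ 1) (hη' : majorityError c * 1000000 ≤ 1)
    (hη4 : majorityError c ≤ 1 / 4) {n k N L m : ℕ} (hk : k ≤ n) (hn : 0 < n) (hN : 32 ≤ N)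
    (hL : 1 ≤ L) (hNn : N ≤ 4 * n)
    (hm1 : (m : ℝ) * (256 * N) ≤ 20000 * n) (hm2 : 10000 * (n : ℝ) ≤ m * (256 * N))
    (hm : 2 * (m : ℝ) * Real.exp (-((N : ℝ) ^ 2 / (16 * n))) ≤ 1 / 100)
    (hnL : (n : ℝ) * Real.exp (-((400 : ℕ) * (L : ℝ))) ≤ 1 / 10000)
    (hnN : (n : ℝ) * Real.exp (-((N : ℝ) / (8 * 2 ^ L))) ≤ 1 / 100) :
    ∃ A : RandAlgorithm n 2,
      A.ComparisonsLE ((c : ℝ) * (2 * n * m + 1600000000 * (N : ℝ) ^ 2)) ∧ A.SolvesTopK k := by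
  have : Nonempty (Fin n) := ⟨⟨0, hn⟩⟩
  have h0 := majorityError_nonneg c
  set η := majorityError c with hη_def
  have h1 : η ≤ 1 := majorityError_le_one c
  have hcoin : IsWeight (coinW η) := isWeight_coinW h0 h1
  let V := Fin n
  let J := Fin m
  -- Two independent copies of the first-round comparisons: one estimates the pivots, the other
  -- determines the levels, so the estimates can be fixed before the errors behind the levels are
  -- drawn.
  let Z := (V × J) ⊕ (V × J)
  let wl : (V → Fin (2 ^ L)) → ℝ := piW V (unifW (Fin (2 ^ L)))
  let wp : (J → V) → ℝ := piW J (unifW V)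
  have hwl : IsWeight wl := (isWeight_unifW _).piW
  have hwp : IsWeight wp := (isWeight_unifW _).piW
  have hwz : IsWeight (piW Z (coinW η)) := hcoin.piW
  have hwe : IsWeight (piW (V × V) (coinW η)) := hcoin.piW
  let idx : Z → V × J := Sum.elim id id
  let pair : (J → V) → Z → V × V := fun piv i => ((idx i).1, piv (idx i).2)
  let lev : (J → V) → (Z → Bool) → V → ℕ := fun piv z =>
    level N L piv (rankEst η k piv fun x i => z (.inl (x, i))) fun x i => z (.inr (x, i))
  let side : (J → V) → (Z → Bool) → V → Prop := fun piv z =>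
    topSide N L piv (rankEst η k piv fun x i => z (.inl (x, i))) fun x i => z (.inr (x, i))
  -- This is `100 * (4000 * N) ^ 2`. If the required comparisons exceed it none is made, so the
  -- worst-case bound holds; Markov's inequality makes this rare.
  let M : ℕ := 1600000000 * N ^ 2
  let query : (J → V) × (V → Fin (2 ^ L)) → (Z → Bool) → V × V → Prop := fun s z p =>
    (secondQueries (lev s.1 z) s.2).card ≤ M ∧ p ∈ secondQueries (lev s.1 z) s.2
  let out : (J → V) × (V → Fin (2 ^ L)) → (Z → Bool) → (V × V → Bool) → Finset V :=
    fun s z z2 => decode k N L (lev s.1 z) (side s.1 z) s.2 (fun u v => z2 (u, v) = true)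
  have hquery : ∀ s z, (Finset.univ.filter (query s z)).card ≤ M := by
    intro s z
    by_cases h : (secondQueries (lev s.1 z) s.2).card ≤ M
    · refine (Finset.card_le_card fun p hp => ?_).trans h
      exact (Finset.mem_filter.1 hp).2.2
    · simp [query, h]
  suffices hout : ∀ σ : Equiv.Perm (Fin n), prob (prodW (prodW wp wl)
      (prodW (piW Z (coinW η)) (piW (V × V) (coinW η)))) (fun x =>
        out x.1 (observed σ (pair x.1.1) (fun i => (pair x.1.1 i).1 ≠ (pair x.1.1 i).2) x.2.1)
          (observed σ id (fun i => query x.1 (observed σ (pair x.1.1)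
            (fun i => (pair x.1.1 i).1 ≠ (pair x.1.1 i).2) x.2.1) i ∧ i.1 ≠ i.2) x.2.2) ≠
          topK σ k) ≤ 1 / 3 by
    obtain ⟨A, hA1, hA2⟩ := exists_twoRound (k := k) hc (hwp.prodW hwl) (fun s => pair s.1)
      query M (fun s z => by convert hquery s z) out (fun σ => by convert hout σ)
    refine ⟨A, ?_, hA2⟩
    convert hA1 using 2
    simp only [Z, V, J, M, Fintype.card_sum, Fintype.card_prod, Fintype.card_fin]
    push_cast
    ring
  intro σ
  rw [prob_prodW_middle_swap]
  set f := signedRank σ k with hf_def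
  have hf : IsRanking (k : ℤ) ((n : ℤ) - k) f := isRanking_signedRank σ
  have hk0 : (0 : ℤ) ≤ k := Nat.cast_nonneg k
  have hk1 : (0 : ℤ) ≤ (n : ℤ) - k := sub_nonneg.2 (Nat.cast_le.2 hk)
  let first : (J → V) → (Z → Bool) → Z → Bool := fun piv e =>
    observed σ (pair piv) (fun i => (pair piv i).1 ≠ (pair piv i).2) e
  have hpiv : prob wp (fun piv => ¬ GoodPivots N L k ((n : ℤ) - k) f piv) ≤ 1 / 100 :=
    prob_not_goodPivots (by omega) hk0 hk1 hf (by simpa [J, V] using hm1)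
      (by simpa [J, V] using hm2)
  have hlev : ∀ piv, GoodPivots N L k ((n : ℤ) - k) f piv → prob (piW Z (coinW η)) (fun e =>
      ¬ GoodLevels N L 4000 (2 / 100) (lev piv (first piv e)) (side piv (first piv e)) f) ≤
      1 / 100 + 3 / 100 := by
    intro piv hp
    let view : (V → J → Bool) → V → J → Bool := fun e x i =>
      if x ≠ piv i then decide (σ x < σ (piv i)) ^^ e x i else false
    have hobs : ∀ e x i, piv i ≠ x → view e x i = (decide (f x < f (piv i)) ^^ e x i) := by
      intro e x i h
      simp only [view]
      rw [if_pos h.symm]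
      congr 2
      exact propext (signedRank_lt σ x (piv i)).symm
    have hre : prob (piW Z (coinW η)) (fun e =>
        ¬ GoodLevels N L 4000 (2 / 100) (lev piv (first piv e)) (side piv (first piv e)) f) =
        prob (prodW (piW V (piW J (coinW η))) (piW V (piW J (coinW η)))) (fun e =>
          ¬ GoodLevels N L 4000 (2 / 100) (level N L piv (rankEst η k piv (view e.1)) (view e.2))
            (topSide N L piv (rankEst η k piv (view e.1)) (view e.2)) f) := by
      exact prob_piW_prod_sum (fun e : (V → J → Bool) × (V → J → Bool) =>
        ¬ GoodLevels N L 4000 (2 / 100) (level N L piv (rankEst η k piv (view e.1)) (view e.2))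
          (topSide N L piv (rankEst η k piv (view e.1)) (view e.2)) f) (coinW η)
    rw [hre]
    refine (prob_prodW_le hcoin.piW.piW hcoin.piW.piW _
      (fun e => ∀ i, |rankEst η k piv (view e) i - f (piv i)| ≤ N) (by norm_num)
      fun e he => ?_).trans (add_le_add ?_ le_rfl)
    · exact prob_not_goodLevels (by omega) hL hf hp he view hobs h0 hη'
        (by simpa [V] using hnL) (by simpa [V] using hnN)
    · exact prob_rankEst (by omega) (by simpa [V] using hNn) hf piv view hobs h0 hη4
        (by simpa [V, J] using hm)
  -- The failure budget: pivots `1 / 100`, estimates `1 / 100`, levels `3 / 100`, cap `1 / 100`,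
  -- decoding `7 / 100`.
  refine (prob_prodW_le hwp (hwz.prodW (hwl.prodW hwe)) _ _
    (ε := 1 / 100 + 3 / 100 + (1 / 100 + (3 * (2 / 100) + 1 / 100))) (by norm_num)
    fun piv hp => ?_).trans ((add_le_add hpiv le_rfl).trans (by norm_num))
  refine (prob_prodW_le hwz (hwl.prodW hwe) _ (fun e => GoodLevels N L 4000 (2 / 100)
    (lev piv (first piv e)) (side piv (first piv e)) f) (by norm_num)
    fun e hg => ?_).trans (add_le_add (hlev piv hp) le_rfl)
  have hq := second_round_queries (B := 4000) (by norm_num) (by omega : 0 < N) hg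
  have hd := prob_decode_ne hk hL hN (by norm_num) (by norm_num) h0 h1 hη σ hg
  rw [← prob_prodW_fst (u := wl) hwe] at hq
  refine le_trans ((prob_mono (hwl.prodW hwe) fun x hx => ?_).trans
    (prob_or_le (hwl.prodW hwe) _ _)) (add_le_add hq hd)
  by_contra hcon
  push Not at hcon
  obtain ⟨hc1, hc2⟩ := hcon
  have h3 : ((secondQueries (lev piv (first piv e)) x.1).card : ℝ) ≤ (M : ℝ) := by
    refine hc1.le.trans (le_of_eq ?_)
    simp only [M]; push_cast; ring
  refine hx ?_
  have h4 := hc2 (query (piv, x.1) (first piv e))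
    fun p hp' => ⟨by exact_mod_cast h3, hp'⟩
  convert h4

end TopK

/-! ### Choice of parameters -/

namespace TopK

open Simulation

theorem pow_mul_exp_neg_le {x y : ℝ} (hy : 0 < y) {d : ℕ} {r : ℝ} (hr : 0 ≤ r)
    (h : x * d.factorial ≤ r * y ^ d) : x * Real.exp (-y) ≤ r := by
  rw [Real.exp_neg, ← div_eq_mul_inv, div_le_iff₀ (Real.exp_pos y)]
  have h1 := Real.pow_div_factorial_le_exp y hy.le d
  have hd : (0 : ℝ) < d.factorial := by exact_mod_cast d.factorial_pos
  refine le_trans ?_ (mul_le_mul_of_nonneg_left h1 hr)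
  rwa [← mul_div_assoc, le_div_iff₀ hd]

/-- Here `a` stands for the cube root of `n`, `N = 100 * a ^ 2` and `2 ^ L` is within a factor two
of `a`. Then `N ^ 2 / n` and `N / 2 ^ L` are both at least of order `a`, and `exp (-400 * L)` is far
below `1 / n`, so all the tails are negligible. -/
theorem exists_twoRound_solves_large {c : ℕ} (hc : Odd c)
    (hη : Real.exp 672 * majorityError c * 4000 ≤ 1) (hη' : majorityError c * 1000000 ≤ 1)
    (hη4 : majorityError c ≤ 1 / 4) {n k a : ℕ} (hk : k ≤ n) (ha : n ≤ a ^ 3)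
    (han : 25600 * a ^ 2 ≤ n) (hn : 0 < n) :
    ∃ A : RandAlgorithm n 2,
      A.ComparisonsLE ((c : ℝ) * (2 * n * a + 16000000000000 * (a : ℝ) ^ 4)) ∧
        A.SolvesTopK k := by
  have ha0 : 0 < a := Nat.pos_of_ne_zero fun h => by subst h; omega
  have ha1 : 25600 ≤ a := by
    have h1 : a ^ 2 * 25600 ≤ a ^ 2 * a := by
      calc a ^ 2 * 25600 = 25600 * a ^ 2 := mul_comm _ _
        _ ≤ a ^ 3 := han.trans ha
        _ = a ^ 2 * a := pow_succ a 2
    exact Nat.le_of_mul_le_mul_left h1 (by positivity)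
  have ra : (25600 : ℝ) ≤ a := by exact_mod_cast ha1
  have ra0 : (0 : ℝ) < a := by linarith
  have rn : (0 : ℝ) < n := by exact_mod_cast hn
  have rna : (n : ℝ) ≤ (a : ℝ) ^ 3 := by exact_mod_cast ha
  have ran : 25600 * (a : ℝ) ^ 2 ≤ n := by exact_mod_cast han
  set L := Nat.log 2 a with hL_def
  have hL1 : 2 ^ L ≤ a := Nat.pow_log_le_self 2 ha0.ne'
  have hL2 : a < 2 ^ (L + 1) := Nat.lt_pow_succ_log_self (by norm_num) a
  have hL : 1 ≤ L := Nat.log_pos (by norm_num) (by omega)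
  have rL1 : (2 : ℝ) ^ L ≤ a := by exact_mod_cast hL1
  have rL2 : (a : ℝ) ≤ 2 * 2 ^ L := by
    have : (a : ℝ) < 2 ^ (L + 1) := by exact_mod_cast hL2
    rw [pow_succ] at this; linarith
  -- The least number of pivots with `10000` per unit on average, the unit being `256 * N = 25600 *
  -- a ^ 2`. Rounding up at most doubles it because a unit has at most `n` items.
  set m := ⌈10000 * (n : ℝ) / (25600 * a ^ 2)⌉₊ with hm_def
  have hpos : (0 : ℝ) < 25600 * a ^ 2 := by positivity
  have hm2 : 10000 * (n : ℝ) ≤ m * (25600 * a ^ 2) := by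
    rw [← div_le_iff₀ hpos]; exact Nat.le_ceil _
  have hm1 : (m : ℝ) * (25600 * a ^ 2) ≤ 20000 * n := by
    have h1 : (m : ℝ) < 10000 * (n : ℝ) / (25600 * a ^ 2) + 1 :=
      Nat.ceil_lt_add_one (by positivity)
    have h2 := mul_le_mul_of_nonneg_right h1.le hpos.le
    rw [add_mul, div_mul_cancel₀ _ hpos.ne'] at h2
    linarith
  have hma : (m : ℝ) ≤ a := by
    have h1 : (m : ℝ) * (25600 * a ^ 2) ≤ a * (25600 * a ^ 2) := by nlinarith
    exact le_of_mul_le_mul_right h1 hpos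
  have hm0 : (0 : ℝ) ≤ m := Nat.cast_nonneg _
  suffices h : _ ∧ _ ∧ _ by
    obtain ⟨A, h1, h2⟩ := exists_twoRound_solves (k := k) (N := 100 * a ^ 2) (L := L) (m := m)
      hc hη hη' hη4 hk hn (by nlinarith) hL (by nlinarith) (by push_cast; linarith)
      (by push_cast; linarith) h.1 h.2.1 h.2.2
    refine ⟨A, fun D hD => (h1 D hD).trans ?_, h2⟩
    refine mul_le_mul_of_nonneg_left ?_ (Nat.cast_nonneg c)
    push_cast
    have : (n : ℝ) * m ≤ n * a := mul_le_mul_of_nonneg_left hma rn.le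
    nlinarith
  refine ⟨?_, ?_, ?_⟩
  · refine pow_mul_exp_neg_le (d := 1) (by positivity) (by norm_num) ?_
    have h1 : 625 * (a : ℝ) ≤ ((100 * a ^ 2 : ℕ) : ℝ) ^ 2 / (16 * n) := by
      rw [le_div_iff₀ (by positivity)]
      push_cast
      calc 625 * (a : ℝ) * (16 * n) = 10000 * a * n := by ring
        _ ≤ 10000 * a * a ^ 3 := by gcongr
        _ = (100 * (a : ℝ) ^ 2) ^ 2 := by ring
    simp only [Nat.factorial_one, Nat.cast_one, mul_one, pow_one]
    linarith
  · have h3 : (8 : ℝ) ^ L ≤ Real.exp (3 * L) := by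
      have h4 : (2 : ℝ) ≤ Real.exp 1 := by have := Real.add_one_le_exp (1 : ℝ); linarith
      have h5 : Real.exp (3 * L) = (Real.exp 1 ^ 3) ^ L := by
        rw [← Real.exp_nat_mul, ← Real.exp_nat_mul]; congr 1; push_cast; ring
      rw [h5]
      refine pow_le_pow_left₀ (by norm_num) ?_ L
      calc (8 : ℝ) = 2 ^ 3 := by norm_num
        _ ≤ Real.exp 1 ^ 3 := pow_le_pow_left₀ (by norm_num) h4 3
    have hLr : (1 : ℝ) ≤ L := by exact_mod_cast hL
    have h6 : (n : ℝ) ≤ 8 * Real.exp (3 * L) := by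
      refine rna.trans ((pow_le_pow_left₀ ra0.le rL2 3).trans ?_)
      rw [mul_pow, ← pow_mul, mul_comm L 3, pow_mul]
      norm_num
      linarith
    have h7 : (8 : ℝ) * Real.exp (-(397 * L)) ≤ 1 / 10000 := by
      refine pow_mul_exp_neg_le (d := 3) (by positivity) (by norm_num) ?_
      have : (397 : ℝ) ^ 3 ≤ (397 * L) ^ 3 := pow_le_pow_left₀ (by norm_num) (by linarith) 3
      norm_num [Nat.factorial] at this ⊢
      linarith
    calc (n : ℝ) * Real.exp (-((400 : ℕ) * (L : ℝ)))
        ≤ 8 * Real.exp (3 * L) * Real.exp (-((400 : ℕ) * (L : ℝ))) :=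
          mul_le_mul_of_nonneg_right h6 (Real.exp_pos _).le
      _ = 8 * Real.exp (-(397 * L)) := by
          rw [mul_assoc, ← Real.exp_add]; congr 2; push_cast; ring
      _ ≤ 1 / 10000 := h7
  · refine pow_mul_exp_neg_le (d := 3) (by positivity) (by norm_num) ?_
    have h1 : 12.5 * (a : ℝ) ≤ ((100 * a ^ 2 : ℕ) : ℝ) / (8 * 2 ^ L) := by
      rw [le_div_iff₀ (by positivity)]
      push_cast
      nlinarith
    have h2 : (12.5 * (a : ℝ)) ^ 3 ≤ (((100 * a ^ 2 : ℕ) : ℝ) / (8 * 2 ^ L)) ^ 3 :=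
      pow_le_pow_left₀ (by positivity) h1 3
    have h3 : (12.5 * (a : ℝ)) ^ 3 = 1953.125 * a ^ 3 := by rw [mul_pow]; norm_num
    have h4 : ((Nat.factorial 3 : ℕ) : ℝ) = 6 := by norm_num [Nat.factorial]
    rw [h4]
    linarith

theorem exists_ceil_cbrt {n : ℕ} (hn : 0 < n) : ∃ a : ℕ, n ≤ a ^ 3 ∧
    (a : ℝ) ≤ 2 * (n : ℝ) ^ ((1 : ℝ) / 3) := by
  have h1 : (1 : ℝ) ≤ (n : ℝ) ^ ((1 : ℝ) / 3) :=
    Real.one_le_rpow (by exact_mod_cast hn) (by norm_num)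
  refine ⟨⌈(n : ℝ) ^ ((1 : ℝ) / 3)⌉₊, ?_, ?_⟩
  · have h2 := pow_le_pow_left₀ (by linarith) (Nat.le_ceil ((n : ℝ) ^ ((1 : ℝ) / 3))) 3
    rw [← Real.rpow_natCast, ← Real.rpow_mul (Nat.cast_nonneg n)] at h2
    norm_num at h2
    exact_mod_cast h2
  · have := Nat.ceil_lt_add_one (by linarith : 0 ≤ (n : ℝ) ^ ((1 : ℝ) / 3))
    linarith

theorem exists_twoRound_solves_rpow {c : ℕ} (hc : Odd c)
    (hη : Real.exp 672 * majorityError c * 4000 ≤ 1) (hη' : majorityError c * 1000000 ≤ 1)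
    (hη4 : majorityError c ≤ 1 / 4) {n k : ℕ} (hk : k ≤ n) :
    ∃ A : RandAlgorithm n 2,
      A.ComparisonsLE ((c : ℝ) * 1000000000000000 * (n : ℝ) ^ ((4 : ℝ) / 3)) ∧
        A.SolvesTopK k := by
  obtain ⟨A, hA1, hA2⟩ := exists_twoRound_solves_sq hc hη hk
  rcases Nat.eq_zero_or_pos n with h0 | hn
  · refine ⟨A, fun D hD => (hA1 D hD).trans ?_, hA2⟩
    subst h0
    simp
  obtain ⟨a, ha1, ha2⟩ := exists_ceil_cbrt hn
  set t : ℝ := (n : ℝ) ^ ((1 : ℝ) / 3) with ht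
  have ht0 : 0 < t := Real.rpow_pos_of_pos (by exact_mod_cast hn) _
  have ht3 : (n : ℝ) = t ^ 3 := by
    rw [ht, ← Real.rpow_natCast, ← Real.rpow_mul (Nat.cast_nonneg n)]; norm_num
  have ht4 : (n : ℝ) ^ ((4 : ℝ) / 3) = t ^ 4 := by
    rw [ht, ← Real.rpow_natCast, ← Real.rpow_mul (Nat.cast_nonneg n)]; norm_num
  have hc0 : (0 : ℝ) ≤ c := Nat.cast_nonneg c
  rw [ht4, mul_assoc]
  have ha3 : (a : ℝ) ^ 2 ≤ 4 * t ^ 2 := by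
    have := pow_le_pow_left₀ (Nat.cast_nonneg a) ha2 2
    rw [mul_pow] at this; linarith
  have ha4 : (a : ℝ) ^ 4 ≤ 16 * t ^ 4 := by
    have := pow_le_pow_left₀ (Nat.cast_nonneg a) ha2 4
    rw [mul_pow] at this; linarith
  -- When a unit exceeds `n`, `n` is bounded by a constant, and comparing all pairs is cheap enough.
  by_cases hsmall : 25600 * a ^ 2 ≤ n
  · obtain ⟨A', h1, h2⟩ := exists_twoRound_solves_large hc hη hη' hη4 hk ha1 hsmall hn
    refine ⟨A', fun D hD => (h1 D hD).trans (mul_le_mul_of_nonneg_left ?_ hc0), h2⟩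
    have h3 : (n : ℝ) * a ≤ t ^ 3 * (2 * t) := by
      rw [ht3]; exact mul_le_mul_of_nonneg_left ha2 (by positivity)
    have h4 : t ^ 3 * (2 * t) = 2 * t ^ 4 := by ring
    have h5 : 0 ≤ t ^ 4 := by positivity
    linarith
  · refine ⟨A, fun D hD => (hA1 D hD).trans (mul_le_mul_of_nonneg_left ?_ hc0), hA2⟩
    have h3 : (n : ℝ) ≤ 25600 * (a : ℝ) ^ 2 := by exact_mod_cast (not_le.1 hsmall).le
    have h4 : t * t ^ 2 ≤ 102400 * t ^ 2 := by
      have : t ^ 3 = t * t ^ 2 := by ring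
      linarith
    have h5 : t ≤ 102400 := le_of_mul_le_mul_right h4 (by positivity)
    have h6 : t ^ 2 ≤ 102400 ^ 2 := pow_le_pow_left₀ ht0.le h5 2
    have h7 : (n : ℝ) ^ 2 = t ^ 2 * t ^ 4 := by rw [ht3]; ring
    rw [h7]
    refine mul_le_mul_of_nonneg_right (h6.trans (by norm_num)) (by positivity)

end TopK

theorem theorem3 :
    (∃ C : ℝ, ∀ n k : ℕ, k ≤ n →
      ∃ A : RandAlgorithm n 1, A.ComparisonsLE (C * (n : ℝ) ^ 2) ∧ A.SolvesTopK k) ∧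
    (∃ C : ℝ, ∀ n k : ℕ, k ≤ n →
      ∃ A : RandAlgorithm n 2,
        A.ComparisonsLE (C * (n : ℝ) ^ ((4 : ℝ) / 3)) ∧ A.SolvesTopK k) := by
  obtain ⟨c, hc, h1, h2, h3⟩ := TopK.exists_repetitions
  exact ⟨⟨c, fun n k hk => TopK.exists_oneRound_solves hc h1 hk⟩,
    ⟨c * 1000000000000000, fun n k hk => TopK.exists_twoRound_solves_rpow hc h1 h2 h3 hk⟩⟩
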